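/- **Setting.** For $f\in\mathcal S'(\mathbb R^3)$ let $\widehat f$ be its Fourier transform, $\widehat f(\xi)=\int e^{-i\xi\cdot x}f(x)\,dx$. For $a\ge 0$, $\sigma\ge 1$, $s\in\mathbb R$ let $\mathcal X^s_{a,\sigma}(\mathbb R^3)$ be the space of those $f\in\mathcal S'(\mathbb R^3)$ with $\widehat f\in L^1_{\rm loc}(\mathbb R^3)$ and $$\|f\|_{\mathcal X^s_{a,\sigma}}=\int_{\mathbb R^3}|\xi|^s e^{a|\xi|^{1/\sigma}}|\widehat f(\xi)|\,d\xi<\infty ,$$ with $|\widehat f(\xi)|$ the Euclidean length for vector fields, and put $\|(u,\theta)\|_{\mathcal X^s_{a,\sigma}}=\|u\|_{\mathcal X^s_{a,\sigma}}+\|\theta\|_{\mathcal X^s_{a,\sigma}}$. Let $\mathbb P$ be the Leray projector, $e_3=(0,0,1)$, and let $e^{-t(-\Delta)^\gamma}$ be the Fourier multiplier $e^{-t|\xi|^{2\gamma}}$. Consider the fractional Boussinesq system on $\mathbb R^3$ with $\mathbb R^3$-valued velocity $u$, real-valued $\theta$, and data $(u_0,\theta_0)$, $\operatorname{div}u_0=0$: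 $$u_t+(-\Delta)^\alpha u+u\cdot\nabla u+\nabla p=\theta e_3,\qquad \theta_t+(-\Delta)^\beta\theta+u\cdot\nabla\theta=0,\qquad \operatorname{div}u=0 .$$ A *mild solution* on $[0,T)$ is a pair $$u\in C([0,T);\mathcal X^s_{a,\sigma})\cap L^1_{\rm loc}([0,T);\mathcal X^{s+2\alpha}_{a,\sigma}),\qquad \theta\in C([0,T);\mathcal X^s_{a,\sigma})\cap L^1_{\rm loc}([0,T);\mathcal X^{s+2\beta}_{a,\sigma})$$ with $\operatorname{div}u(t)=0$ and, for all $t\in[0,T)$, $$u(t)=e^{-t(-\Delta)^\alpha}u_0-\int_0^t e^{-(t-\tau)(-\Delta)^\alpha}\mathbb P(u\cdot\nabla u)\,d\tau+\int_0^t e^{-(t-\tau)(-\Delta)^\alpha}\mathbb P(\theta e_3)\,d\tau,$$ $$\theta(t)=e^{-t(-\Delta)^\beta}\theta_0-\int_0^t e^{-(t-\tau)(-\Delta)^\beta}(u\cdot\nabla\theta)\,d\tau .$$ Here $L^1_{\rm loc}([0,T);X)$ means integrable on $[0,t]$ for every $t<T$. A mild solution on $[0,T^*)$, $T^*>0$,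 is *maximal* if either $T^*=\infty$ or it has no extension to a mild solution on $[0,T')$ with $T'>T^*$. **Theorem 1.4.** Let $\alpha,\beta>\frac12$ and $$(a,s,\sigma)\in\{(0,\infty)\times[-1,0)\times(1,\infty)\}\cup\{[0,\infty)\times\{0\}\times[1,\infty)\}.$$ There is a constant $C>0$, depending only on $a,s,\sigma,\alpha,\beta$, with the following property. Let $(u_0,\theta_0)\in\mathcal X^s_{a,\sigma}(\mathbb R^3)$ with $\operatorname{div}u_0=0$, and let $(u,\theta)$ be a maximal mild solution on $[0,T^*)$ with these data. If $T^*<\infty$, then i) $\displaystyle\limsup_{t\nearrow T^*}\|(u,\theta)(t)\|_{\mathcal X^s_{a,\sigma}}=\infty$; ii) $\displaystyle\int_t^{T^*}\Big[\|(u,\theta)(\tau)\|_{\mathcal X^s_{a,\sigma}}^{\frac{2\alpha}{2\alpha-1}}+\|u(\tau)\|_{\mathcal X^s_{a,\sigma}}^{\frac{2\beta}{2\beta-1}}\Big]d\tau=\infty$ for all $t\in[0,T^*)$; iii) $\displaystyle\|(u,\theta)(t)\|_{\mathcal X^s_{a,\sigma}}^{\frac{2\alpha}{2\alpha-1}}+\|(u,\theta)(t)\|_{\mathcal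 X^s_{a,\sigma}}^{\frac{2\beta}{2\beta-1}}\ge\big[e^{C(T^*-t)}-1\big]^{-1}$ for all $t\in[0,T^*)$. -/

import Mathlib

open MeasureTheory Filter Topology Set
open scoped ENNReal SchwartzMap FourierTransform LineDeriv

noncomputable section

namespace Boussinesq

/-- Physical space, and frequency space, `ℝ³` with its Euclidean norm. -/
abbrev E3 : Type := EuclideanSpace ℝ (Fin 3)

/-- Scalar tempered distributions on `ℝ³`. -/
abbrev Dist : Type := 𝓢'(E3, ℂ)

/-! ### Tempered distributions given by functions -/

/-- The tempered distribution `f` is given by the locally integrable function `F`. -/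
def Represents (f : Dist) (F : E3 → ℂ) : Prop :=
  LocallyIntegrable F volume ∧
    ∀ φ : 𝓢(E3, ℂ), Integrable (fun x => φ x * F x) volume ∧ f φ = ∫ x, φ x * F x

/-- The tempered distribution `f` is a function. -/
def IsFun (f : Dist) : Prop := ∃ F : E3 → ℂ, Represents f F

/-- The function by which the distribution `f` is given (unique up to null sets, see
`Represents.ae_eq`); zero if `f` is not a function. -/
def asFun (f : Dist) : E3 → ℂ :=
  open Classical in if h : IsFun f then h.choose else 0

/-- The tempered distribution given by the function `F`; zero if `F` does not define one. -/
def ofFun (F : E3 → ℂ) : Dist :=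
  open Classical in if h : ∃ f : Dist, Represents f F then h.choose else 0

/-- The function by which a distribution is given is determined almost everywhere. -/
theorem Represents.ae_eq {f : Dist} {F G : E3 → ℂ} (hF : Represents f F) (hG : Represents f G) :
    F =ᵐ[volume] G := by
  have h0 : ∀ᵐ x ∂(volume : Measure E3), (F - G) x = 0 := by
    apply ae_eq_zero_of_integral_contDiff_smul_eq_zero (hF.1.sub hG.1)
    intro g g_smooth g_cpt
    have hg₁ : HasCompactSupport (Complex.ofRealCLM ∘ g) := g_cpt.comp_left rfl
    have hg₂ : ContDiff ℝ (⊤ : ℕ∞) (Complex.ofRealCLM ∘ g) := by fun_prop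
    have h1 := hF.2 (hg₁.toSchwartzMap hg₂)
    have h2 := hG.2 (hg₁.toSchwartzMap hg₂)
    have h3 := integral_sub h1.1 h2.1
    rw [← h1.2, ← h2.2, sub_self] at h3
    rw [← h3]
    congr 1
    ext x
    simp [mul_sub]
  filter_upwards [h0] with x hx
  simpa [sub_eq_zero] using hx

/-- A function determines the distribution that it gives. -/
theorem Represents.unique {f g : Dist} {F : E3 → ℂ} (hf : Represents f F)
    (hg : Represents g F) : f = g := by
  ext φ
  rw [(hf.2 φ).2, (hg.2 φ).2]

/-- The distribution `f` is real-valued. -/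
def IsReal (f : Dist) : Prop :=
  ∀ φ : 𝓢(E3, ℂ), (∀ x, (φ x).im = 0) → (f φ).im = 0

/-! ### The Fourier transform `f̂(ξ) = ∫ exp(-i ξ·x) f(x) dx`

Mathlib's Fourier transform is `𝓕 f(η) = ∫ exp(-2πi η·x) f(x) dx`, so that
`f̂(ξ) = 𝓕 f(ξ / 2π)` and `𝓕 f(η) = f̂(2πη)`. -/

/-- The Fourier transform of `f` is a (locally integrable) function. -/
def HasFunHat (f : Dist) : Prop := IsFun (𝓕 f)

/-- The Fourier transform `f̂`, in the normalization `∫ exp(-i ξ·x) f(x) dx`, as a function. -/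
def hat (f : Dist) : E3 → ℂ := fun ξ => asFun (𝓕 f) ((2 * Real.pi)⁻¹ • ξ)

/-- The tempered distribution whose Fourier transform `f̂` is the function `g`. -/
def ofHat (g : E3 → ℂ) : Dist := 𝓕⁻ (ofFun fun η => g ((2 * Real.pi) • η))

/-! ### Lei-Lin-Gevrey spaces -/

/-- The weight `|ξ|^s exp(a |ξ|^(1/σ))`. -/
def weight (a s σ : ℝ) (ξ : E3) : ℝ := ‖ξ‖ ^ s * Real.exp (a * ‖ξ‖ ^ (1 / σ))

/-- The norm of `X^s_{a,σ}(ℝ³)`, for scalar distributions; it is infinite exactly for the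
distributions that do not belong to the space. -/
def normX (a s σ : ℝ) (f : Dist) : ℝ≥0∞ :=
  open Classical in
  if HasFunHat f then ∫⁻ ξ, ENNReal.ofReal (weight a s σ ξ) * ‖hat f ξ‖ₑ else ⊤

/-- The norm of `X^s_{a,σ}(ℝ³)`, for vector fields: the integral of the weight against the
Euclidean length of `f̂(ξ) ∈ ℂ³`. -/
def normX3 (a s σ : ℝ) (f : Fin 3 → Dist) : ℝ≥0∞ :=
  open Classical in
  if ∀ k, HasFunHat (f k) then
    ∫⁻ ξ, ENNReal.ofReal (weight a s σ ξ) * ‖WithLp.toLp 2 (fun k => hat (f k) ξ)‖ₑ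
  else ⊤

/-- The norm of a pair (velocity, temperature): `‖(u,θ)‖ = ‖u‖ + ‖θ‖`. -/
def normPair (a s σ : ℝ) (u : Fin 3 → Dist) (θ : Dist) : ℝ≥0∞ :=
  normX3 a s σ u + normX a s σ θ

/-! ### The operators in the equations -/

/-- The heat semigroup `exp(-t(-Δ)^γ)`, with Fourier multiplier `exp(-t|ξ|^(2γ))`. -/
def heat (γ t : ℝ) (f : Dist) : Dist :=
  ofHat fun ξ => (Real.exp (-t * ‖ξ‖ ^ (2 * γ)) : ℂ) * hat f ξ

/-- The Leray projector: `(ℙv)^_k(ξ) = v̂_k(ξ) - ξ_k (ξ · v̂(ξ)) / |ξ|²`. -/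
def leray (v : Fin 3 → Dist) : Fin 3 → Dist := fun k =>
  ofHat fun ξ => hat (v k) ξ - (ξ k : ℂ) * (∑ j, (ξ j : ℂ) * hat (v j) ξ) / ((‖ξ‖ ^ 2 : ℝ) : ℂ)

/-- The partial derivative `∂_j` of a tempered distribution. -/
def partialD (j : Fin 3) (f : Dist) : Dist := ∂_{(EuclideanSpace.single j (1 : ℝ) : E3)} f

/-- The divergence. -/
def div3 (u : Fin 3 → Dist) : Dist := ∑ j, partialD j (u j)

/-- The transport term `u · ∇ f = ∑ⱼ uⱼ ∂ⱼ f`, the products being products of functions. -/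
def transport (u : Fin 3 → Dist) (f : Dist) : Dist :=
  ofFun fun x => ∑ j, asFun (u j) x * asFun (partialD j f) x

/-- The vector field `f e₃`. -/
def timesE3 (f : Dist) : Fin 3 → Dist := fun k => if k = 2 then f else 0

/-! ### Mild solutions -/

/-- The integrand `exp(-(t-τ)(-Δ)^α) [ℙ(θe₃)(τ) - ℙ(u·∇u)(τ)]`, for the `k`-th component of the
velocity. -/
def velocityForcing (α : ℝ) (u : ℝ → Fin 3 → Dist) (θ : ℝ → Dist) (t : ℝ) (k : Fin 3) (τ : ℝ) :
    Dist :=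
  heat α (t - τ) (leray (timesE3 (θ τ)) k)
    - heat α (t - τ) (leray (fun i => transport (u τ) (u τ i)) k)

/-- The integrand `-exp(-(t-τ)(-Δ)^β) [u·∇θ](τ)` for the temperature. -/
def temperatureForcing (β : ℝ) (u : ℝ → Fin 3 → Dist) (θ : ℝ → Dist) (t τ : ℝ) : Dist :=
  -heat β (t - τ) (transport (u τ) (θ τ))

/-- `(u, θ)` is a real-valued mild solution on `[0, T)`, with data `(u₀, θ₀)`, of the fractional
Boussinesq equations, in the class
`C([0,T); X^s_{a,σ}) ∩ L¹_loc([0,T); X^{s+2α}_{a,σ})` for `u` and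
`C([0,T); X^s_{a,σ}) ∩ L¹_loc([0,T); X^{s+2β}_{a,σ})` for `θ`.
The time integrals in the mild formulation are integrals of functions with values in `𝓢'`, that
is, they are taken after pairing with an arbitrary test function. -/
structure IsMildSolution (a s σ α β : ℝ) (u₀ : Fin 3 → Dist) (θ₀ : Dist) (T : ℝ)
    (u : ℝ → Fin 3 → Dist) (θ : ℝ → Dist) : Prop where
  real_u : ∀ t ∈ Ico 0 T, ∀ k, IsReal (u t k)
  real_θ : ∀ t ∈ Ico 0 T, IsReal (θ t)
  div_free : ∀ t ∈ Ico 0 T, div3 (u t) = 0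
  mem_u : ∀ t ∈ Ico 0 T, normX3 a s σ (u t) < ⊤
  mem_θ : ∀ t ∈ Ico 0 T, normX a s σ (θ t) < ⊤
  continuous_u : ∀ t ∈ Ico 0 T,
    Tendsto (fun r => normX3 a s σ (u r - u t)) (𝓝[Ico 0 T] t) (𝓝 0)
  continuous_θ : ∀ t ∈ Ico 0 T,
    Tendsto (fun r => normX a s σ (θ r - θ t)) (𝓝[Ico 0 T] t) (𝓝 0)
  integrable_u : ∀ t ∈ Ico 0 T, ∫⁻ τ in Icc 0 t, normX3 a (s + 2 * α) σ (u τ) < ⊤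
  integrable_θ : ∀ t ∈ Ico 0 T, ∫⁻ τ in Icc 0 t, normX a (s + 2 * β) σ (θ τ) < ⊤
  eq_u : ∀ t ∈ Ico 0 T, ∀ k, ∀ φ : 𝓢(E3, ℂ),
    IntervalIntegrable (fun τ => velocityForcing α u θ t k τ φ) volume 0 t ∧
    u t k φ = heat α t (u₀ k) φ + ∫ τ in (0 : ℝ)..t, velocityForcing α u θ t k τ φ
  eq_θ : ∀ t ∈ Ico 0 T, ∀ φ : 𝓢(E3, ℂ),
    IntervalIntegrable (fun τ => temperatureForcing β u θ t τ φ) volume 0 t ∧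
    θ t φ = heat β t θ₀ φ + ∫ τ in (0 : ℝ)..t, temperatureForcing β u θ t τ φ

/-- `(u, θ)` is a maximal mild solution, with maximal time of existence `T < ∞`: it is a mild
solution on `[0, T)`, and no mild solution on a longer interval extends it. -/
structure IsMaximalMildSolution (a s σ α β : ℝ) (u₀ : Fin 3 → Dist) (θ₀ : Dist) (T : ℝ)
    (u : ℝ → Fin 3 → Dist) (θ : ℝ → Dist) : Prop where
  time_pos : 0 < T
  solution : IsMildSolution a s σ α β u₀ θ₀ T u θ
  no_extension : ¬ ∃ T' > T, ∃ (u' : ℝ → Fin 3 → Dist) (θ' : ℝ → Dist),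
    IsMildSolution a s σ α β u₀ θ₀ T' u' θ' ∧ ∀ t ∈ Ico 0 T, u' t = u t ∧ θ' t = θ t

end Boussinesq

end

noncomputable section

/-! ### Tempered distributions given by functions -/

namespace Boussinesq

/-! The norms are weighted `L¹` norms of Fourier transforms, so the system is treated at each
frequency as an equation v' = -|ξ|^(2γ) v + F, the frequencies being coupled only through the
forcing F. Two inequalities for the weight w carry the nonlinear estimates (`GoodWeight`): 1 ≤ C w
away from 0, so that a finite norm makes the transform integrable, and |p+q| w(p+q) ≤ C (|p|+|q|)
w(p) w(q). The second one gives the bilinear bound `GoodWeight.nrm_adv_le`, ‖u·∇v‖ ≤ C (‖u‖₁‖v‖ +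
‖u‖‖v‖₁), where the index 1 stands for one more derivative. The admissible range of (a, s, σ) is
used only in proving these two inequalities.

Duhamel's formula satisfies a smoothing estimate with constant one (`GoodWeight.nrm_Duh_add_le`):
the norm at time t plus the time integral of the norm with 2γ more derivatives is at most the
initial norm plus the integral of the norm of the forcing. As 2γ > 1, Young's inequality bounds
x‖f‖₁ by ε‖f‖_{2γ} + c x^(2γ/(2γ-1)) ‖f‖, and the first term is absorbed. With y = ‖(u,θ)‖, x = ‖u‖,
p = 2α/(2α-1) and q = 2β/(2β-1) this yields (`GoodWeight.exists_energy_le`) y(t) ≤ y(t₀) + K ∫ y (1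
+ y^p + x^q). The summand 1 comes from the buoyancy. The derivative of θ occurs only multiplied by
the norm of u, which is why the exponent q falls on x alone.

Statement ii: if y^p + x^q were integrable up to T*, Grönwall's lemma would bound y, the forcing
would be integrable up to T*, and Duhamel's formula would have a value in the space at T*. Local
existence restarted from that value contradicts maximality. Statement i follows, since a bounded
norm makes the integral in ii finite. Statement iii: if Y is the right-hand side above and Z = Y^p +
Y^q, then Z' ≤ c Z (1+Z) with c = (p+q)K, so exp(-ct) Z/(1+Z) is nonincreasing. Comparing a time t
with times at which the norm is arbitrarily large gives 1 ≤ exp(c(T*-t)) z/(1+z) for z = y(t)^p +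
y(t)^q, which is the claim.

Local existence is a contraction argument whose unknowns are the forcings, in `L¹` of time and
frequency; Duhamel's formula then supplies continuity and smoothing for free. Real-valuedness is a
reflection symmetry on the Fourier side, and uniqueness of the fixed point shows that it is
inherited from the data. The passage between distributions and Fourier side
(`IsMildSolution.exists_isFourierSolution`, `IsFourierSolution.isMildSolution`) consists in checking
that the functions involved are integrable, so that no operator takes its default value, and in
using Fubini's theorem. -/

theorem integrable_schwartz_mul (φ : 𝓢(E3, ℂ)) {G : E3 → ℂ} (hG : Integrable G) :
    Integrable (fun x => φ x * G x) := by
  obtain ⟨C, hC⟩ := φ.decay 0 0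
  refine hG.bdd_mul (c := C) φ.continuous.aestronglyMeasurable (ae_of_all _ fun x => ?_)
  simpa using hC.2 x

theorem exists_represents {G : E3 → ℂ} (hG : Integrable G) : ∃ f : Dist, Represents f G := by
  have : Fact (1 ≤ (1 : ℝ≥0∞)) := ⟨le_rfl⟩
  refine ⟨Lp.toTemperedDistribution (μ := volume) hG.toL1, hG.locallyIntegrable, fun φ =>
    ⟨integrable_schwartz_mul φ hG, ?_⟩⟩
  erw [Lp.toTemperedDistribution_apply]
  apply integral_congr_ae
  filter_upwards [hG.coeFn_toL1] with x hx
  rw [hx, smul_eq_mul]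

theorem Represents.congr {f : Dist} {F G : E3 → ℂ} (hF : Represents f F) (h : F =ᵐ[volume] G) :
    Represents f G := by
  refine ⟨hF.1.congr h, fun φ => ?_⟩
  have h2 : (fun x => φ x * F x) =ᵐ[volume] fun x => φ x * G x := by
    filter_upwards [h] with x hx; rw [hx]
  exact ⟨(hF.2 φ).1.congr h2, (hF.2 φ).2.trans (integral_congr_ae h2)⟩

theorem Represents.ofFun {f : Dist} {F : E3 → ℂ} (hF : Represents f F) : ofFun F = f := by
  have h : ∃ f : Dist, Represents f F := ⟨f, hF⟩
  rw [Boussinesq.ofFun, dif_pos h]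
  exact h.choose_spec.unique hF

theorem Represents.asFun_ae {f : Dist} {F : E3 → ℂ} (hF : Represents f F) :
    asFun f =ᵐ[volume] F := by
  have h : IsFun f := ⟨F, hF⟩
  rw [asFun, dif_pos h]
  exact h.choose_spec.ae_eq hF

theorem represents_asFun {f : Dist} (h : IsFun f) : Represents f (asFun f) := by
  rw [asFun, dif_pos h]
  exact h.choose_spec

theorem Represents.add {f g : Dist} {F G : E3 → ℂ} (hF : Represents f F) (hG : Represents g G) :
    Represents (f + g) (fun x => F x + G x) := by
  refine ⟨hF.1.add hG.1, fun φ => ?_⟩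
  simp only [mul_add]
  exact ⟨(hF.2 φ).1.add (hG.2 φ).1, by
    rw [integral_add (hF.2 φ).1 (hG.2 φ).1, ← (hF.2 φ).2, ← (hG.2 φ).2]; rfl⟩

theorem Represents.const_smul {f : Dist} {F : E3 → ℂ} (hF : Represents f F) (c : ℂ) :
    Represents (c • f) (fun x => c * F x) := by
  refine ⟨hF.1.smul c, fun φ => ?_⟩
  simp only [mul_left_comm _ c]
  exact ⟨(hF.2 φ).1.const_mul c, by
    rw [integral_const_mul, ← (hF.2 φ).2]; rfl⟩

theorem represents_zero : Represents 0 (fun _ => 0) :=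
  ⟨locallyIntegrable_zero, fun φ => ⟨by simp, by simp⟩⟩

/-- Fubini's theorem moves the transform from the test function to `G`. Since `G` is integrable, its
inverse transform is bounded and continuous, so it pairs absolutely with Schwartz functions. -/
theorem Represents.fourierInv {f : Dist} {G : E3 → ℂ} (hf : Represents f G) (hG : Integrable G) :
    Represents (𝓕⁻ f) (𝓕⁻ G : E3 → ℂ) := by
  have hF : (𝓕⁻ G : E3 → ℂ) = fun x => 𝓕 G (-x) := by
    ext x; exact Real.fourierInv_eq_fourier_neg G x
  have hc0 : Continuous (𝓕 G : E3 → ℂ) :=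
    VectorFourier.fourierIntegral_continuous Real.continuous_fourierChar
      (by exact continuous_inner) hG
  have hc : Continuous (𝓕⁻ G : E3 → ℂ) := by
    rw [hF]; exact hc0.comp continuous_neg
  have hb : ∀ x, ‖(𝓕⁻ G : E3 → ℂ) x‖ ≤ ∫ y, ‖G y‖ := fun x => by
    rw [hF]; exact VectorFourier.norm_fourierIntegral_le_integral_norm _ _ _ _ _
  refine ⟨hc.locallyIntegrable, fun φ => ⟨?_, ?_⟩⟩
  · exact φ.integrable.mul_bdd (c := ∫ y, ‖G y‖) hc.aestronglyMeasurable (ae_of_all _ hb)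
  · rw [TemperedDistribution.fourierInv_apply, (hf.2 _).2, hF]
    -- The multiplication formula concerns the forward transform. It is applied to φ(-x), whose
    -- forward transform is `𝓕⁻ φ`; the reflection is undone below by x ↦ -x.
    have h1 := VectorFourier.integral_fourierIntegral_smul_eq_flip (L := innerₗ E3)
      (μ := volume) (ν := volume) (f := fun x => φ (-x)) (g := G) Real.continuous_fourierChar
      (by exact continuous_inner) φ.integrable.comp_neg hG
    have h2 : ∀ ξ, VectorFourier.fourierIntegral Real.fourierChar volume (innerₗ E3)
        (fun x => φ (-x)) ξ = (𝓕⁻ φ : 𝓢(E3, ℂ)) ξ := fun ξ => by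
      rw [SchwartzMap.fourierInv_coe, Real.fourierInv_eq_fourier_comp_neg]; rfl
    simp only [h2, smul_eq_mul] at h1
    rw [h1, flip_innerₗ, ← integral_neg_eq_self]
    simp only [neg_neg]
    rfl

/-! ### Distributions whose Fourier transform is a function -/

/-- The scaled function `g` is the Fourier transform `f̂`. -/
def HatIs (f : Dist) (g : E3 → ℂ) : Prop :=
  Represents (𝓕 f) fun η => g ((2 * Real.pi) • η)

theorem two_pi_ne : (2 * Real.pi : ℝ) ≠ 0 := by positivity

theorem ae_comp_smul {p : E3 → Prop} (h : ∀ᵐ ξ, p ξ) {r : ℝ} (hr : r ≠ 0) : ∀ᵐ ξ, p (r • ξ) :=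
  (Measure.quasiMeasurePreserving_smul (volume : Measure E3) hr).ae h

theorem HatIs.hasFunHat {f : Dist} {g : E3 → ℂ} (h : HatIs f g) : HasFunHat f := ⟨_, h⟩

theorem HatIs.hat_ae {f : Dist} {g : E3 → ℂ} (h : HatIs f g) : hat f =ᵐ[volume] g := by
  have := ae_comp_smul (Represents.asFun_ae h) (inv_ne_zero two_pi_ne)
  filter_upwards [this] with ξ hξ
  rw [hat, hξ, smul_inv_smul₀ two_pi_ne]

theorem HasFunHat.hatIs {f : Dist} (h : HasFunHat f) : HatIs f (hat f) := by
  have h2 := represents_asFun h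
  simpa only [HatIs, hat, inv_smul_smul₀ two_pi_ne] using h2

theorem HatIs.congr {f : Dist} {g g' : E3 → ℂ} (h : HatIs f g) (hg : g =ᵐ[volume] g') :
    HatIs f g' :=
  Represents.congr h (ae_comp_smul hg two_pi_ne)

theorem HatIs.ae_eq {f : Dist} {g g' : E3 → ℂ} (h : HatIs f g) (h' : HatIs f g') :
    g =ᵐ[volume] g' := h.hat_ae.symm.trans h'.hat_ae

theorem HatIs.unique {f f' : Dist} {g : E3 → ℂ} (h : HatIs f g) (h' : HatIs f' g) : f = f' := by
  have := congrArg (fun d : Dist => (𝓕⁻ d : Dist)) (Represents.unique h h')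
  simpa only [FourierTransform.fourierInv_fourier_eq] using this

theorem integrable_comp_two_pi {g : E3 → ℂ} (hg : Integrable g) :
    Integrable fun η => g ((2 * Real.pi) • η) := hg.comp_smul two_pi_ne

/-- Integrability of `g` keeps `ofFun` away from its default value. This is how `heat`, `leray` and
`transport` are shown to act as intended. -/
theorem hatIs_ofHat {g : E3 → ℂ} (hg : Integrable g) : HatIs (ofHat g) g := by
  obtain ⟨f, hf⟩ := exists_represents (integrable_comp_two_pi hg)
  rw [HatIs, ofHat, hf.ofFun, FourierTransform.fourier_fourierInv_eq]
  exact hf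

theorem HatIs.eq_ofHat {f : Dist} {g : E3 → ℂ} (h : HatIs f g) : f = ofHat g := by
  rw [ofHat, Represents.ofFun h, FourierTransform.fourierInv_fourier_eq]

theorem HatIs.add {f f' : Dist} {g g' : E3 → ℂ} (h : HatIs f g) (h' : HatIs f' g') :
    HatIs (f + f') (fun ξ => g ξ + g' ξ) := by
  rw [HatIs, FourierTransform.fourier_add]; exact Represents.add h h'

theorem HatIs.const_smul {f : Dist} {g : E3 → ℂ} (h : HatIs f g) (c : ℂ) :
    HatIs (c • f) (fun ξ => c * g ξ) := by
  rw [HatIs, FourierTransform.fourier_smul]; exact Represents.const_smul h c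

theorem HatIs.neg {f : Dist} {g : E3 → ℂ} (h : HatIs f g) : HatIs (-f) (fun ξ => -g ξ) := by
  have := h.const_smul (-1)
  have h2 : ((-1 : ℂ) • f : Dist) = -f := neg_one_smul ℂ f
  rw [h2] at this
  simpa only [neg_one_mul] using this

theorem HatIs.sub {f f' : Dist} {g g' : E3 → ℂ} (h : HatIs f g) (h' : HatIs f' g') :
    HatIs (f - f') (fun ξ => g ξ - g' ξ) := by
  simpa [sub_eq_add_neg] using h.add h'.neg

theorem hatIs_zero : HatIs 0 (fun _ => 0) := by
  rw [HatIs]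
  have : 𝓕 (0 : Dist) = 0 := by
    simp
  rw [this]; exact represents_zero

theorem HatIs.sum {ι : Type*} (S : Finset ι) {f : ι → Dist} {g : ι → E3 → ℂ}
    (h : ∀ i ∈ S, HatIs (f i) (g i)) : HatIs (∑ i ∈ S, f i) (fun ξ => ∑ i ∈ S, g i ξ) := by
  classical
  induction S using Finset.induction_on with
  | empty => simp [hatIs_zero]
  | insert i S hi ih =>
    simp only [Finset.sum_insert hi]
    exact (h i (by simp)).add (ih fun j hj => h j (by simp [hj]))

theorem HatIs.apply {f : Dist} {g : E3 → ℂ} (h : HatIs f g) (φ : 𝓢(E3, ℂ)) :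
    f φ = ∫ η, (𝓕⁻ φ : 𝓢(E3, ℂ)) η * g ((2 * Real.pi) • η) := by
  rw [← (h.2 _).2, TemperedDistribution.fourier_apply, FourierTransform.fourier_fourierInv_eq]

/-- The factor is the Jacobian of η ↦ 2πη. In this form the pairing with a test function is an
integral over ξ, to which Fubini's theorem in (τ, ξ) can be applied. -/
theorem HatIs.apply' {f : Dist} {g : E3 → ℂ} (h : HatIs f g) (φ : 𝓢(E3, ℂ)) :
    f φ = ∫ ξ, (((2 * Real.pi) ^ 3)⁻¹ : ℝ) • ((𝓕⁻ φ : 𝓢(E3, ℂ)) ((2 * Real.pi)⁻¹ • ξ) * g ξ) := by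
  rw [h.apply, integral_smul]
  have := Measure.integral_comp_smul (volume : Measure E3)
    (fun ξ => (𝓕⁻ φ : 𝓢(E3, ℂ)) ((2 * Real.pi)⁻¹ • ξ) * g ξ) (2 * Real.pi)
  simp only [inv_smul_smul₀ two_pi_ne] at this
  rw [this]
  simp only [finrank_euclideanSpace, Fintype.card_fin]
  rw [abs_of_nonneg (by positivity)]

theorem HatIs.partialD {f : Dist} {g : E3 → ℂ} (h : HatIs f g) (j : Fin 3) :
    HatIs (partialD j f) (fun ξ => Complex.I * (ξ j : ℂ) * g ξ) := by
  rw [HatIs, Boussinesq.partialD, TemperedDistribution.fourier_lineDerivOp_eq]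
  set m : E3 := EuclideanSpace.single j (1 : ℝ)
  have hin : ∀ x : E3, inner ℝ x m = x j := fun x => by
    simp [m, EuclideanSpace.inner_single_right]
  have hmul : ∀ φ : 𝓢(E3, ℂ), ∀ x,
      SchwartzMap.smulLeftCLM ℂ (fun x : E3 => ((inner ℝ x m : ℝ) : ℂ)) φ x = (x j : ℂ) * φ x := by
    intro φ x
    have : (fun x : E3 => inner ℝ x m).HasTemperateGrowth := by fun_prop
    rw [SchwartzMap.smulLeftCLM_apply_apply (by fun_prop)]
    simp [hin]
  have h2 : Represents (TemperedDistribution.smulLeftCLM ℂ (fun x : E3 => ((inner ℝ x m : ℝ) : ℂ))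
      (𝓕 f)) (fun η => (η j : ℂ) * g ((2 * Real.pi) • η)) := by
    refine ⟨?_, fun φ => ?_⟩
    · have hc : Continuous fun η : E3 => (η j : ℂ) := by fun_prop
      rw [locallyIntegrable_iff]
      intro K hK
      exact IntegrableOn.continuousOn_mul hc.continuousOn ((locallyIntegrable_iff.1 h.1) K hK) hK
    · have h3 := h.2 (SchwartzMap.smulLeftCLM ℂ (fun x : E3 => ((inner ℝ x m : ℝ) : ℂ)) φ)
      simp only [hmul] at h3
      rw [TemperedDistribution.smulLeftCLM_apply_apply, h3.2]
      constructor
      · refine h3.1.congr (ae_of_all _ fun x => ?_)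
        simp only []; ring
      · congr 1; ext x; ring
  -- The multiplier 2πi η_j of the unscaled transform is i ξ_j at ξ = 2πη.
  refine (h2.const_smul (2 * Real.pi * Complex.I)).congr (ae_of_all _ fun η => ?_)
  simp only [PiLp.smul_apply, smul_eq_mul, Complex.ofReal_mul, Complex.ofReal_ofNat]
  ring

/-! ### Products and convolutions -/

/-- The inverse Fourier transform of an integrable function, in the normalization of `hat`. -/
def invHat (g : E3 → ℂ) : E3 → ℂ := 𝓕⁻ fun η : E3 => g ((2 * Real.pi) • η)

theorem HatIs.represents {f : Dist} {g : E3 → ℂ} (h : HatIs f g) (hg : Integrable g) :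
    Represents f (invHat g) := by
  have := Represents.fourierInv h (integrable_comp_two_pi hg)
  rwa [FourierTransform.fourierInv_fourier_eq] at this

/-- Convolution with the constant that makes it the Fourier transform of the product. -/
def hconv (g g' : E3 → ℂ) (ξ : E3) : ℂ :=
  (((2 * Real.pi) ^ 3)⁻¹ : ℝ) • ∫ η, g (ξ - η) * g' η

theorem integrable_hconv {g g' : E3 → ℂ} (hg : Integrable g) (hg' : Integrable g') :
    Integrable (hconv g g') := by
  have := hg'.integrable_convolution (.mul ℂ ℂ) hg
  refine (Integrable.smul ((((2 * Real.pi) ^ 3)⁻¹ : ℝ)) this).congr (ae_of_all _ fun ξ => ?_)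
  simp only [hconv, Pi.smul_apply, convolution, ContinuousLinearMap.mul_apply', mul_comm]

/-- The convolution theorem for the dilated functions; the Jacobian of the dilation inside the
convolution is the factor (2π)⁻³ of `hconv`. -/
theorem invHat_mul {g g' : E3 → ℂ} (hg : Integrable g) (hg' : Integrable g') (x : E3) :
    invHat g x * invHat g' x = invHat (hconv g g') x := by
  simp only [invHat, Real.fourierInv_eq_fourier_neg]
  rw [← Real.fourier_mul_convolution_eq (integrable_comp_two_pi hg) (integrable_comp_two_pi hg')]
  have hfun : convolution (fun η : E3 => g ((2 * Real.pi) • η))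
      (fun η : E3 => g' ((2 * Real.pi) • η)) (ContinuousLinearMap.mul ℂ ℂ) volume = fun η => hconv g g' ((2 * Real.pi) • η) := by
    ext η
    rw [convolution_mul_swap, hconv]
    have := Measure.integral_comp_smul (volume : Measure E3)
      (fun ζ => g ((2 * Real.pi) • η - ζ) * g' ζ) (2 * Real.pi)
    simp only [finrank_euclideanSpace, Fintype.card_fin] at this
    rw [abs_of_nonneg (by positivity)] at this
    rw [← this]
    simp only [smul_sub]
  rw [hfun]

/-- `transport` multiplies chosen representatives pointwise. Each of them agrees almost everywhere
with the inverse transform of an integrable function, so their product is the inverse transform of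
the convolution. -/
theorem hatIs_mul {f f' : Dist} {g g' : E3 → ℂ} (h : HatIs f g) (h' : HatIs f' g')
    (hg : Integrable g) (hg' : Integrable g') {d : Dist}
    (hd : HatIs d (hconv g g')) : Represents d (fun x => asFun f x * asFun f' x) := by
  refine (hd.represents (integrable_hconv hg hg')).congr ?_
  filter_upwards [(h.represents hg).asFun_ae, (h'.represents hg').asFun_ae] with x h1 h2
  rw [h1, h2, invHat_mul hg hg']

theorem represents_sum {ι : Type*} (S : Finset ι) {f : ι → Dist} {g : ι → E3 → ℂ}
    (h : ∀ i ∈ S, Represents (f i) (g i)) :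
    Represents (∑ i ∈ S, f i) (fun ξ => ∑ i ∈ S, g i ξ) := by
  classical
  induction S using Finset.induction_on with
  | empty => simpa using represents_zero
  | insert i S hi ih =>
    simp only [Finset.sum_insert hi]
    exact (h i (by simp)).add (ih fun j hj => h j (by simp [hj]))

/-- The transport term on the Fourier side. -/
theorem hatIs_transport {u : Fin 3 → Dist} {f : Dist} {U : Fin 3 → E3 → ℂ} {g : E3 → ℂ}
    (hu : ∀ j, HatIs (u j) (U j)) (hf : HatIs f g) (hU : ∀ j, Integrable (U j))
    (hg : ∀ j : Fin 3, Integrable fun ξ : E3 => Complex.I * (ξ j : ℂ) * g ξ) :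
    HatIs (transport u f)
      (fun ξ => ∑ j, hconv (U j) (fun η => Complex.I * (η j : ℂ) * g η) ξ) := by
  have h1 : ∀ j, HatIs (ofHat (hconv (U j) (fun η => Complex.I * (η j : ℂ) * g η)))
      (hconv (U j) (fun η => Complex.I * (η j : ℂ) * g η)) := fun j =>
    hatIs_ofHat (integrable_hconv (hU j) (hg j))
  have h2 := represents_sum Finset.univ fun j _ =>
    hatIs_mul (hu j) (hf.partialD j) (hU j) (hg j) (h1 j)
  rw [transport, h2.ofFun]
  exact HatIs.sum Finset.univ fun j _ => h1 j

/-! ### Divergence and real-valuedness on the Fourier side -/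

theorem div3_eq_zero_iff {u : Fin 3 → Dist} {U : Fin 3 → E3 → ℂ} (hu : ∀ j, HatIs (u j) (U j)) :
    div3 u = 0 ↔ ∀ᵐ ξ : E3, ∑ j, (ξ j : ℂ) * U j ξ = 0 := by
  have h := HatIs.sum Finset.univ fun j _ => (hu j).partialD j
  have h2 : ∀ ξ : E3, ∑ j, Complex.I * (ξ j : ℂ) * U j ξ = Complex.I * ∑ j, (ξ j : ℂ) * U j ξ :=
    fun ξ => by simp only [Finset.mul_sum, mul_assoc]
  simp only [h2] at h
  constructor
  · intro h0
    rw [← div3, h0] at h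
    filter_upwards [h.ae_eq hatIs_zero] with ξ hξ
    simpa using hξ
  · intro h0
    refine HatIs.unique h (hatIs_zero.congr ?_)
    filter_upwards [h0] with ξ hξ
    simp [hξ]

theorem invHat_conj (g : E3 → ℂ) (x : E3) :
    invHat (fun ξ => (starRingEnd ℂ) (g (-ξ))) x = (starRingEnd ℂ) (invHat g x) := by
  simp only [invHat, Real.fourierInv_eq']
  rw [← integral_conj, ← integral_neg_eq_self]
  congr 1
  ext η
  simp [← Complex.exp_conj, Complex.conj_ofNat]

/-- Conjugating a function conjugates and reflects its transform. Testing a real distribution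
against real bump functions shows that the imaginary part of its representative vanishes almost
everywhere, and the transform is injective. This makes real-valuedness a symmetry that the
fixed-point argument can track. -/
theorem isReal_iff {f : Dist} {g : E3 → ℂ} (h : HatIs f g) (hg : Integrable g) :
    IsReal f ↔ ∀ᵐ ξ, g (-ξ) = (starRingEnd ℂ) (g ξ) := by
  have hg2 : Integrable fun ξ => (starRingEnd ℂ) (g (-ξ)) := by
    have := hg.comp_neg
    exact (Complex.conjCLE : ℂ →L[ℝ] ℂ).integrable_comp this
  have hr := h.represents hg
  constructor
  · intro hre
    have him : ∀ᵐ x, (invHat g x).im = 0 := by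
      apply ae_eq_zero_of_integral_contDiff_smul_eq_zero
      · rw [locallyIntegrable_iff]
        intro K hK
        exact ((locallyIntegrable_iff.1 hr.1) K hK).im
      · intro b hb hbc
        have hg₁ : HasCompactSupport (Complex.ofRealCLM ∘ b) := hbc.comp_left rfl
        have hg₂ : ContDiff ℝ (⊤ : ℕ∞) (Complex.ofRealCLM ∘ b) := by fun_prop
        have h1 := hre (hg₁.toSchwartzMap hg₂) (by intro x; simp)
        have h2 := hr.2 (hg₁.toSchwartzMap hg₂)
        rw [h2.2] at h1
        have h3 := integral_im h2.1
        simp only [RCLike.im_to_complex] at h3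
        rw [← h3] at h1
        rw [← h1]
        congr 1; ext x; simp
    have h4 : Represents f (invHat fun ξ => (starRingEnd ℂ) (g (-ξ))) := by
      refine hr.congr ?_
      filter_upwards [him] with x hx
      rw [invHat_conj, Complex.conj_eq_iff_im.2 hx]
    have h5 := (hatIs_ofHat hg2).represents hg2
    have h6 := h4.unique h5
    have h7 := hatIs_ofHat hg2
    rw [← h6] at h7
    filter_upwards [h.ae_eq h7] with ξ hξ
    rw [hξ, Complex.conj_conj]
  · intro hs φ hφ
    have h2 : invHat g = invHat fun ξ => (starRingEnd ℂ) (g (-ξ)) := by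
      ext x
      simp only [invHat]
      apply Real.fourierInv_congr_ae
      filter_upwards [ae_comp_smul hs two_pi_ne] with ξ hξ
      simp only [hξ, Complex.conj_conj]
    have him : ∀ x, (invHat g x).im = 0 := fun x => by
      rw [← Complex.conj_eq_iff_im, ← invHat_conj, ← h2]
    have h3 := integral_im (hr.2 φ).1
    simp only [RCLike.im_to_complex] at h3
    rw [(hr.2 φ).2, ← h3]
    simp [hφ, him]

/-! ### Weights -/

/-- The properties of the Lei-Lin-Gevrey weight on which the estimates rest. -/
structure GoodWeight (w : E3 → ℝ) (C : ℝ) : Prop where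
  measurable : Measurable w
  nonneg : ∀ ξ, 0 ≤ w ξ
  const_pos : 0 < C
  one_le : ∀ ξ, ξ ≠ 0 → 1 ≤ C * w ξ
  mul_le : ∀ p q, p ≠ 0 → q ≠ 0 → ‖p + q‖ * w (p + q) ≤ C * (‖p‖ + ‖q‖) * (w p * w q)

/-- Apply x ≤ exp x at x = δz/k and raise to the power k. -/
theorem rpow_le_mul_exp {k δ : ℝ} (hk : 0 < k) (hδ : 0 < δ) {z : ℝ} (hz : 0 ≤ z) :
    z ^ k ≤ (k / δ) ^ k * Real.exp (δ * z) := by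
  have h1 : z = (k / δ) * (δ * z / k) := by field_simp
  have h2 : (δ * z / k) ^ k ≤ Real.exp (δ * z) := by
    have : δ * z / k ≤ Real.exp (δ * z / k) := by linarith [Real.add_one_le_exp (δ * z / k)]
    calc (δ * z / k) ^ k ≤ Real.exp (δ * z / k) ^ k := by
          apply Real.rpow_le_rpow (by positivity) this hk.le
      _ = Real.exp (δ * z) := by rw [← Real.exp_mul]; congr 1; field_simp
  calc z ^ k = (k / δ) ^ k * (δ * z / k) ^ k := by
        rw [← Real.mul_rpow (by positivity) (by positivity), ← h1]
    _ ≤ _ := by gcongr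

/-- Bernoulli's inequality for a concave power, applied to 1 + y/x. The point is the coefficient `p`
of the smaller term: when p < 1, ordinary subadditivity would leave no part of the exponential
weight to spare. -/
theorem add_rpow_le_add_mul_rpow {p x y : ℝ} (hp : 0 < p) (hp1 : p ≤ 1) (hy : 0 ≤ y)
    (hyx : y ≤ x) : (x + y) ^ p ≤ x ^ p + p * y ^ p := by
  rcases (hy.trans hyx).eq_or_lt with hx | hx
  · have : y = 0 := le_antisymm (hyx.trans hx.symm.le) hy
    subst this; simp [← hx, Real.zero_rpow hp.ne']
  have h1 : (1 + y / x) ^ p ≤ 1 + p * (y / x) :=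
    _root_.rpow_one_add_le_one_add_mul_self (by linarith [div_nonneg hy hx.le]) hp.le hp1
  have h2 : y / x ≤ (y / x) ^ p := by
    rcases hy.eq_or_lt with h | h
    · simp [← h, Real.zero_rpow hp.ne']
    · exact Real.self_le_rpow_of_le_one (by positivity) (by rwa [div_le_one hx]) hp1
  calc (x + y) ^ p = x ^ p * (1 + y / x) ^ p := by
        rw [← Real.mul_rpow hx.le (by positivity)]; congr 1; field_simp
    _ ≤ x ^ p * (1 + p * (y / x) ^ p) := by gcongr; exact h1.trans (by gcongr)
    _ = x ^ p + p * y ^ p := by rw [Real.div_rpow hy hx.le]; field_simp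

/-- By symmetry let |q| ≤ |p|. The exponent of the exponential at p+q then contains only the
fraction 1/σ of that at q, and what is left of exp(a|q|^(1/σ)) has to compensate the factor |q|^s.
If s < 0 this works because a > 0 and σ > 1; if s = 0 there is nothing to compensate. -/
theorem goodWeight {a s σ : ℝ}
    (hrange : (0 < a ∧ s ∈ Set.Ico (-1 : ℝ) 0 ∧ 1 < σ) ∨ (0 ≤ a ∧ s = 0 ∧ 1 ≤ σ)) :
    ∃ C, GoodWeight (weight a s σ) C := by
  have ha : 0 ≤ a := by rcases hrange with h | h <;> linarith [h.1]
  have hσ : 1 ≤ σ := by rcases hrange with h | h <;> linarith [h.2.2]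
  have hs1 : -1 ≤ s := by
    rcases hrange with h | h
    · exact h.2.1.1
    · linarith [h.2.1]
  have hs0 : s ≤ 0 := by
    rcases hrange with h | h
    · exact h.2.1.2.le
    · exact h.2.1.le
  have hσ0 : 0 < 1 / σ := by positivity
  have hσ1 : 1 / σ ≤ 1 := by rw [div_le_one (by positivity)]; exact hσ
  obtain ⟨C, hC, hexp⟩ : ∃ C : ℝ, 0 < C ∧ ∀ y : ℝ, 0 < y →
      Real.exp (a * ((1 / σ) * y ^ (1 / σ))) ≤ C * (y ^ s * Real.exp (a * y ^ (1 / σ))) := by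
    rcases hrange with ⟨h1, h2, h3⟩ | ⟨h1, h2, h3⟩
    · have hδ : 0 < a * (1 - 1 / σ) := by
        apply mul_pos h1
        rw [sub_pos, div_lt_one (by positivity)]; exact h3
      have hk : 0 < -s * σ := mul_pos (by linarith [h2.2]) (by positivity)
      -- With z = y^(1/σ), the power z^(-sσ) is y^(-s), and a(1 - 1/σ) is the unused part of the
      -- exponential rate.
      refine ⟨(-s * σ / (a * (1 - 1 / σ))) ^ (-s * σ), by positivity, fun y hy => ?_⟩
      have h4 := rpow_le_mul_exp hk hδ (Real.rpow_nonneg hy.le (1 / σ))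
      rw [← Real.rpow_mul hy.le, show 1 / σ * (-s * σ) = -s by field_simp] at h4
      have h5 : y ^ s * y ^ (-s) = 1 := by rw [← Real.rpow_add hy]; simp
      have h6 : 0 < y ^ s := Real.rpow_pos_of_pos hy s
      calc Real.exp (a * ((1 / σ) * y ^ (1 / σ)))
          = y ^ s * y ^ (-s) * Real.exp (a * ((1 / σ) * y ^ (1 / σ))) := by rw [h5, one_mul]
        _ ≤ y ^ s * ((-s * σ / (a * (1 - 1 / σ))) ^ (-s * σ) *
            Real.exp (a * (1 - 1 / σ) * y ^ (1 / σ))) *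
            Real.exp (a * ((1 / σ) * y ^ (1 / σ))) := by gcongr
        _ = (-s * σ / (a * (1 - 1 / σ))) ^ (-s * σ) * (y ^ s *
            (Real.exp (a * (1 - 1 / σ) * y ^ (1 / σ)) *
            Real.exp (a * ((1 / σ) * y ^ (1 / σ))))) := by ring
        _ = _ := by rw [← Real.exp_add]; congr 3; ring_nf
    · refine ⟨1, one_pos, fun y hy => ?_⟩
      rw [h2, Real.rpow_zero, one_mul, one_mul]
      gcongr
      exact mul_le_of_le_one_left (by positivity) hσ1
  have key : ∀ p q : E3, p ≠ 0 → q ≠ 0 → ‖q‖ ≤ ‖p‖ →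
      ‖p + q‖ * weight a s σ (p + q) ≤
        2 * C * (‖p‖ + ‖q‖) * (weight a s σ p * weight a s σ q) := by
    intro p q hp hq hqp
    have hx : 0 < ‖p‖ := norm_pos_iff.2 hp
    have hy : 0 < ‖q‖ := norm_pos_iff.2 hq
    have h1 : ‖p + q‖ ^ (1 / σ) ≤ ‖p‖ ^ (1 / σ) + (1 / σ) * ‖q‖ ^ (1 / σ) :=
      (Real.rpow_le_rpow (norm_nonneg _) (norm_add_le p q) hσ0.le).trans
        (add_rpow_le_add_mul_rpow hσ0 hσ1 hy.le hqp)
    -- Here -1 ≤ s enters: t ↦ t^(1+s) is nondecreasing, |p+q| ≤ 2|p|, and 2^(1+s) ≤ 2 because s ≤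
    -- 0.
    have h2 : ‖p + q‖ * ‖p + q‖ ^ s ≤ 2 * (‖p‖ * ‖p‖ ^ s) := by
      rcases (norm_nonneg (p + q)).eq_or_lt with h0 | h0
      · rw [← h0, zero_mul]; positivity
      · have e : ∀ z : ℝ, 0 < z → z * z ^ s = z ^ (1 + s) := fun z hz => by
          rw [Real.rpow_add hz, Real.rpow_one]
        rw [e _ h0, e _ hx]
        calc ‖p + q‖ ^ (1 + s) ≤ (2 * ‖p‖) ^ (1 + s) := by
              apply Real.rpow_le_rpow h0.le _ (by linarith)
              linarith [norm_add_le p q]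
          _ = 2 ^ (1 + s) * ‖p‖ ^ (1 + s) := Real.mul_rpow (by norm_num) hx.le
          _ ≤ 2 ^ (1 : ℝ) * ‖p‖ ^ (1 + s) := by
              gcongr
              · norm_num
              · linarith
          _ = _ := by rw [Real.rpow_one]
    calc ‖p + q‖ * weight a s σ (p + q)
        = (‖p + q‖ * ‖p + q‖ ^ s) * Real.exp (a * ‖p + q‖ ^ (1 / σ)) := by rw [weight]; ring
      _ ≤ (2 * (‖p‖ * ‖p‖ ^ s)) *
          Real.exp (a * (‖p‖ ^ (1 / σ) + (1 / σ) * ‖q‖ ^ (1 / σ))) := by gcongr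
      _ = 2 * (‖p‖ * weight a s σ p) * Real.exp (a * ((1 / σ) * ‖q‖ ^ (1 / σ))) := by
          rw [weight, mul_add, Real.exp_add]; ring
      _ ≤ 2 * (‖p‖ * weight a s σ p) * (C * weight a s σ q) := by
          have : 0 ≤ weight a s σ p := by rw [weight]; positivity
          gcongr
          exact hexp _ hy
      _ ≤ 2 * ((‖p‖ + ‖q‖) * weight a s σ p) * (C * weight a s σ q) := by
          have h3 : 0 ≤ weight a s σ p := by rw [weight]; positivity
          have h4 : 0 ≤ weight a s σ q := by rw [weight]; positivity
          gcongr
          linarith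
      _ = _ := by ring
  -- The lower bound for the weight is `hexp` once more, since its left side is at least 1.
  refine ⟨2 * C, ?_, fun ξ => ?_, by positivity, fun ξ hξ => ?_, fun p q hp hq => ?_⟩
  · unfold weight; fun_prop
  · unfold weight; positivity
  · have hy : 0 < ‖ξ‖ := norm_pos_iff.2 hξ
    have h1 := hexp _ hy
    have h2 : 1 ≤ Real.exp (a * ((1 / σ) * ‖ξ‖ ^ (1 / σ))) := by
      rw [Real.one_le_exp_iff]; positivity
    have h3 : 0 ≤ weight a s σ ξ := by rw [weight]; positivity
    have h4 : 1 ≤ C * weight a s σ ξ := h2.trans h1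
    nlinarith [mul_nonneg hC.le h3]
  · rcases le_total ‖q‖ ‖p‖ with h | h
    · exact key p q hp hq h
    · have := key q p hq hp h
      rw [add_comm p q, add_comm ‖p‖, mul_comm (weight a s σ p)]
      exact this

/-! ### Weighted norms of convolutions -/

/-- The weighted `L¹` norm. -/
def nrm {E : Type*} [ENorm E] (w : E3 → ℝ) (f : E3 → E) : ℝ≥0∞ :=
  ∫⁻ ξ, ENNReal.ofReal (w ξ) * ‖f ξ‖ₑ

/-- The weight with `r` more derivatives. -/
def up (w : E3 → ℝ) (r : ℝ) : E3 → ℝ := fun ξ => ‖ξ‖ ^ r * w ξ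

theorem up_measurable {w : E3 → ℝ} (hw : Measurable w) (r : ℝ) : Measurable (up w r) := by
  unfold up; fun_prop

theorem ae_ne_zero : ∀ᵐ ξ : E3, ξ ≠ 0 := by
  simp [ae_iff]

/-- Tonelli's theorem and the translation ξ = p + η turn the left side into a double integral over
(p, η). The pointwise inequality `mul_le`, valid off a null set, bounds the weight by products of
functions of p and of η, and the integral factors. -/
theorem GoodWeight.conv_le {w : E3 → ℝ} {C : ℝ} (hw : GoodWeight w C) {f g : E3 → ℝ≥0∞}
    (hf : Measurable f) (hg : Measurable g) :
    ∫⁻ ξ, ENNReal.ofReal (up w 1 ξ) * ∫⁻ η, f (ξ - η) * g η ≤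
      ENNReal.ofReal C * (nrm (up w 1) f * nrm w g + nrm w f * nrm (up w 1) g) := by
  have hwm := hw.measurable
  have hu := up_measurable hw.measurable 1
  have hm : Measurable fun p : E3 × E3 =>
      ENNReal.ofReal (up w 1 p.1) * (f (p.1 - p.2) * g p.2) := by fun_prop
  calc ∫⁻ ξ, ENNReal.ofReal (up w 1 ξ) * ∫⁻ η, f (ξ - η) * g η
      = ∫⁻ ξ, ∫⁻ η, ENNReal.ofReal (up w 1 ξ) * (f (ξ - η) * g η) := by
        refine lintegral_congr fun ξ => ?_
        rw [lintegral_const_mul]; fun_prop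
    _ = ∫⁻ η, ∫⁻ ξ, ENNReal.ofReal (up w 1 ξ) * (f (ξ - η) * g η) :=
        lintegral_lintegral_swap hm.aemeasurable
    _ = ∫⁻ η, ∫⁻ p, ENNReal.ofReal (up w 1 (p + η)) * (f p * g η) := by
        refine lintegral_congr fun η => ?_
        rw [← lintegral_add_right_eq_self _ η]
        simp
    _ ≤ ∫⁻ η, ∫⁻ p, ENNReal.ofReal C *
          ((ENNReal.ofReal (up w 1 p) * f p) * (ENNReal.ofReal (w η) * g η) +
          (ENNReal.ofReal (w p) * f p) * (ENNReal.ofReal (up w 1 η) * g η)) := by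
        refine lintegral_mono_ae ?_
        filter_upwards [ae_ne_zero] with η hη
        refine lintegral_mono_ae ?_
        filter_upwards [ae_ne_zero] with p hp
        have h1 : ENNReal.ofReal (up w 1 (p + η)) ≤ ENNReal.ofReal C *
            (ENNReal.ofReal (up w 1 p) * ENNReal.ofReal (w η) +
              ENNReal.ofReal (w p) * ENNReal.ofReal (up w 1 η)) := by
          have p0 := hw.nonneg p
          have q0 := hw.nonneg η
          rw [← ENNReal.ofReal_mul (by unfold up; positivity), ← ENNReal.ofReal_mul p0,
            ← ENNReal.ofReal_add (by unfold up; positivity) (by unfold up; positivity),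
            ← ENNReal.ofReal_mul hw.const_pos.le]
          apply ENNReal.ofReal_le_ofReal
          simp only [up, Real.rpow_one]
          refine (hw.mul_le p η hp hη).trans (le_of_eq (by ring))
        calc _ ≤ ENNReal.ofReal C *
            (ENNReal.ofReal (up w 1 p) * ENNReal.ofReal (w η) +
              ENNReal.ofReal (w p) * ENNReal.ofReal (up w 1 η)) * (f p * g η) := by gcongr
          _ = _ := by ring
    _ = ∫⁻ η, ENNReal.ofReal C *
          (nrm (up w 1) f * (ENNReal.ofReal (w η) * g η) +
          nrm w f * (ENNReal.ofReal (up w 1 η) * g η)) := by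
        refine lintegral_congr fun η => ?_
        rw [lintegral_const_mul _ (by fun_prop), lintegral_add_left (by fun_prop),
          lintegral_mul_const _ (by fun_prop), lintegral_mul_const _ (by fun_prop)]
        rfl
    _ = _ := by
        rw [lintegral_const_mul _ (by fun_prop), lintegral_add_left (by fun_prop),
          lintegral_const_mul _ (by fun_prop), lintegral_const_mul _ (by fun_prop)]
        rfl

/-- The weight is bounded below off the origin, so the weighted norm controls the plain `L¹` norm.
All integrability needed for transforms, products and convolutions comes from here. -/
theorem GoodWeight.lintegral_le {w : E3 → ℝ} {C : ℝ} (hw : GoodWeight w C) {E : Type*} [ENorm E]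
    (f : E3 → E) : ∫⁻ ξ, ‖f ξ‖ₑ ≤ ENNReal.ofReal C * nrm w f := by
  rw [nrm, ← lintegral_const_mul' _ _ ENNReal.ofReal_ne_top]
  refine lintegral_mono_ae ?_
  filter_upwards [ae_ne_zero] with ξ hξ
  rw [← mul_assoc, ← ENNReal.ofReal_mul hw.const_pos.le]
  refine le_mul_of_one_le_left (zero_le) ?_
  rw [ENNReal.one_le_ofReal]
  exact hw.one_le ξ hξ

theorem GoodWeight.integrable {w : E3 → ℝ} {C : ℝ} (hw : GoodWeight w C) {E : Type*}
    [NormedAddCommGroup E] {f : E3 → E} (hf : AEStronglyMeasurable f) (h : nrm w f < ⊤) :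
    Integrable f :=
  ⟨hf, (hw.lintegral_le f).trans_lt (ENNReal.mul_lt_top ENNReal.ofReal_lt_top h)⟩

/-! ### Young's inequality -/

/-- Young's inequality for the exponent 2γ > 1 and its conjugate, applied to l r and x/l. -/
theorem exists_young {γ ε : ℝ} (hγ : 1 / 2 < γ) (hε : 0 < ε) :
    ∃ c : ℝ, 0 < c ∧ ∀ x r : ℝ, 0 ≤ x → 0 ≤ r →
      x * r ≤ ε * r ^ (2 * γ) + c * x ^ (2 * γ / (2 * γ - 1)) := by
  have hq : (2 * γ).HolderConjugate (2 * γ / (2 * γ - 1)) :=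
    Real.HolderConjugate.conjExponent (by linarith)
  set q := 2 * γ / (2 * γ - 1)
  have hγ0 : 0 < 2 * γ := by linarith
  have hq0 : 0 < q := hq.symm.pos
  -- Chosen so that (l r)^(2γ) / (2γ) = ε r^(2γ).
  set l : ℝ := (ε * (2 * γ)) ^ (1 / (2 * γ))
  have hl : 0 < l := by positivity
  have hl2 : l ^ (2 * γ) = ε * (2 * γ) := by
    rw [← Real.rpow_mul (by positivity), one_div_mul_cancel hγ0.ne', Real.rpow_one]
  refine ⟨(l⁻¹) ^ q / q, by positivity, fun x r hx hr => ?_⟩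
  have := Real.young_inequality_of_nonneg (a := l * r) (b := l⁻¹ * x) (by positivity)
    (by positivity) hq
  rw [Real.mul_rpow hl.le hr, Real.mul_rpow (by positivity) hx, hl2] at this
  calc x * r = l * r * (l⁻¹ * x) := by field_simp
    _ ≤ _ := this
    _ = _ := by field_simp

/-- Interpolation in the form of Young's inequality. -/
theorem exists_interp {γ ε : ℝ} (hγ : 1 / 2 < γ) (hε : 0 < ε) :
    ∃ c : ℝ, 0 < c ∧ ∀ (w : E3 → ℝ), Measurable w → (∀ ξ, 0 ≤ w ξ) →
      ∀ {E : Type} [NormedAddCommGroup E] (f : E3 → E), AEStronglyMeasurable f →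
      ∀ x : ℝ≥0∞, x ≠ ⊤ →
      x * nrm (up w 1) f ≤ ENNReal.ofReal ε * nrm (up w (2 * γ)) f +
        ENNReal.ofReal c * x ^ (2 * γ / (2 * γ - 1)) * nrm w f := by
  obtain ⟨c, hc, h⟩ := exists_young hγ hε
  refine ⟨c, hc, fun w hw hw0 E _ f hf x hx => ?_⟩
  have hu := up_measurable hw (2 * γ)
  have hu1 := up_measurable hw 1
  have hfe := hf.enorm
  rw [nrm, nrm, nrm, ← lintegral_const_mul' _ _ hx, ← lintegral_const_mul' _ _
    ENNReal.ofReal_ne_top, ← lintegral_const_mul'' _ (by fun_prop), ← lintegral_add_left'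
    (by fun_prop)]
  refine lintegral_mono fun ξ => ?_
  obtain ⟨y, hy, rfl⟩ : ∃ y : ℝ, 0 ≤ y ∧ x = ENNReal.ofReal y :=
    ⟨x.toReal, ENNReal.toReal_nonneg, (ENNReal.ofReal_toReal hx).symm⟩
  -- Young's inequality at r = |ξ|, to be integrated against w |f|; the factor x does not depend on
  -- ξ.
  have h1 := h y ‖ξ‖ hy (norm_nonneg _)
  have h2 : ENNReal.ofReal y * ENNReal.ofReal (up w 1 ξ) ≤
      ENNReal.ofReal ε * ENNReal.ofReal (up w (2 * γ) ξ) +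
        ENNReal.ofReal c * ENNReal.ofReal y ^ (2 * γ / (2 * γ - 1)) * ENNReal.ofReal (w ξ) := by
    have w0 := hw0 ξ
    have hq0 : 0 ≤ 2 * γ / (2 * γ - 1) := by
      apply div_nonneg <;> linarith
    rw [ENNReal.ofReal_rpow_of_nonneg hy hq0, ← ENNReal.ofReal_mul hy,
      ← ENNReal.ofReal_mul hε.le, ← ENNReal.ofReal_mul hc.le, ← ENNReal.ofReal_mul (by positivity),
      ← ENNReal.ofReal_add (by unfold up; positivity) (by positivity)]
    apply ENNReal.ofReal_le_ofReal
    simp only [up, Real.rpow_one]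
    nlinarith
  calc _ = (ENNReal.ofReal y * ENNReal.ofReal (up w 1 ξ)) * ‖f ξ‖ₑ := by ring
    _ ≤ _ := mul_le_mul_left h2 _
    _ = _ := by ring

/-! ### The operators of the equations on the Fourier side -/

/-- Frequency-side values of the velocity. -/
abbrev C3 : Type := EuclideanSpace ℂ (Fin 3)

/-- The bilinear product `ξ · v` of a real and a complex vector. -/
def dotc (ξ : E3) (v : C3) : ℂ := ∑ j, (ξ j : ℂ) * v j

/-- A real vector as a complex vector. -/
def cplx (ξ : E3) : C3 := WithLp.toLp 2 fun j => (ξ j : ℂ)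

theorem norm_cplx (ξ : E3) : ‖cplx ξ‖ = ‖ξ‖ := by
  simp [cplx, EuclideanSpace.norm_eq]

theorem dotc_eq_inner (ξ : E3) (v : C3) : dotc ξ v = inner ℂ (cplx ξ) v := by
  simp [dotc, cplx, PiLp.inner_apply, mul_comm]

theorem norm_dotc_le (ξ : E3) (v : C3) : ‖dotc ξ v‖ ≤ ‖ξ‖ * ‖v‖ := by
  rw [dotc_eq_inner, ← norm_cplx]
  exact norm_inner_le_norm _ _

theorem enorm_dotc_le (ξ : E3) (v : C3) : ‖dotc ξ v‖ₑ ≤ ENNReal.ofReal ‖ξ‖ * ‖v‖ₑ := by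
  rw [← ofReal_norm, ← ofReal_norm, ← ENNReal.ofReal_mul (norm_nonneg _)]
  exact ENNReal.ofReal_le_ofReal (norm_dotc_le ξ v)

theorem dotc_add (ξ : E3) (v v' : C3) : dotc ξ (v + v') = dotc ξ v + dotc ξ v' := by
  simp only [dotc_eq_inner, inner_add_right]

theorem dotc_sub (ξ : E3) (v v' : C3) : dotc ξ (v - v') = dotc ξ v - dotc ξ v' := by
  simp only [dotc_eq_inner, inner_sub_right]

theorem dotc_smul (ξ : E3) (c : ℂ) (v : C3) : dotc ξ (c • v) = c * dotc ξ v := by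
  simp only [dotc_eq_inner, inner_smul_right]

theorem dotc_add_left (ξ η : E3) (v : C3) : dotc (ξ + η) v = dotc ξ v + dotc η v := by
  simp [dotc, add_mul, Finset.sum_add_distrib]

@[fun_prop]
theorem continuous_dotc : Continuous fun p : E3 × C3 => dotc p.1 p.2 := by
  unfold dotc; fun_prop

@[fun_prop]
theorem continuous_cplx : Continuous cplx := by
  unfold cplx; fun_prop

/-- The symbol of the Leray projector. -/
def lerayAt (ξ : E3) (v : C3) : C3 := v - (dotc ξ v / ((‖ξ‖ ^ 2 : ℝ) : ℂ)) • cplx ξ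

theorem lerayAt_apply (ξ : E3) (v : C3) (k : Fin 3) :
    lerayAt ξ v k = v k - (ξ k : ℂ) * dotc ξ v / ((‖ξ‖ ^ 2 : ℝ) : ℂ) := by
  simp [lerayAt, cplx]; ring

/-- The crude constant 2 of the triangle inequality is enough. At the origin, division by zero makes
the symbol the identity. -/
theorem norm_lerayAt_le (ξ : E3) (v : C3) : ‖lerayAt ξ v‖ ≤ 2 * ‖v‖ := by
  have h : ‖(dotc ξ v / ((‖ξ‖ ^ 2 : ℝ) : ℂ)) • cplx ξ‖ ≤ ‖v‖ := by
    rw [norm_smul, norm_cplx, norm_div, Complex.norm_real, norm_pow, norm_norm]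
    rcases (norm_nonneg ξ).eq_or_lt with h0 | h0
    · rw [← h0]; simp
    · calc _ ≤ ‖ξ‖ * ‖v‖ / ‖ξ‖ ^ 2 * ‖ξ‖ := by gcongr; exact norm_dotc_le ξ v
        _ = _ := by field_simp
  calc _ ≤ ‖v‖ + ‖(dotc ξ v / ((‖ξ‖ ^ 2 : ℝ) : ℂ)) • cplx ξ‖ := norm_sub_le _ _
    _ ≤ _ := by linarith

theorem enorm_lerayAt_le (ξ : E3) (v : C3) : ‖lerayAt ξ v‖ₑ ≤ 2 * ‖v‖ₑ := by
  have := ENNReal.ofReal_le_ofReal (norm_lerayAt_le ξ v)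
  rwa [ENNReal.ofReal_mul (by norm_num), ofReal_norm, ofReal_norm,
    ENNReal.ofReal_ofNat] at this

theorem lerayAt_sub (ξ : E3) (v v' : C3) : lerayAt ξ (v - v') = lerayAt ξ v - lerayAt ξ v' := by
  simp only [lerayAt, dotc_sub, sub_div, sub_smul]; abel

theorem dotc_lerayAt (ξ : E3) (v : C3) : dotc ξ (lerayAt ξ v) = 0 := by
  rcases eq_or_ne ξ 0 with rfl | h
  · simp [dotc]
  have h2 : dotc ξ (cplx ξ) = ((‖ξ‖ ^ 2 : ℝ) : ℂ) := by
    rw [dotc_eq_inner, inner_self_eq_norm_sq_to_K, norm_cplx]; simp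
  have h3 : ((‖ξ‖ ^ 2 : ℝ) : ℂ) ≠ 0 := by
    have := norm_ne_zero_iff.2 h
    exact_mod_cast pow_ne_zero 2 this
  rw [lerayAt, dotc_sub, dotc_smul, h2, div_mul_cancel₀ _ h3, sub_self]

theorem measurable_lerayAt : Measurable fun p : E3 × C3 => lerayAt p.1 p.2 := by
  have h1 : Measurable fun p : E3 × C3 => dotc p.1 p.2 := continuous_dotc.measurable
  have h2 : Measurable fun p : E3 × C3 => cplx p.1 := (continuous_cplx.comp continuous_fst).measurable
  unfold lerayAt
  fun_prop

/-- The constant `(2π)⁻³` of the convolution theorem. -/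
def kap : ℝ := ((2 * Real.pi) ^ 3)⁻¹

theorem kap_pos : 0 < kap := by unfold kap; positivity

section Adv

variable {E : Type} [NormedAddCommGroup E] [NormedSpace ℂ E]

/-- The Fourier transform of `u · ∇ v = ∑ⱼ ∂ⱼ(uⱼ v)` in terms of those of `u` and `v`. -/
def adv (U : E3 → C3) (V : E3 → E) (ξ : E3) : E :=
  ((kap : ℂ) * Complex.I) • ∫ η, dotc ξ (U (ξ - η)) • V η

/-- In divergence form the derivative is a factor ξ outside the convolution, so it can be handed to
the weight as one extra power of |ξ|. -/
theorem enorm_adv_le (U : E3 → C3) (V : E3 → E) (ξ : E3) :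
    ‖adv U V ξ‖ₑ ≤ ENNReal.ofReal kap * (ENNReal.ofReal ‖ξ‖ * ∫⁻ η, ‖U (ξ - η)‖ₑ * ‖V η‖ₑ) := by
  have h1 : ‖(kap : ℂ) * Complex.I‖ₑ = ENNReal.ofReal kap := by
    rw [← ofReal_norm]; simp [abs_of_pos kap_pos]
  rw [adv, enorm_smul, h1, ← lintegral_const_mul' _ _ ENNReal.ofReal_ne_top]
  gcongr
  refine (enorm_integral_le_lintegral_enorm _).trans (lintegral_mono fun η => ?_)
  rw [enorm_smul, ← mul_assoc]
  gcongr
  exact enorm_dotc_le _ _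

/-- The bilinear estimate behind both local existence and the a priori bounds: the derivative lost
by the transport term falls on one factor at a time. -/
theorem GoodWeight.nrm_adv_le {w : E3 → ℝ} {C : ℝ} (hw : GoodWeight w C) {U : E3 → C3}
    {V : E3 → E} (hU : StronglyMeasurable U) (hV : StronglyMeasurable V) :
    nrm w (adv U V) ≤ ENNReal.ofReal (kap * C) *
      (nrm (up w 1) U * nrm w V + nrm w U * nrm (up w 1) V) := by
  have h := hw.conv_le hU.enorm hV.enorm
  rw [ENNReal.ofReal_mul kap_pos.le, mul_assoc]
  refine le_trans ?_ (mul_le_mul_right h _)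
  rw [← lintegral_const_mul' _ _ ENNReal.ofReal_ne_top]
  refine lintegral_mono fun ξ => ?_
  refine (mul_le_mul_right (enorm_adv_le U V ξ) _).trans (le_of_eq ?_)
  have : ENNReal.ofReal (up w 1 ξ) = ENNReal.ofReal ‖ξ‖ * ENNReal.ofReal (w ξ) := by
    rw [← ENNReal.ofReal_mul (norm_nonneg _)]; simp [up]
  rw [this]; ring

/-- Needed because a Bochner integral is zero when its integrand is not integrable: additivity and
coordinates of `adv` are only available where the integrand is integrable. -/
theorem ae_integrable_adv {U : E3 → C3} {V : E3 → E} (hU : Integrable U) (hV : Integrable V) :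
    ∀ᵐ ξ : E3, Integrable fun η => dotc ξ (U (ξ - η)) • V η := by
  have h := hV.norm.convolution_integrand (.mul ℝ ℝ) hU.norm
  have h1 := h.prod_right_ae
  filter_upwards [h1] with ξ hξ
  simp only [ContinuousLinearMap.mul_apply'] at hξ
  refine (hξ.const_mul ‖ξ‖).mono' ?_ (ae_of_all _ fun η => ?_)
  · have h2 : AEStronglyMeasurable fun η => U (ξ - η) :=
      hU.1.comp_quasiMeasurePreserving (quasiMeasurePreserving_sub_left_of_right_invariant volume ξ)
    have hc : Continuous fun v : C3 => dotc ξ v := by unfold dotc; fun_prop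
    have h3 : AEStronglyMeasurable fun η => dotc ξ (U (ξ - η)) := hc.comp_aestronglyMeasurable h2
    exact h3.smul hV.1
  · rw [norm_smul]
    calc _ ≤ ‖ξ‖ * ‖U (ξ - η)‖ * ‖V η‖ := by gcongr; exact norm_dotc_le _ _
      _ = _ := by ring

theorem adv_sub_adv {U U' : E3 → C3} {V V' : E3 → E} (hU : Integrable U) (hU' : Integrable U')
    (hV : Integrable V) (hV' : Integrable V') :
    ∀ᵐ ξ, adv U V ξ - adv U' V' ξ =
      adv (fun η => U η - U' η) V ξ + adv U' (fun η => V η - V' η) ξ := by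
  filter_upwards [ae_integrable_adv hU hV, ae_integrable_adv hU' hV, ae_integrable_adv hU' hV']
    with ξ h1 h2 h3
  simp only [adv, ← smul_sub, ← smul_add, dotc_sub, sub_smul]
  simp only [smul_sub]
  rw [integral_sub h1 h2, integral_sub h2 h3, sub_add_sub_cancel, smul_sub]

/-- Equality holds at every ξ, since an integral over η sees its arguments only up to null sets. -/
theorem adv_congr {U U' : E3 → C3} {V V' : E3 → E} (hU : U =ᵐ[volume] U') (hV : V =ᵐ[volume] V')
    (ξ : E3) : adv U V ξ = adv U' V' ξ := by
  unfold adv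
  congr 1
  apply integral_congr_ae
  have := (quasiMeasurePreserving_sub_left_of_right_invariant (volume : Measure E3) ξ).ae hU
  filter_upwards [this, hV] with η h1 h2
  rw [h1, h2]

theorem stronglyMeasurable_adv {X : Type*} [MeasurableSpace X] {U : X → E3 → C3} {V : X → E3 → E}
    (hU : StronglyMeasurable (Function.uncurry U)) (hV : StronglyMeasurable (Function.uncurry V)) :
    StronglyMeasurable (Function.uncurry fun τ => adv (U τ) (V τ)) := by
  have h : StronglyMeasurable fun p : (X × E3) × E3 =>
      dotc p.1.2 (U p.1.1 (p.1.2 - p.2)) • V p.1.1 p.2 := by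
    have h1 : StronglyMeasurable fun p : (X × E3) × E3 => U p.1.1 (p.1.2 - p.2) :=
      hU.comp_measurable (g := fun p : (X × E3) × E3 => (p.1.1, p.1.2 - p.2)) (by fun_prop)
    have h2 : StronglyMeasurable fun p : (X × E3) × E3 => V p.1.1 p.2 :=
      hV.comp_measurable (g := fun p : (X × E3) × E3 => (p.1.1, p.2)) (by fun_prop)
    have h3 : StronglyMeasurable fun p : (X × E3) × E3 => p.1.2 :=
      (by fun_prop : Measurable fun p : (X × E3) × E3 => p.1.2).stronglyMeasurable
    exact (continuous_dotc.comp_stronglyMeasurable (h3.prodMk h1)).smul h2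
  exact h.integral_prod_right'.const_smul ((kap : ℂ) * Complex.I)

/-- If `u` is divergence-free, the derivative may be put on the transported function. -/
theorem adv_eq_of_div_free {U : E3 → C3} {V : E3 → E} (hU : ∀ᵐ ξ, dotc ξ (U ξ) = 0) (ξ : E3) :
    adv U V ξ = ((kap : ℂ) * Complex.I) • ∫ η, dotc η (U (ξ - η)) • V η := by
  unfold adv
  congr 1
  apply integral_congr_ae
  have := (quasiMeasurePreserving_sub_left_of_right_invariant (volume : Measure E3) ξ).ae hU
  filter_upwards [this] with η h1
  have : dotc ξ (U (ξ - η)) = dotc (ξ - η) (U (ξ - η)) + dotc η (U (ξ - η)) := by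
    rw [← dotc_add_left]; simp
  rw [this, h1, zero_add]

end Adv

/-! ### Weighted norms -/

section Nrm

variable {E : Type*} [NormedAddCommGroup E] {w : E3 → ℝ}

theorem nrm_congr {f g : E3 → E} (h : f =ᵐ[volume] g) : nrm w f = nrm w g :=
  lintegral_congr_ae (by filter_upwards [h] with ξ hξ; rw [hξ])

theorem nrm_add_le (hw : Measurable w) {f g : E3 → E} (hf : AEStronglyMeasurable f) :
    nrm w (fun ξ => f ξ + g ξ) ≤ nrm w f + nrm w g := by
  have := hf.enorm
  rw [nrm, nrm, nrm, ← lintegral_add_left' (by fun_prop)]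
  refine lintegral_mono fun ξ => ?_
  rw [← mul_add]
  gcongr
  exact enorm_add_le _ _

theorem nrm_sub_le (hw : Measurable w) {f g : E3 → E} (hf : AEStronglyMeasurable f) :
    nrm w (fun ξ => f ξ - g ξ) ≤ nrm w f + nrm w g := by
  have := hf.enorm
  rw [nrm, nrm, nrm, ← lintegral_add_left' (by fun_prop)]
  refine lintegral_mono fun ξ => ?_
  rw [← mul_add]
  gcongr
  exact enorm_sub_le

theorem nrm_mono {F : Type*} [NormedAddCommGroup F] {f : E3 → E} {g : E3 → F}
    (h : ∀ᵐ ξ, ‖f ξ‖ₑ ≤ ‖g ξ‖ₑ) : nrm w f ≤ nrm w g := by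
  refine lintegral_mono_ae ?_
  filter_upwards [h] with ξ hξ
  gcongr

theorem nrm_le_mul {F : Type*} [NormedAddCommGroup F] {f : E3 → E} {g : E3 → F} {c : ℝ≥0∞}
    (hc : c ≠ ⊤) (h : ∀ᵐ ξ, ‖f ξ‖ₑ ≤ c * ‖g ξ‖ₑ) : nrm w f ≤ c * nrm w g := by
  rw [nrm, nrm, ← lintegral_const_mul' _ _ hc]
  refine lintegral_mono_ae ?_
  filter_upwards [h] with ξ hξ
  calc _ ≤ ENNReal.ofReal (w ξ) * (c * ‖g ξ‖ₑ) := by gcongr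
    _ = _ := by ring

theorem measurable_nrm {X : Type*} [MeasurableSpace X] (hw : Measurable w) {f : X → E3 → E}
    (hf : StronglyMeasurable (Function.uncurry f)) : Measurable fun τ => nrm w (f τ) := by
  have h : Measurable fun p : X × E3 => ENNReal.ofReal (w p.2) * ‖Function.uncurry f p‖ₑ := by
    have := hf.enorm
    fun_prop
  exact h.lintegral_prod_right'

end Nrm

/-! ### Duhamel's formula -/

section Duhamel

variable {E : Type} [NormedAddCommGroup E] [NormedSpace ℝ E]

/-- The solution at time `t` of `v' = -m v + F`, `v(0) = A`. -/
def duh (m : ℝ) (A : E) (F : ℝ → E) (t : ℝ) : E :=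
  Real.exp (-(t * m)) • (A + ∫ τ in (0 : ℝ)..t, Real.exp (τ * m) • F τ)

theorem duh_zero (m : ℝ) (A : E) (F : ℝ → E) : duh m A F 0 = A := by simp [duh]

theorem intervalIntegrable_exp_smul {m : ℝ} {F : ℝ → E} {x y : ℝ}
    (hF : IntervalIntegrable F volume x y) :
    IntervalIntegrable (fun τ => Real.exp (τ * m) • F τ) volume x y :=
  hF.continuousOn_smul (by fun_prop)

/-- The semigroup property: the solution may be restarted at `t₀`. It serves the smoothing estimate
and, later, the gluing of two solutions. -/
theorem duh_eq {m : ℝ} {A : E} {F : ℝ → E} {t₀ t : ℝ}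
    (h0 : IntervalIntegrable F volume 0 t₀) (h1 : IntervalIntegrable F volume t₀ t) :
    duh m A F t = Real.exp (-((t - t₀) * m)) • duh m A F t₀ +
      ∫ τ in t₀..t, Real.exp (-((t - τ) * m)) • F τ := by
  have h2 : ∫ τ in t₀..t, Real.exp (-((t - τ) * m)) • F τ =
      Real.exp (-(t * m)) • ∫ τ in t₀..t, Real.exp (τ * m) • F τ := by
    rw [← intervalIntegral.integral_smul]
    congr 1; ext τ
    rw [smul_smul, ← Real.exp_add]; congr 2; ring
  rw [h2, duh, duh, smul_smul, ← Real.exp_add, ← intervalIntegral.integral_add_adjacent_intervals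
    (intervalIntegrable_exp_smul h0) (intervalIntegrable_exp_smul h1), ← add_assoc, smul_add]
  congr 3; ring

/-- The fundamental theorem of calculus for exp(-(r-τ)m). A unit of mass injected at time τ is, at
time t, partly still present and partly dissipated; because this balance is exact, the smoothing
estimate has constant one. -/
theorem exp_add_lintegral_eq {m τ t : ℝ} (hm : 0 ≤ m) (hτ : τ ≤ t) :
    ENNReal.ofReal (Real.exp (-((t - τ) * m))) +
      ENNReal.ofReal m * ∫⁻ r in Ioc τ t, ENNReal.ofReal (Real.exp (-((r - τ) * m))) = 1 := by
  have hc : Continuous fun r : ℝ => m * Real.exp (-((r - τ) * m)) := by fun_prop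
  rw [← lintegral_const_mul' _ _ ENNReal.ofReal_ne_top]
  simp_rw [← ENNReal.ofReal_mul hm]
  rw [← ofReal_integral_eq_lintegral_ofReal (hc.integrableOn_Ioc)
    (ae_of_all _ fun r => by positivity), ← intervalIntegral.integral_of_le hτ]
  have hd : ∀ r ∈ uIcc τ t, HasDerivAt (fun r => -Real.exp (-((r - τ) * m)))
      (m * Real.exp (-((r - τ) * m))) r := fun r _ => by
    have h1 : HasDerivAt (fun r : ℝ => -((r - τ) * m)) (-(1 * m)) r :=
      (((hasDerivAt_id r).sub_const τ).mul_const m).neg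
    exact h1.exp.neg.congr_deriv (by ring)
  rw [intervalIntegral.integral_eq_sub_of_hasDerivAt hd (hc.intervalIntegrable _ _),
    ← ENNReal.ofReal_add (by positivity)]
  · simp
  · simp only [sub_self, zero_mul, neg_zero, Real.exp_zero, sub_neg_eq_add]
    have : Real.exp (-((t - τ) * m)) ≤ 1 := by
      rw [Real.exp_le_one_iff]
      have := mul_nonneg (sub_nonneg.2 hτ) hm
      linarith
    linarith

theorem enorm_duh_le {m : ℝ} {A : E} {F : ℝ → E} {t₀ t : ℝ} (ht0 : t₀ ≤ t)
    (h0 : IntervalIntegrable F volume 0 t₀) (h1 : IntervalIntegrable F volume t₀ t) :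
    ‖duh m A F t‖ₑ ≤ ENNReal.ofReal (Real.exp (-((t - t₀) * m))) * ‖duh m A F t₀‖ₑ +
      ∫⁻ τ in Ioc t₀ t, ENNReal.ofReal (Real.exp (-((t - τ) * m))) * ‖F τ‖ₑ := by
  have he : ∀ (c : ℝ) (v : E), ‖Real.exp c • v‖ₑ = ENNReal.ofReal (Real.exp c) * ‖v‖ₑ :=
    fun c v => by rw [enorm_smul, Real.enorm_of_nonneg (Real.exp_nonneg _)]
  rw [duh_eq h0 h1, intervalIntegral.integral_of_le ht0]
  refine (enorm_add_le _ _).trans ?_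
  rw [he]
  gcongr
  refine (enorm_integral_le_lintegral_enorm _).trans (le_of_eq ?_)
  simp_rw [he]

/-- The smoothing estimate for Duhamel's formula. -/
theorem enorm_duh_add_le {m : ℝ} (hm : 0 ≤ m) {A : E} {F : ℝ → E} {t₀ t : ℝ} (ht00 : 0 ≤ t₀)
    (ht0 : t₀ ≤ t) (hF : IntegrableOn F (Ioc 0 t)) :
    ‖duh m A F t‖ₑ + ENNReal.ofReal m * ∫⁻ r in Ioc t₀ t, ‖duh m A F r‖ₑ ≤
      ‖duh m A F t₀‖ₑ + ∫⁻ τ in Ioc t₀ t, ‖F τ‖ₑ := by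
  have hI : ∀ x y, 0 ≤ x → x ≤ y → y ≤ t → IntervalIntegrable F volume x y := fun x y hx hy hyt => by
    rw [intervalIntegrable_iff_integrableOn_Ioc_of_le hy]
    exact hF.mono_set (Ioc_subset_Ioc hx hyt)
  set B := ‖duh m A F t₀‖ₑ
  set e : ℝ → ℝ≥0∞ := fun x => ENNReal.ofReal (Real.exp (-(x * m)))
  have hem : Measurable e := by fun_prop
  have hFm : AEMeasurable (fun τ => ‖F τ‖ₑ) (volume.restrict (Ioc t₀ t)) :=
    (hF.mono_set (Ioc_subset_Ioc_left ht00)).1.enorm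
  -- The triangle τ ≤ r is encoded by an indicator, so that Tonelli's theorem applies on a product
  -- of intervals.
  have hind : Measurable fun p : ℝ × ℝ => (Ici p.2).indicator (fun r => e (r - p.2)) p.1 := by
    have : (fun p : ℝ × ℝ => (Ici p.2).indicator (fun r => e (r - p.2)) p.1) =
        ({p : ℝ × ℝ | p.2 ≤ p.1}).indicator fun p => e (p.1 - p.2) := by
      ext p; simp [indicator]
    rw [this]
    exact Measurable.indicator (by fun_prop) (measurableSet_le measurable_snd measurable_fst)
  have h1 : ∀ r ∈ Ioc t₀ t, ‖duh m A F r‖ₑ ≤ e (r - t₀) * B +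
      ∫⁻ τ in Ioc t₀ t, (Ici τ).indicator (fun r => e (r - τ)) r * ‖F τ‖ₑ := fun r hr => by
    refine (enorm_duh_le hr.1.le (hI 0 t₀ le_rfl ht00 ht0) (hI t₀ r ht00 hr.1.le hr.2)).trans ?_
    refine add_le_add le_rfl ?_
    calc _ = ∫⁻ τ in Ioc t₀ r, (Ici τ).indicator (fun r => e (r - τ)) r * ‖F τ‖ₑ := by
          refine setLIntegral_congr_fun measurableSet_Ioc fun τ hτ => ?_
          simp only [indicator_of_mem (show r ∈ Ici τ from hτ.2), e]
      _ ≤ _ := lintegral_mono_set (Ioc_subset_Ioc_right hr.2)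
  -- The share of the mass injected at time τ that is dissipated before time t.
  have h2 : ∀ τ ∈ Ioc t₀ t, ENNReal.ofReal m * ∫⁻ r in Ioc t₀ t,
      (Ici τ).indicator (fun r => e (r - τ)) r ≤ 1 - e (t - τ) := fun τ hτ => by
    rw [← exp_add_lintegral_eq hm hτ.2, ENNReal.add_sub_cancel_left ENNReal.ofReal_ne_top]
    gcongr 1
    rw [lintegral_indicator measurableSet_Ici, Measure.restrict_restrict measurableSet_Ici,
      setLIntegral_congr (Ioc_ae_eq_Icc (a := τ) (b := t))]
    exact lintegral_mono_set fun r hr => ⟨hr.1, hr.2.2⟩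
  have hle : ∀ x, 0 ≤ x → e x ≤ 1 := fun x hx => by
    rw [← ENNReal.ofReal_one]
    apply ENNReal.ofReal_le_ofReal
    rw [Real.exp_le_one_iff]
    linarith [mul_nonneg hx hm]
  have h3 : ENNReal.ofReal m * ∫⁻ r in Ioc t₀ t, ‖duh m A F r‖ₑ ≤
      (1 - e (t - t₀)) * B + ∫⁻ τ in Ioc t₀ t, (1 - e (t - τ)) * ‖F τ‖ₑ := by
    calc _ ≤ ENNReal.ofReal m * ∫⁻ r in Ioc t₀ t, (e (r - t₀) * B +
          ∫⁻ τ in Ioc t₀ t, (Ici τ).indicator (fun r => e (r - τ)) r * ‖F τ‖ₑ) := by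
          gcongr 1
          exact setLIntegral_mono' measurableSet_Ioc h1
      _ = (ENNReal.ofReal m * ∫⁻ r in Ioc t₀ t, e (r - t₀)) * B +
          ∫⁻ τ in Ioc t₀ t, (ENNReal.ofReal m * ∫⁻ r in Ioc t₀ t,
            (Ici τ).indicator (fun r => e (r - τ)) r) * ‖F τ‖ₑ := by
          rw [lintegral_add_left (by fun_prop), mul_add, lintegral_mul_const _ (by fun_prop),
            mul_assoc, lintegral_lintegral_swap, ← lintegral_const_mul' _ _ ENNReal.ofReal_ne_top]
          · congr 1
            refine lintegral_congr fun τ => ?_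
            rw [mul_assoc, lintegral_mul_const]
            exact hind.comp (measurable_id.prodMk measurable_const)
          · exact hind.aemeasurable.mul (hFm.comp_snd)
      _ ≤ _ := by
          gcongr ?_ * B + ?_
          · rw [← exp_add_lintegral_eq hm ht0, ENNReal.add_sub_cancel_left ENNReal.ofReal_ne_top]
          · refine setLIntegral_mono' measurableSet_Ioc fun τ hτ => ?_
            gcongr
            exact h2 τ hτ
  -- The surviving and the dissipated shares add up to one, for the initial value and for the
  -- forcing at each time.
  calc _ ≤ (e (t - t₀) * B + ∫⁻ τ in Ioc t₀ t, e (t - τ) * ‖F τ‖ₑ) +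
        ((1 - e (t - t₀)) * B + ∫⁻ τ in Ioc t₀ t, (1 - e (t - τ)) * ‖F τ‖ₑ) :=
        add_le_add (enorm_duh_le ht0 (hI 0 t₀ le_rfl ht00 ht0) (hI t₀ t ht00 ht0 le_rfl)) h3
    _ = (e (t - t₀) + (1 - e (t - t₀))) * B +
        ∫⁻ τ in Ioc t₀ t, (e (t - τ) + (1 - e (t - τ))) * ‖F τ‖ₑ := by
        simp only [add_mul]
        rw [lintegral_add_left' (by fun_prop)]
        ring
    _ = _ := by
        rw [add_tsub_cancel_of_le (hle _ (by linarith)), one_mul]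
        congr 1
        refine setLIntegral_congr_fun measurableSet_Ioc fun τ hτ => ?_
        simp only [add_tsub_cancel_of_le (hle _ (sub_nonneg.2 hτ.2)), one_mul]

theorem continuousOn_duh {m : ℝ} {A : E} {F : ℝ → E} {T : ℝ} (hF : IntegrableOn F (Icc 0 T)) :
    ContinuousOn (duh m A F) (Icc 0 T) := by
  have h := intervalIntegral.continuousOn_primitive (f := fun τ => Real.exp (τ * m) • F τ)
    (a := 0) (b := T) (hF.continuousOn_smul (by fun_prop) isCompact_Icc)
  have h2 : ContinuousOn (fun t => Real.exp (-(t * m)) • (A + ∫ τ in Ioc 0 t,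
      Real.exp (τ * m) • F τ)) (Icc 0 T) := by fun_prop
  refine h2.congr fun t ht => ?_
  simp only [duh, intervalIntegral.integral_of_le ht.1]

theorem duh_congr {m : ℝ} {A : E} {F G : ℝ → E} {t : ℝ} (ht : 0 ≤ t)
    (h : ∀ᵐ τ ∂volume.restrict (Ioc 0 t), F τ = G τ) : duh m A F t = duh m A G t := by
  simp only [duh, intervalIntegral.integral_of_le ht]
  congr 2
  apply integral_congr_ae
  filter_upwards [h] with τ hτ
  rw [hτ]

theorem duh_sub_duh {m : ℝ} {A B : E} {F G : ℝ → E} {t : ℝ}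
    (hF : IntervalIntegrable F volume 0 t) (hG : IntervalIntegrable G volume 0 t) :
    duh m A F t - duh m B G t = duh m (A - B) (fun τ => F τ - G τ) t := by
  simp only [duh, ← smul_sub]
  rw [add_sub_add_comm, ← intervalIntegral.integral_sub (intervalIntegrable_exp_smul hF)
    (intervalIntegrable_exp_smul hG)]
  simp only [smul_sub]

end Duhamel

/-! ### Duhamel's formula for all frequencies together -/

section DuhamelFamily

variable {E : Type} [NormedAddCommGroup E] {w : E3 → ℝ} {C : ℝ}

theorem setLIntegral_nrm (hw : Measurable w) {F : ℝ → E3 → E}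
    (hF : StronglyMeasurable (Function.uncurry F)) {S : Set ℝ} :
    ∫⁻ τ in S, nrm w (F τ) = ∫⁻ ξ, ENNReal.ofReal (w ξ) * ∫⁻ τ in S, ‖F τ ξ‖ₑ := by
  have hFe := hF.enorm
  unfold nrm
  rw [lintegral_lintegral_swap]
  · refine lintegral_congr fun ξ => ?_
    rw [lintegral_const_mul' _ _ ENNReal.ofReal_ne_top]
  · have : Measurable fun p : ℝ × E3 =>
      ENNReal.ofReal (w p.2) * ‖Function.uncurry F p‖ₑ := by fun_prop
    exact this.aemeasurable

/-- Tonelli's theorem, followed by division by the weight, which is positive off the origin. The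
scalar lemmas on `duh` can therefore be used at almost every frequency. -/
theorem GoodWeight.ae_integrableOn (hw : GoodWeight w C) {F : ℝ → E3 → E}
    (hF : StronglyMeasurable (Function.uncurry F)) {S : Set ℝ}
    (h : ∫⁻ τ in S, nrm w (F τ) < ⊤) : ∀ᵐ ξ, IntegrableOn (fun τ => F τ ξ) S := by
  have hwm := hw.measurable
  have hFe := hF.enorm
  have hm : Measurable fun p : ℝ × E3 =>
      ENNReal.ofReal (w p.2) * ‖Function.uncurry F p‖ₑ := by fun_prop
  have h1 : ∫⁻ ξ, ∫⁻ τ in S, ENNReal.ofReal (w ξ) * ‖F τ ξ‖ₑ < ⊤ := by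
    rwa [← lintegral_lintegral_swap (hm.aemeasurable)]
  have h2 := ae_lt_top' (Measurable.aemeasurable
    (Measurable.lintegral_prod_right' (f := fun p : E3 × ℝ =>
      ENNReal.ofReal (w p.1) * ‖F p.2 p.1‖ₑ) (hm.comp measurable_swap))) h1.ne
  filter_upwards [h2, ae_ne_zero] with ξ hξ h0
  have h3 : StronglyMeasurable fun τ => F τ ξ :=
    hF.comp_measurable (g := fun τ : ℝ => (τ, ξ)) (by fun_prop)
  refine ⟨h3.aestronglyMeasurable, ?_⟩
  simp only [lintegral_const_mul' _ _ ENNReal.ofReal_ne_top] at hξ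
  have h4 : ENNReal.ofReal (w ξ) ≠ 0 := by
    have := hw.one_le ξ h0
    simp only [ne_eq, ENNReal.ofReal_eq_zero, not_le]
    by_contra h5
    have := mul_nonpos_of_nonneg_of_nonpos hw.const_pos.le (not_lt.1 h5)
    linarith
  exact ENNReal.lt_top_of_mul_ne_top_right hξ.ne h4

variable [NormedSpace ℝ E]

/-- Duhamel's formula for the fractional heat equation, on the Fourier side. -/
def Duh (γ : ℝ) (A : E3 → E) (F : ℝ → E3 → E) (t : ℝ) (ξ : E3) : E :=
  duh (‖ξ‖ ^ (2 * γ)) (A ξ) (fun τ => F τ ξ) t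

theorem stronglyMeasurable_Duh {γ : ℝ} {A : E3 → E} {F : ℝ → E3 → E} (hA : StronglyMeasurable A)
    (hF : StronglyMeasurable (Function.uncurry F)) :
    StronglyMeasurable (Function.uncurry (Duh γ A F)) := by
  have hG : StronglyMeasurable fun p : (ℝ × E3) × ℝ =>
      Real.exp (p.2 * ‖p.1.2‖ ^ (2 * γ)) • F p.2 p.1.2 := by
    refine StronglyMeasurable.smul (Measurable.stronglyMeasurable (by fun_prop)) ?_
    exact hF.comp_measurable (g := fun p : (ℝ × E3) × ℝ => (p.2, p.1.2)) (by fun_prop)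
  have hI : StronglyMeasurable fun p : ℝ × E3 =>
      ∫ τ in (0 : ℝ)..p.1, Real.exp (τ * ‖p.2‖ ^ (2 * γ)) • F τ p.2 := by
    have e : (fun p : ℝ × E3 => ∫ τ in (0 : ℝ)..p.1, Real.exp (τ * ‖p.2‖ ^ (2 * γ)) • F τ p.2) =
        fun p => (∫ τ, ({q : (ℝ × E3) × ℝ | q.2 ∈ Ioc 0 q.1.1}.indicator (fun q =>
          Real.exp (q.2 * ‖q.1.2‖ ^ (2 * γ)) • F q.2 q.1.2)) (p, τ)) -
          ∫ τ, ({q : (ℝ × E3) × ℝ | q.2 ∈ Ioc q.1.1 0}.indicator (fun q =>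
          Real.exp (q.2 * ‖q.1.2‖ ^ (2 * γ)) • F q.2 q.1.2)) (p, τ) := by
      ext p
      rw [intervalIntegral, ← integral_indicator measurableSet_Ioc,
        ← integral_indicator measurableSet_Ioc]
      rfl
    rw [e]
    refine StronglyMeasurable.sub ?_ ?_
    · refine (hG.indicator ?_).integral_prod_right'
      exact (measurableSet_lt measurable_const measurable_snd).inter
        (measurableSet_le measurable_snd (by fun_prop))
    · refine (hG.indicator ?_).integral_prod_right'
      exact (measurableSet_lt (by fun_prop) measurable_snd).inter
        (measurableSet_le measurable_snd measurable_const)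
  refine StronglyMeasurable.smul (f := fun p : ℝ × E3 => Real.exp (-(p.1 * ‖p.2‖ ^ (2 * γ))))
    (Measurable.stronglyMeasurable (by fun_prop)) (StronglyMeasurable.add ?_ hI)
  exact hA.comp_measurable measurable_snd

/-- The smoothing estimate for the fractional heat equation. -/
theorem GoodWeight.nrm_Duh_add_le (hw : GoodWeight w C) {γ : ℝ} {A : E3 → E} {F : ℝ → E3 → E}
    (hA : StronglyMeasurable A) (hF : StronglyMeasurable (Function.uncurry F)) {t₀ t : ℝ}
    (ht00 : 0 ≤ t₀) (ht0 : t₀ ≤ t) (h : ∫⁻ τ in Ioc 0 t, nrm w (F τ) < ⊤) :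
    nrm w (Duh γ A F t) + ∫⁻ r in Ioc t₀ t, nrm (up w (2 * γ)) (Duh γ A F r) ≤
      nrm w (Duh γ A F t₀) + ∫⁻ τ in Ioc t₀ t, nrm w (F τ) := by
  have hwm := hw.measurable
  have hum := up_measurable hw.measurable (2 * γ)
  have hD := (stronglyMeasurable_Duh (γ := γ) hA hF)
  have hsec : ∀ r, Measurable fun ξ => ‖Duh γ A F r ξ‖ₑ := fun r =>
    hD.enorm.comp (g := fun p : ℝ × E3 => ‖Function.uncurry (Duh γ A F) p‖ₑ)
      (f := fun ξ : E3 => (r, ξ)) (measurable_const.prodMk measurable_id)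
  have e1 : ∫⁻ r in Ioc t₀ t, nrm (up w (2 * γ)) (Duh γ A F r) =
      ∫⁻ ξ, ENNReal.ofReal (w ξ) * (ENNReal.ofReal (‖ξ‖ ^ (2 * γ)) *
        ∫⁻ r in Ioc t₀ t, ‖Duh γ A F r ξ‖ₑ) := by
    rw [setLIntegral_nrm hum hD]
    refine lintegral_congr fun ξ => ?_
    rw [up, mul_comm (‖ξ‖ ^ (2 * γ)), ENNReal.ofReal_mul (hw.nonneg ξ), mul_assoc]
  have hm1 : Measurable fun ξ => ENNReal.ofReal (w ξ) * ‖Duh γ A F t ξ‖ₑ :=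
    (ENNReal.measurable_ofReal.comp hwm).mul (hsec t)
  have hm2 : Measurable fun ξ => ENNReal.ofReal (w ξ) * ‖Duh γ A F t₀ ξ‖ₑ :=
    (ENNReal.measurable_ofReal.comp hwm).mul (hsec t₀)
  rw [e1, setLIntegral_nrm hwm hF, nrm, nrm, ← lintegral_add_left hm1, ← lintegral_add_left hm2]
  refine lintegral_mono_ae ?_
  filter_upwards [hw.ae_integrableOn hF h] with ξ hξ
  rw [← mul_add, ← mul_add]
  have h5 := enorm_duh_add_le (m := ‖ξ‖ ^ (2 * γ)) (A := A ξ) (by positivity) ht00 ht0 hξ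
  exact mul_le_mul_right h5 _

theorem GoodWeight.nrm_Duh_le (hw : GoodWeight w C) {γ : ℝ} {A : E3 → E} {F : ℝ → E3 → E}
    (hA : StronglyMeasurable A) (hF : StronglyMeasurable (Function.uncurry F)) {t : ℝ}
    (ht0 : 0 ≤ t) (h : ∫⁻ τ in Ioc 0 t, nrm w (F τ) < ⊤) :
    nrm w (Duh γ A F t) ≤ nrm w A + ∫⁻ τ in Ioc 0 t, nrm w (F τ) := by
  have h0 : Duh γ A F 0 = A := by ext1 ξ; exact duh_zero _ _ _
  have := hw.nrm_Duh_add_le (γ := γ) hA hF le_rfl ht0 h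
  rw [h0] at this
  exact le_self_add.trans this

/-- Duhamel's formula gives a continuous curve. -/
theorem GoodWeight.tendsto_nrm_Duh (hw : GoodWeight w C) {γ : ℝ} {A : E3 → E} {F : ℝ → E3 → E}
    (hA : StronglyMeasurable A) (hF : StronglyMeasurable (Function.uncurry F)) {T : ℝ}
    (hA0 : nrm w A < ⊤) (h : ∫⁻ τ in Ioc 0 T, nrm w (F τ) < ⊤) {t : ℝ} (ht : t ∈ Icc 0 T) :
    Tendsto (fun r => nrm w (fun ξ => Duh γ A F r ξ - Duh γ A F t ξ)) (𝓝[Icc 0 T] t) (𝓝 0) := by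
  have hwm := hw.measurable
  have hD := (stronglyMeasurable_Duh (γ := γ) hA hF)
  have hFe := hF.enorm
  have hFe' : Measurable fun p : E3 × ℝ => ‖F p.2 p.1‖ₑ := hFe.comp measurable_swap
  have hsec : ∀ r, StronglyMeasurable fun ξ => Duh γ A F r ξ := fun r =>
    hD.comp_measurable (g := fun ξ : E3 => (r, ξ)) (measurable_const.prodMk measurable_id)
  have hAe := hA.enorm
  have hb0 : ∀ᵐ ξ, ∀ r ∈ Icc 0 T, ‖Duh γ A F r ξ‖ₑ ≤ ‖A ξ‖ₑ + ∫⁻ τ in Ioc 0 T, ‖F τ ξ‖ₑ := by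
    filter_upwards [hw.ae_integrableOn hF h] with ξ hξ r hr
    have := enorm_duh_add_le (m := ‖ξ‖ ^ (2 * γ)) (A := A ξ) (by positivity) le_rfl hr.1
      (hξ.mono_set (Ioc_subset_Ioc_right hr.2))
    rw [duh_zero] at this
    refine (le_self_add.trans this).trans ?_
    gcongr
    exact hr.2
  have e2 : ∫⁻ ξ, ENNReal.ofReal (w ξ) * ∫⁻ τ in Ioc 0 T, ‖F τ ξ‖ₑ < ⊤ := by
    rwa [← setLIntegral_nrm hwm hF]
  have hz : (0 : ℝ≥0∞) = ∫⁻ _ : E3, 0 := by simp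
  rw [hz]
  unfold nrm
  -- For fixed ξ the curve is continuous in time, and its modulus is at most |A| + ∫|F| at all
  -- times, which dominates the difference.
  refine tendsto_lintegral_filter_of_dominated_convergence
    (fun ξ => ENNReal.ofReal (w ξ) * (2 * (‖A ξ‖ₑ + ∫⁻ τ in Ioc 0 T, ‖F τ ξ‖ₑ))) ?_ ?_ ?_ ?_
  · refine Eventually.of_forall fun r => ?_
    have := ((hsec r).sub (hsec t)).enorm
    simp only [Pi.sub_apply] at this
    fun_prop
  · filter_upwards [self_mem_nhdsWithin] with r hr
    filter_upwards [hb0] with ξ hξ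
    gcongr
    rw [two_mul]
    exact enorm_sub_le.trans (add_le_add (hξ r hr) (hξ t ht))
  · have : ∫⁻ ξ, ENNReal.ofReal (w ξ) * (2 * (‖A ξ‖ₑ + ∫⁻ τ in Ioc 0 T, ‖F τ ξ‖ₑ)) =
        2 * (nrm w A + ∫⁻ ξ, ENNReal.ofReal (w ξ) * ∫⁻ τ in Ioc 0 T, ‖F τ ξ‖ₑ) := by
      rw [nrm, ← lintegral_add_left (by fun_prop), ← lintegral_const_mul' _ _ (by simp)]
      refine lintegral_congr fun ξ => ?_
      ring
    rw [this]
    exact (ENNReal.mul_lt_top (by simp) (ENNReal.add_lt_top.2 ⟨hA0, e2⟩)).ne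
  · filter_upwards [hw.ae_integrableOn hF h] with ξ hξ
    have hc := continuousOn_duh (m := ‖ξ‖ ^ (2 * γ)) (A := A ξ)
      ((integrableOn_Icc_iff_integrableOn_Ioc).2 hξ) t ht
    have h1 : Tendsto (fun r => Duh γ A F r ξ - Duh γ A F t ξ) (𝓝[Icc 0 T] t) (𝓝 0) := by
      have h2 : Tendsto (fun r => Duh γ A F r ξ) (𝓝[Icc 0 T] t) (𝓝 (Duh γ A F t ξ)) := hc
      simpa using h2.sub_const (Duh γ A F t ξ)
    have h3 := (continuous_enorm.tendsto (0 : E)).comp h1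
    have h4 := ENNReal.Tendsto.const_mul (a := ENNReal.ofReal (w ξ)) h3
      (Or.inr ENNReal.ofReal_ne_top)
    simpa using h4

end DuhamelFamily

section

/-! ### Local existence on the Fourier side -/

/-- Banach's fixed point theorem in the unit ball of `L¹`, by explicit iteration from 0, because the
map acts on functions and not on their classes. Accordingly the fixed-point equation holds only
almost everywhere. -/
theorem exists_fixedPoint_L1 {Y : Type*} [MeasurableSpace Y] (ν : Measure Y) {E : Type*}
    [NormedAddCommGroup E] [CompleteSpace E] (Φ : (Y → E) → Y → E)
    (hm : ∀ f, StronglyMeasurable f → ∫⁻ y, ‖f y‖ₑ ∂ν ≤ 1 → StronglyMeasurable (Φ f))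
    (hb : ∀ f, StronglyMeasurable f → ∫⁻ y, ‖f y‖ₑ ∂ν ≤ 1 → ∫⁻ y, ‖Φ f y‖ₑ ∂ν ≤ 1)
    (hl : ∀ f g, StronglyMeasurable f → ∫⁻ y, ‖f y‖ₑ ∂ν ≤ 1 → StronglyMeasurable g →
      ∫⁻ y, ‖g y‖ₑ ∂ν ≤ 1 → ∫⁻ y, ‖Φ f y - Φ g y‖ₑ ∂ν ≤ 2⁻¹ * ∫⁻ y, ‖f y - g y‖ₑ ∂ν) :
    ∃ f, StronglyMeasurable f ∧ ∫⁻ y, ‖f y‖ₑ ∂ν ≤ 1 ∧ ∫⁻ y, ‖Φ f y - f y‖ₑ ∂ν = 0 := by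
  set g : ℕ → Y → E := fun n => Φ^[n] 0
  have hg : ∀ n, StronglyMeasurable (g n) ∧ ∫⁻ y, ‖g n y‖ₑ ∂ν ≤ 1 := by
    intro n
    induction n with
    | zero => exact ⟨stronglyMeasurable_zero, by simp [g]⟩
    | succ n ih =>
      simp only [g, Function.iterate_succ_apply']
      exact ⟨hm _ ih.1 ih.2, hb _ ih.1 ih.2⟩
  have hs : ∀ n, g (n + 1) = Φ (g n) := fun n => by simp only [g, Function.iterate_succ_apply']
  have hd : ∀ n, ∫⁻ y, ‖g n y - g (n + 1) y‖ₑ ∂ν ≤ 1 * (2⁻¹ : ℝ≥0∞) ^ n := by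
    intro n
    induction n with
    | zero => simpa [g] using (hg 1).2
    | succ n ih =>
      have := hl _ _ (hg n).1 (hg n).2 (hg (n + 1)).1 (hg (n + 1)).2
      rw [← hs, ← hs] at this
      refine this.trans ?_
      rw [pow_succ]
      calc _ ≤ 2⁻¹ * (1 * (2⁻¹ : ℝ≥0∞) ^ n) := by gcongr
        _ = _ := by ring
  have hi : ∀ n, Integrable (g n) ν := fun n =>
    ⟨(hg n).1.aestronglyMeasurable, (hg n).2.trans_lt ENNReal.one_lt_top⟩
  have he : ∀ n (q : Lp E 1 ν), edist ((hi n).toL1 (g n)) q = ∫⁻ y, ‖g n y - q y‖ₑ ∂ν := by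
    intro n q
    have h1 := L1.integrable_coeFn q
    have h2 := Integrable.edist_toL1_toL1 (g n) q (hi n) h1
    rw [Integrable.toL1_coeFn] at h2
    rw [h2]
    simp only [edist_eq_enorm_sub]
  -- Consecutive iterates are at distance at most 2⁻ⁿ.
  have hc : CauchySeq fun n => (hi n).toL1 (g n) := by
    refine cauchySeq_of_edist_le_geometric 2⁻¹ 1 ?_ (by simp) fun n => ?_
    · exact ENNReal.inv_lt_one.2 (by norm_num)
    · rw [Integrable.edist_toL1_toL1]
      simpa only [edist_eq_enorm_sub] using hd n
  obtain ⟨q, hq⟩ := cauchySeq_tendsto_of_complete hc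
  have ht : Tendsto (fun n => ∫⁻ y, ‖g n y - q y‖ₑ ∂ν) atTop (𝓝 0) := by
    simp_rw [← he]
    exact tendsto_iff_edist_tendsto_0.1 hq
  have hqm := Lp.stronglyMeasurable q
  have hq1 : ∫⁻ y, ‖q y‖ₑ ∂ν ≤ 1 := by
    have h3 : Tendsto (fun n => ∫⁻ y, ‖g n y - q y‖ₑ ∂ν + 1) atTop (𝓝 (0 + 1)) :=
      ht.add tendsto_const_nhds
    rw [zero_add] at h3
    refine ge_of_tendsto' h3 fun n => ?_
    have h4 := ((hg n).1.sub hqm).enorm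
    calc ∫⁻ y, ‖q y‖ₑ ∂ν ≤ ∫⁻ y, (‖g n y - q y‖ₑ + ‖g n y‖ₑ) ∂ν := by
          refine lintegral_mono fun y => ?_
          have := enorm_sub_le (a := g n y) (b := g n y - q y)
          rwa [sub_sub_cancel, add_comm] at this
      _ = ∫⁻ y, ‖g n y - q y‖ₑ ∂ν + ∫⁻ y, ‖g n y‖ₑ ∂ν := lintegral_add_left h4 _
      _ ≤ _ := add_le_add le_rfl (hg n).2
  refine ⟨q, hqm, hq1, le_antisymm ?_ zero_le⟩
  -- The distance from Φ(q) to q is at most the distance from Φ(q) to g_{n+1} = Φ(g_n) plus that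
  -- from g_{n+1} to q, and both tend to zero.
  have h5 : Tendsto (fun n => 2⁻¹ * (∫⁻ y, ‖g n y - q y‖ₑ ∂ν) +
      ∫⁻ y, ‖g (n + 1) y - q y‖ₑ ∂ν) atTop (𝓝 (2⁻¹ * 0 + 0)) :=
    (ENNReal.Tendsto.const_mul ht (Or.inr (by simp))).add (ht.comp (tendsto_add_atTop_nat 1))
  rw [mul_zero, add_zero] at h5
  refine ge_of_tendsto' h5 fun n => ?_
  have h6 := hl _ _ (hg n).1 (hg n).2 hqm hq1
  have h7 := (((hg (n + 1)).1).sub (hm _ hqm hq1)).enorm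
  rw [← hs] at h6
  calc ∫⁻ y, ‖Φ q y - q y‖ₑ ∂ν
      ≤ ∫⁻ y, (‖g (n + 1) y - Φ q y‖ₑ + ‖g (n + 1) y - q y‖ₑ) ∂ν := by
        refine lintegral_mono fun y => ?_
        have := enorm_sub_le (a := g (n + 1) y - q y) (b := g (n + 1) y - Φ q y)
        rwa [sub_sub_sub_cancel_left, add_comm] at this
    _ = ∫⁻ y, ‖g (n + 1) y - Φ q y‖ₑ ∂ν + ∫⁻ y, ‖g (n + 1) y - q y‖ₑ ∂ν :=
        lintegral_add_left h7 _
    _ ≤ _ := add_le_add h6 le_rfl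

/-! ### Forcing terms -/

/-- The forcing of the velocity. -/
def forceU (U : E3 → C3) (Θ : E3 → ℂ) (ξ : E3) : C3 :=
  lerayAt ξ (EuclideanSpace.single 2 (Θ ξ)) - lerayAt ξ (adv U U ξ)

/-- The forcing of the temperature. -/
def forceT (U : E3 → C3) (Θ : E3 → ℂ) (ξ : E3) : ℂ := -adv U Θ ξ

theorem enorm_single (z : ℂ) : ‖(EuclideanSpace.single 2 z : C3)‖ₑ = ‖z‖ₑ := by
  rw [← ofReal_norm, ← ofReal_norm]; simp

theorem single_sub (z z' : ℂ) : (EuclideanSpace.single 2 (z - z') : C3) =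
    EuclideanSpace.single 2 z - EuclideanSpace.single 2 z' := by
  ext i; simp only [PiLp.sub_apply, PiLp.single_apply]; split_ifs <;> simp

theorem continuous_single_two :
    Continuous fun z : ℂ => (EuclideanSpace.single 2 z : C3) := by
  have h : Continuous fun z : ℂ => (Pi.single 2 z : Fin 3 → ℂ) := by
    refine continuous_pi fun i => ?_
    simp only [Pi.single_apply]
    split_ifs
    · exact continuous_id
    · exact continuous_const
  exact (PiLp.continuous_toLp 2 fun _ : Fin 3 => ℂ).comp h

section

variable {X : Type*} [MeasurableSpace X] {U : X → E3 → C3} {Θ : X → E3 → ℂ}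

theorem stronglyMeasurable_forceU (hU : StronglyMeasurable (Function.uncurry U))
    (hΘ : StronglyMeasurable (Function.uncurry Θ)) :
    StronglyMeasurable (Function.uncurry fun τ => forceU (U τ) (Θ τ)) := by
  have h1 : Measurable (Function.uncurry fun τ => adv (U τ) (U τ)) :=
    (stronglyMeasurable_adv hU hU).measurable
  have hc : Continuous fun z : ℂ => (EuclideanSpace.single 2 z : C3) :=
    continuous_single_two
  refine Measurable.stronglyMeasurable (Measurable.sub ?_ ?_)
  · exact measurable_lerayAt.comp
      (measurable_snd.prodMk (hc.measurable.comp hΘ.measurable))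
  · exact measurable_lerayAt.comp (measurable_snd.prodMk h1)

theorem stronglyMeasurable_forceT (hU : StronglyMeasurable (Function.uncurry U))
    (hΘ : StronglyMeasurable (Function.uncurry Θ)) :
    StronglyMeasurable (Function.uncurry fun τ => forceT (U τ) (Θ τ)) :=
  (stronglyMeasurable_adv hU hΘ).neg

end

theorem forceU_congr {U U' : E3 → C3} {Θ Θ' : E3 → ℂ} (hU : U =ᵐ[volume] U')
    (hΘ : Θ =ᵐ[volume] Θ') : forceU U Θ =ᵐ[volume] forceU U' Θ' := by
  filter_upwards [hΘ] with ξ hξ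
  rw [forceU, forceU, hξ, adv_congr hU hU]

theorem forceT_congr {U U' : E3 → C3} {Θ Θ' : E3 → ℂ} (hU : U =ᵐ[volume] U')
    (hΘ : Θ =ᵐ[volume] Θ') (ξ : E3) : forceT U Θ ξ = forceT U' Θ' ξ := by
  rw [forceT, forceT, adv_congr hU hΘ]

variable {w : E3 → ℝ} {C : ℝ} {U U' : E3 → C3} {Θ Θ' : E3 → ℂ}


theorem GoodWeight.nrm_forceU_le (hw : GoodWeight w C) (hU : StronglyMeasurable U) (hΘ : StronglyMeasurable Θ) :
    nrm w (forceU U Θ) ≤ 2 * nrm w Θ + 2 * nrm w (adv U U) := by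
  have hA : StronglyMeasurable (adv U U) :=
    (stronglyMeasurable_adv (X := Unit) (U := fun _ => U) (V := fun _ => U)
      (hU.comp_measurable measurable_snd) (hU.comp_measurable measurable_snd)).comp_measurable
        (g := fun ξ : E3 => ((), ξ)) (by fun_prop)
  have hc : Continuous fun z : ℂ => (EuclideanSpace.single 2 z : C3) :=
    continuous_single_two
  have h1 : Measurable fun ξ => lerayAt ξ (EuclideanSpace.single 2 (Θ ξ)) :=
    measurable_lerayAt.comp (measurable_id.prodMk (hc.measurable.comp hΘ.measurable))
  refine (nrm_sub_le hw.measurable h1.aestronglyMeasurable).trans (add_le_add ?_ ?_)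
  · refine nrm_le_mul (by simp) (ae_of_all _ fun ξ => ?_)
    rw [← enorm_single]
    exact enorm_lerayAt_le _ _
  · exact nrm_le_mul (by simp) (ae_of_all _ fun ξ => enorm_lerayAt_le _ _)

end

theorem stronglyMeasurable_section {X E : Type*} [MeasurableSpace X] [TopologicalSpace E]
    {f : X → E3 → E} (hf : StronglyMeasurable (Function.uncurry f)) (τ : X) :
    StronglyMeasurable (f τ) :=
  hf.comp_measurable (g := fun ξ : E3 => (τ, ξ)) (by fun_prop)

/-! ### Time-integrated estimates of the forcing -/

/-- The curve `f` is bounded by `ρ` in `L^∞ X^s` and `L¹ X^{s+2γ}` on `(0, T]`. -/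
def Controlled {E : Type} [NormedAddCommGroup E] (w : E3 → ℝ) (γ T : ℝ) (f : ℝ → E3 → E)
    (ρ : ℝ≥0∞) : Prop :=
  (∀ τ ∈ Ioc 0 T, nrm w (f τ) ≤ ρ) ∧ ∫⁻ τ in Ioc 0 T, nrm (up w (2 * γ)) (f τ) ≤ ρ

section

variable {w : E3 → ℝ} {C : ℝ} {E : Type} [NormedAddCommGroup E]

theorem Controlled.mono {γ T : ℝ} {f : ℝ → E3 → E} {ρ ρ' : ℝ≥0∞} (h : Controlled w γ T f ρ)
    (hρ : ρ ≤ ρ') : Controlled w γ T f ρ' :=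
  ⟨fun τ hτ => (h.1 τ hτ).trans hρ, h.2.trans hρ⟩

theorem GoodWeight.controlled_Duh [NormedSpace ℝ E] (hw : GoodWeight w C) {γ T : ℝ} (hT : 0 ≤ T)
    {A : E3 → E} {F : ℝ → E3 → E} (hA : StronglyMeasurable A)
    (hF : StronglyMeasurable (Function.uncurry F)) (h : ∫⁻ τ in Ioc 0 T, nrm w (F τ) < ⊤) :
    Controlled w γ T (Duh γ A F) (nrm w A + ∫⁻ τ in Ioc 0 T, nrm w (F τ)) := by
  constructor
  · intro τ hτ
    have h1 : ∫⁻ τ in Ioc 0 τ, nrm w (F τ) ≤ ∫⁻ τ in Ioc 0 T, nrm w (F τ) :=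
      lintegral_mono_set (Ioc_subset_Ioc_right hτ.2)
    refine (hw.nrm_Duh_le hA hF hτ.1.le (h1.trans_lt h)).trans ?_
    gcongr
  · have h0 : Duh γ A F 0 = A := by ext1 ξ; exact duh_zero _ _ _
    have := hw.nrm_Duh_add_le (γ := γ) hA hF le_rfl hT h
    rw [h0] at this
    exact le_add_self.trans this

/-- `η` is admissible as the factor gained by integrating one derivative. -/
def Gain (w : E3 → ℝ) (γ T : ℝ) (η : ℝ≥0∞) : Prop :=
  ∀ {E : Type} [NormedAddCommGroup E] (f : ℝ → E3 → E) (ρ : ℝ≥0∞),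
    StronglyMeasurable (Function.uncurry f) → Controlled w γ T f ρ →
    ∫⁻ τ in Ioc 0 T, nrm (up w 1) (f τ) ≤ η * ρ

/-- Interpolation with constant factor 1: one derivative costs ε of the dissipation plus c times the
norm, and the latter integrates to cT. Taking first ε and then T small makes the factor as small as
desired. -/
theorem GoodWeight.exists_gain (hw : GoodWeight w C) {γ ε : ℝ} (hγ : 1 / 2 < γ) (hε : 0 < ε) :
    ∃ c : ℝ, 0 < c ∧ ∀ T : ℝ, 0 ≤ T → Gain w γ T (ENNReal.ofReal (ε + c * T)) := by
  obtain ⟨c, hc, h⟩ := exists_interp hγ hε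
  refine ⟨c, hc, fun T hT E _ f ρ hf hρ => ?_⟩
  have h1 : ∀ τ, nrm (up w 1) (f τ) ≤ ENNReal.ofReal ε * nrm (up w (2 * γ)) (f τ) +
      ENNReal.ofReal c * nrm w (f τ) := fun τ => by
    simpa using h w hw.measurable hw.nonneg (f τ)
      (stronglyMeasurable_section hf τ).aestronglyMeasurable 1 (by simp)
  have hm : Measurable fun τ => nrm (up w (2 * γ)) (f τ) :=
    measurable_nrm (up_measurable hw.measurable _) hf
  calc _ ≤ ∫⁻ τ in Ioc 0 T, (ENNReal.ofReal ε * nrm (up w (2 * γ)) (f τ) +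
          ENNReal.ofReal c * nrm w (f τ)) := lintegral_mono fun τ => h1 τ
    _ ≤ ∫⁻ τ in Ioc 0 T, (ENNReal.ofReal ε * nrm (up w (2 * γ)) (f τ) +
          ENNReal.ofReal c * ρ) := by
        refine setLIntegral_mono' measurableSet_Ioc fun τ hτ => ?_
        gcongr
        exact hρ.1 τ hτ
    _ = ENNReal.ofReal ε * (∫⁻ τ in Ioc 0 T, nrm (up w (2 * γ)) (f τ)) +
          ENNReal.ofReal c * ρ * ENNReal.ofReal T := by
        rw [lintegral_add_left (by fun_prop), lintegral_const_mul' _ _ ENNReal.ofReal_ne_top,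
          setLIntegral_const, Real.volume_Ioc, sub_zero]
    _ ≤ ENNReal.ofReal ε * ρ + ENNReal.ofReal c * ρ * ENNReal.ofReal T := by
        gcongr
        exact hρ.2
    _ = _ := by
        rw [ENNReal.ofReal_add hε.le (by positivity), ENNReal.ofReal_mul hc.le]; ring

/-- In each product the factor without derivative is bounded uniformly in time, and the one with a
derivative is integrated by means of `Gain`. -/
theorem GoodWeight.lintegral_adv_le [NormedSpace ℂ E] (hw : GoodWeight w C) {γ γ' T : ℝ}
    {η ρ ρ' : ℝ≥0∞} {U : ℝ → E3 → C3} {V : ℝ → E3 → E}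
    (hη : Gain w γ T η) (hη' : Gain w γ' T η)
    (hU : StronglyMeasurable (Function.uncurry U)) (hV : StronglyMeasurable (Function.uncurry V))
    (hρ : Controlled w γ T U ρ) (hρ' : Controlled w γ' T V ρ') :
    ∫⁻ τ in Ioc 0 T, nrm w (adv (U τ) (V τ)) ≤
      ENNReal.ofReal (kap * C) * (2 * η * ρ * ρ') := by
  have hm : Measurable fun τ => nrm (up w 1) (U τ) :=
    measurable_nrm (up_measurable hw.measurable _) hU
  have hm' : Measurable fun τ => nrm (up w 1) (V τ) :=
    measurable_nrm (up_measurable hw.measurable _) hV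
  calc _ ≤ ∫⁻ τ in Ioc 0 T, ENNReal.ofReal (kap * C) *
          (nrm (up w 1) (U τ) * ρ' + ρ * nrm (up w 1) (V τ)) := by
        refine setLIntegral_mono' measurableSet_Ioc fun τ hτ => ?_
        refine (hw.nrm_adv_le (stronglyMeasurable_section hU τ)
          (stronglyMeasurable_section hV τ)).trans ?_
        gcongr
        · exact hρ'.1 τ hτ
        · exact hρ.1 τ hτ
    _ = ENNReal.ofReal (kap * C) * ((∫⁻ τ in Ioc 0 T, nrm (up w 1) (U τ)) * ρ' +
          ρ * ∫⁻ τ in Ioc 0 T, nrm (up w 1) (V τ)) := by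
        rw [lintegral_const_mul' _ _ ENNReal.ofReal_ne_top, lintegral_add_left (by fun_prop),
          lintegral_mul_const _ hm, lintegral_const_mul _ hm']
    _ ≤ ENNReal.ofReal (kap * C) * ((η * ρ) * ρ' + ρ * (η * ρ')) := by
        gcongr
        · exact hη U ρ hU hρ
        · exact hη' V ρ' hV hρ'
    _ = _ := by ring

theorem GoodWeight.nrm_adv_sub_adv_le [NormedSpace ℂ E] (hw : GoodWeight w C) {U U' : E3 → C3}
    {V V' : E3 → E} (hU : StronglyMeasurable U) (hU' : StronglyMeasurable U')
    (hV : StronglyMeasurable V) (hV' : StronglyMeasurable V')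
    (hU0 : nrm w U < ⊤) (hU0' : nrm w U' < ⊤) (hV0 : nrm w V < ⊤) (hV0' : nrm w V' < ⊤) :
    nrm w (fun ξ => adv U V ξ - adv U' V' ξ) ≤
      nrm w (adv (fun η => U η - U' η) V) + nrm w (adv U' (fun η => V η - V' η)) := by
  have h := adv_sub_adv (hw.integrable hU.aestronglyMeasurable hU0)
    (hw.integrable hU'.aestronglyMeasurable hU0') (hw.integrable hV.aestronglyMeasurable hV0)
    (hw.integrable hV'.aestronglyMeasurable hV0')
  rw [nrm_congr h]
  refine nrm_add_le hw.measurable ?_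
  exact (stronglyMeasurable_section (X := Unit) (stronglyMeasurable_adv
    (U := fun _ η => U η - U' η) (V := fun _ => V)
    ((hU.sub hU').comp_measurable measurable_snd) (hV.comp_measurable measurable_snd))
    ()).aestronglyMeasurable

end

section

variable {w : E3 → ℝ} {C : ℝ}

theorem GoodWeight.nrm_forceU_sub_le (hw : GoodWeight w C) {U U' : E3 → C3} {Θ Θ' : E3 → ℂ}
    (hU : StronglyMeasurable U) (hU' : StronglyMeasurable U')
    (hΘ : StronglyMeasurable Θ) (hΘ' : StronglyMeasurable Θ')
    (hU0 : nrm w U < ⊤) (hU0' : nrm w U' < ⊤) :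
    nrm w (fun ξ => forceU U Θ ξ - forceU U' Θ' ξ) ≤ 2 * nrm w (fun ξ => Θ ξ - Θ' ξ) +
      2 * (nrm w (adv (fun η => U η - U' η) U) + nrm w (adv U' (fun η => U η - U' η))) := by
  have e : ∀ ξ, forceU U Θ ξ - forceU U' Θ' ξ =
      lerayAt ξ (EuclideanSpace.single 2 (Θ ξ - Θ' ξ)) -
        lerayAt ξ (adv U U ξ - adv U' U' ξ) := fun ξ => by
    rw [single_sub, lerayAt_sub, lerayAt_sub, forceU, forceU]; abel
  simp only [e]
  have h1 : Measurable fun ξ => lerayAt ξ (EuclideanSpace.single 2 (Θ ξ - Θ' ξ)) :=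
    measurable_lerayAt.comp
      (measurable_id.prodMk (continuous_single_two.measurable.comp (hΘ.sub hΘ').measurable))
  refine (nrm_sub_le hw.measurable h1.aestronglyMeasurable).trans (add_le_add ?_ ?_)
  · refine nrm_le_mul (by simp) (ae_of_all _ fun ξ => ?_)
    rw [← enorm_single]
    exact enorm_lerayAt_le _ _
  · refine (nrm_le_mul (c := 2) (g := fun ξ => adv U U ξ - adv U' U' ξ) (by simp)
      (ae_of_all _ fun ξ => enorm_lerayAt_le _ _)).trans ?_
    gcongr
    exact hw.nrm_adv_sub_adv_le hU hU' hU hU' hU0 hU0' hU0 hU0'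

theorem nrm_neg {E : Type*} [NormedAddCommGroup E] (f : E3 → E) :
    nrm w (fun ξ => -f ξ) = nrm w f := by simp [nrm]

theorem GoodWeight.nrm_forceT_sub_le (hw : GoodWeight w C) {U U' : E3 → C3} {Θ Θ' : E3 → ℂ}
    (hU : StronglyMeasurable U) (hU' : StronglyMeasurable U')
    (hΘ : StronglyMeasurable Θ) (hΘ' : StronglyMeasurable Θ')
    (hU0 : nrm w U < ⊤) (hU0' : nrm w U' < ⊤) (hΘ0 : nrm w Θ < ⊤) (hΘ0' : nrm w Θ' < ⊤) :
    nrm w (fun ξ => forceT U Θ ξ - forceT U' Θ' ξ) ≤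
      nrm w (adv (fun η => U η - U' η) Θ) + nrm w (adv U' (fun η => Θ η - Θ' η)) := by
  refine le_trans (le_of_eq ?_) (hw.nrm_adv_sub_adv_le hU hU' hΘ hΘ' hU0 hU0' hΘ0 hΘ0')
  rw [← nrm_neg]
  congr 1; ext ξ
  simp only [forceT]; ring

theorem GoodWeight.Duh_sub_ae {E : Type} [NormedAddCommGroup E] [NormedSpace ℝ E]
    (hw : GoodWeight w C) {γ T : ℝ} {A B : E3 → E} {F G : ℝ → E3 → E}
    (hF : StronglyMeasurable (Function.uncurry F)) (hG : StronglyMeasurable (Function.uncurry G))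
    (hF1 : ∫⁻ τ in Ioc 0 T, nrm w (F τ) < ⊤) (hG1 : ∫⁻ τ in Ioc 0 T, nrm w (G τ) < ⊤)
    {t : ℝ} (ht : t ∈ Icc 0 T) :
    (fun ξ => Duh γ A F t ξ - Duh γ B G t ξ) =ᵐ[volume]
      Duh γ (fun ξ => A ξ - B ξ) (fun τ ξ => F τ ξ - G τ ξ) t := by
  filter_upwards [hw.ae_integrableOn hF hF1, hw.ae_integrableOn hG hG1] with ξ h1 h2
  apply duh_sub_duh
  · exact (intervalIntegrable_iff_integrableOn_Ioc_of_le ht.1).2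
      (h1.mono_set (Ioc_subset_Ioc_right ht.2))
  · exact (intervalIntegrable_iff_integrableOn_Ioc_of_le ht.1).2
      (h2.mono_set (Ioc_subset_Ioc_right ht.2))

end

/-! ### Contraction estimates for the forcings -/

/-- `F` and `G` are the forcings of a solution with data `A`, `B`, at almost all times of `S`. -/
def Solves (α β : ℝ) (A : E3 → C3) (B : E3 → ℂ) (F : ℝ → E3 → C3) (G : ℝ → E3 → ℂ)
    (S : Set ℝ) : Prop :=
  (∀ᵐ τ ∂volume.restrict S, F τ =ᵐ[volume] forceU (Duh α A F τ) (Duh β B G τ)) ∧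
    ∀ᵐ τ ∂volume.restrict S, G τ =ᵐ[volume] forceT (Duh α A F τ) (Duh β B G τ)

section

variable {w : E3 → ℝ} {C : ℝ} {α β T : ℝ} {η ρ : ℝ≥0∞}
  {A : E3 → C3} {B : E3 → ℂ} {F F' : ℝ → E3 → C3} {G G' : ℝ → E3 → ℂ}

theorem Gain.mono {γ : ℝ} {η' : ℝ≥0∞} (h : Gain w γ T η) (hη : η ≤ η') : Gain w γ T η' :=
  fun f ρ hf hρ => (h f ρ hf hρ).trans (by gcongr)

/-- By linearity the difference solves the same equation with zero data, so the smoothing estimate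
leaves only the difference of the forcings. -/
theorem GoodWeight.controlled_Duh_sub (hw : GoodWeight w C) {E : Type} [NormedAddCommGroup E]
    [NormedSpace ℝ E] {γ : ℝ} (hT : 0 ≤ T) {A : E3 → E} {F F' : ℝ → E3 → E}
    (hF : StronglyMeasurable (Function.uncurry F)) (hF' : StronglyMeasurable (Function.uncurry F'))
    (hF1 : ∫⁻ τ in Ioc 0 T, nrm w (F τ) < ⊤) (hF1' : ∫⁻ τ in Ioc 0 T, nrm w (F' τ) < ⊤) :
    Controlled w γ T (fun τ ξ => Duh γ A F τ ξ - Duh γ A F' τ ξ)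
      (∫⁻ τ in Ioc 0 T, nrm w (fun ξ => F τ ξ - F' τ ξ)) := by
  have hd : ∫⁻ τ in Ioc 0 T, nrm w (fun ξ => F τ ξ - F' τ ξ) < ⊤ := by
    refine lt_of_le_of_lt (lintegral_mono fun τ => nrm_sub_le hw.measurable
      (stronglyMeasurable_section hF τ).aestronglyMeasurable) ?_
    rw [lintegral_add_left (measurable_nrm hw.measurable hF)]
    exact ENNReal.add_lt_top.2 ⟨hF1, hF1'⟩
  have hc := hw.controlled_Duh (γ := γ) hT (A := fun _ => (0 : E)) stronglyMeasurable_const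
    (F := fun τ ξ => F τ ξ - F' τ ξ) (hF.sub hF') hd
  have h0 : nrm w (fun _ : E3 => (0 : E)) = 0 := by simp [nrm]
  rw [h0, zero_add] at hc
  have e : ∀ τ ∈ Ioc 0 T, ∀ v : E3 → ℝ, nrm v (fun ξ => Duh γ A F τ ξ - Duh γ A F' τ ξ) =
      nrm v (Duh γ (fun _ => (0 : E)) (fun τ ξ => F τ ξ - F' τ ξ) τ) := fun τ hτ v => by
    have := hw.Duh_sub_ae (γ := γ) (A := A) (B := A) hF hF' hF1 hF1' (Ioc_subset_Icc_self hτ)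
    simp only [sub_self] at this
    exact nrm_congr this
  refine ⟨fun τ hτ => (e τ hτ w).trans_le (hc.1 τ hτ), le_trans (le_of_eq ?_) hc.2⟩
  exact setLIntegral_congr_fun measurableSet_Ioc fun τ hτ => e τ hτ _

theorem GoodWeight.lintegral_forceU_le (hw : GoodWeight w C) {U : ℝ → E3 → C3} {Θ : ℝ → E3 → ℂ}
    (hη : Gain w α T η) (hU : StronglyMeasurable (Function.uncurry U))
    (hΘ : StronglyMeasurable (Function.uncurry Θ))
    (hρ : Controlled w α T U ρ) (hρ' : Controlled w β T Θ ρ) :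
    ∫⁻ τ in Ioc 0 T, nrm w (forceU (U τ) (Θ τ)) ≤
      (2 * ENNReal.ofReal T + 4 * ENNReal.ofReal (kap * C) * η * ρ) * ρ := by
  calc _ ≤ ∫⁻ τ in Ioc 0 T, (2 * ρ + 2 * nrm w (adv (U τ) (U τ))) := by
        refine setLIntegral_mono' measurableSet_Ioc fun τ hτ => ?_
        refine (hw.nrm_forceU_le (stronglyMeasurable_section hU τ)
          (stronglyMeasurable_section hΘ τ)).trans ?_
        gcongr
        exact hρ'.1 τ hτ
    _ = 2 * ρ * ENNReal.ofReal T + 2 * ∫⁻ τ in Ioc 0 T, nrm w (adv (U τ) (U τ)) := by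
        rw [lintegral_add_left (by fun_prop), setLIntegral_const, lintegral_const_mul' _ _ (by simp),
          Real.volume_Ioc, sub_zero]
    _ ≤ 2 * ρ * ENNReal.ofReal T + 2 * (ENNReal.ofReal (kap * C) * (2 * η * ρ * ρ)) := by
        gcongr
        exact hw.lintegral_adv_le hη hη hU hU hρ hρ
    _ = _ := by ring

theorem GoodWeight.lintegral_forceT_le (hw : GoodWeight w C) {U : ℝ → E3 → C3} {Θ : ℝ → E3 → ℂ}
    (hη : Gain w α T η) (hη' : Gain w β T η) (hU : StronglyMeasurable (Function.uncurry U))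
    (hΘ : StronglyMeasurable (Function.uncurry Θ))
    (hρ : Controlled w α T U ρ) (hρ' : Controlled w β T Θ ρ) :
    ∫⁻ τ in Ioc 0 T, nrm w (forceT (U τ) (Θ τ)) ≤
      2 * ENNReal.ofReal (kap * C) * η * ρ * ρ := by
  refine le_trans (le_of_eq ?_) ((hw.lintegral_adv_le hη hη' hU hΘ hρ hρ').trans
    (le_of_eq (by ring)))
  refine lintegral_congr fun τ => ?_
  exact nrm_neg _

/-- The map from forcings to forcings is Lipschitz continuous. -/
theorem GoodWeight.lintegral_force_sub_le (hw : GoodWeight w C) (hT : 0 ≤ T)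
    (hη : Gain w α T η) (hη' : Gain w β T η) (hρ : ρ < ⊤)
    (hA : StronglyMeasurable A) (hB : StronglyMeasurable B)
    (hF : StronglyMeasurable (Function.uncurry F)) (hF' : StronglyMeasurable (Function.uncurry F'))
    (hG : StronglyMeasurable (Function.uncurry G)) (hG' : StronglyMeasurable (Function.uncurry G'))
    (hAF : nrm w A + ∫⁻ τ in Ioc 0 T, nrm w (F τ) ≤ ρ)
    (hAF' : nrm w A + ∫⁻ τ in Ioc 0 T, nrm w (F' τ) ≤ ρ)
    (hBG : nrm w B + ∫⁻ τ in Ioc 0 T, nrm w (G τ) ≤ ρ)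
    (hBG' : nrm w B + ∫⁻ τ in Ioc 0 T, nrm w (G' τ) ≤ ρ) {δ : ℝ≥0∞}
    (hδ : ∫⁻ τ in Ioc 0 T, nrm w (fun ξ => F τ ξ - F' τ ξ) ≤ δ)
    (hδ' : ∫⁻ τ in Ioc 0 T, nrm w (fun ξ => G τ ξ - G' τ ξ) ≤ δ) :
    (∫⁻ τ in Ioc 0 T, nrm w (fun ξ => forceU (Duh α A F τ) (Duh β B G τ) ξ -
        forceU (Duh α A F' τ) (Duh β B G' τ) ξ)) +
      (∫⁻ τ in Ioc 0 T, nrm w (fun ξ => forceT (Duh α A F τ) (Duh β B G τ) ξ -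
        forceT (Duh α A F' τ) (Duh β B G' τ) ξ)) ≤
    (2 * ENNReal.ofReal T + 12 * ENNReal.ofReal (kap * C) * η * ρ) * δ := by
  have fin : ∀ {x y : ℝ≥0∞}, x + y ≤ ρ → y < ⊤ := fun h => (le_add_self.trans h).trans_lt hρ
  have mU := stronglyMeasurable_Duh (γ := α) hA hF
  have mU' := stronglyMeasurable_Duh (γ := α) hA hF'
  have mT := stronglyMeasurable_Duh (γ := β) hB hG
  have mT' := stronglyMeasurable_Duh (γ := β) hB hG'
  have cU := (hw.controlled_Duh (γ := α) hT hA hF (fin hAF)).mono hAF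
  have cU' := (hw.controlled_Duh (γ := α) hT hA hF' (fin hAF')).mono hAF'
  have cT := (hw.controlled_Duh (γ := β) hT hB hG (fin hBG)).mono hBG
  have cT' := (hw.controlled_Duh (γ := β) hT hB hG' (fin hBG')).mono hBG'
  have dU := (hw.controlled_Duh_sub (γ := α) (A := A) hT hF hF' (fin hAF) (fin hAF')).mono hδ
  have dT := (hw.controlled_Duh_sub (γ := β) (A := B) hT hG hG' (fin hBG) (fin hBG')).mono hδ'
  have mdU : StronglyMeasurable (Function.uncurry fun τ ξ =>
    Duh α A F τ ξ - Duh α A F' τ ξ) := mU.sub mU'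
  have mdT : StronglyMeasurable (Function.uncurry fun τ ξ =>
    Duh β B G τ ξ - Duh β B G' τ ξ) := mT.sub mT'
  have i1 := hw.lintegral_adv_le hη hη mdU mU dU cU
  have i2 := hw.lintegral_adv_le hη hη mU' mdU cU' dU
  have i3 := hw.lintegral_adv_le hη hη' mdU mT dU cT
  have i4 := hw.lintegral_adv_le hη hη' mU' mdT cU' dT
  have n1 := measurable_nrm hw.measurable (stronglyMeasurable_adv mdU mU)
  have n2 := measurable_nrm hw.measurable (stronglyMeasurable_adv mU' mdU)
  have n3 := measurable_nrm hw.measurable (stronglyMeasurable_adv mdU mT)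
  have n4 := measurable_nrm hw.measurable (stronglyMeasurable_adv mU' mdT)
  have lt : ∀ {E : Type} [NormedAddCommGroup E] {γ : ℝ} {f : ℝ → E3 → E}, Controlled w γ T f ρ →
      ∀ τ ∈ Ioc 0 T, nrm w (f τ) < ⊤ := fun h τ hτ => (h.1 τ hτ).trans_lt hρ
  have b1 : (∫⁻ τ in Ioc 0 T, nrm w (fun ξ => forceU (Duh α A F τ) (Duh β B G τ) ξ -
        forceU (Duh α A F' τ) (Duh β B G' τ) ξ)) ≤ 2 * δ * ENNReal.ofReal T +
        2 * (ENNReal.ofReal (kap * C) * (2 * η * δ * ρ) +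
          ENNReal.ofReal (kap * C) * (2 * η * ρ * δ)) := by
    calc _ ≤ ∫⁻ τ in Ioc 0 T, (2 * δ +
          2 * (nrm w (adv (fun ξ => Duh α A F τ ξ - Duh α A F' τ ξ) (Duh α A F τ)) +
            nrm w (adv (Duh α A F' τ) (fun ξ => Duh α A F τ ξ - Duh α A F' τ ξ)))) := by
          refine setLIntegral_mono' measurableSet_Ioc fun τ hτ => ?_
          refine (hw.nrm_forceU_sub_le (stronglyMeasurable_section mU τ)
            (stronglyMeasurable_section mU' τ) (stronglyMeasurable_section mT τ)
            (stronglyMeasurable_section mT' τ) (lt cU τ hτ) (lt cU' τ hτ)).trans ?_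
          gcongr
          exact dT.1 τ hτ
      _ = 2 * δ * ENNReal.ofReal T + 2 *
          ((∫⁻ τ in Ioc 0 T, nrm w (adv (fun ξ => Duh α A F τ ξ - Duh α A F' τ ξ)
            (Duh α A F τ))) + ∫⁻ τ in Ioc 0 T, nrm w (adv (Duh α A F' τ)
              (fun ξ => Duh α A F τ ξ - Duh α A F' τ ξ))) := by
          rw [lintegral_add_left (by fun_prop), setLIntegral_const,
            lintegral_const_mul' _ _ (by simp), lintegral_add_left n1, Real.volume_Ioc, sub_zero]
      _ ≤ _ := by gcongr
  have b2 : (∫⁻ τ in Ioc 0 T, nrm w (fun ξ => forceT (Duh α A F τ) (Duh β B G τ) ξ -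
        forceT (Duh α A F' τ) (Duh β B G' τ) ξ)) ≤ ENNReal.ofReal (kap * C) * (2 * η * δ * ρ) +
          ENNReal.ofReal (kap * C) * (2 * η * ρ * δ) := by
    refine le_trans (setLIntegral_mono' measurableSet_Ioc fun τ hτ =>
      hw.nrm_forceT_sub_le (stronglyMeasurable_section mU τ)
            (stronglyMeasurable_section mU' τ) (stronglyMeasurable_section mT τ)
            (stronglyMeasurable_section mT' τ) (lt cU τ hτ) (lt cU' τ hτ)
            (lt cT τ hτ) (lt cT' τ hτ)) ?_
    rw [lintegral_add_left n3]
    exact add_le_add i3 i4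
  -- The constant 12 is 8 + 4: each of the two advection differences in a forcing contributes 2η,
  -- and those of the velocity are doubled by the bound for the Leray symbol.
  refine (add_le_add b1 b2).trans (le_of_eq ?_)
  ring

end

/-! ### Reflection symmetry, the Fourier side of real-valuedness -/

/-- Complex conjugation of vectors. -/
def conj3 : C3 →L[ℝ] C3 :=
  ((LinearIsometryEquiv.piLpCongrRight 2 fun _ : Fin 3 => Complex.conjLIE :
    C3 ≃ₗᵢ[ℝ] C3).toContinuousLinearEquiv : C3 →L[ℝ] C3)

theorem conj3_apply (v : C3) (k : Fin 3) : conj3 v k = (starRingEnd ℂ) (v k) := rfl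

/-- Complex conjugation of numbers. -/
def conj1 : ℂ →L[ℝ] ℂ := (Complex.conjCLE : ℂ →L[ℝ] ℂ)

theorem conj1_apply (z : ℂ) : conj1 z = (starRingEnd ℂ) z := rfl

theorem norm_conj3 (v : C3) : ‖conj3 v‖ = ‖v‖ :=
  LinearIsometryEquiv.norm_map (LinearIsometryEquiv.piLpCongrRight 2 fun _ : Fin 3 =>
    Complex.conjLIE) v

theorem conj3_smul (c : ℂ) (v : C3) : conj3 (c • v) = (starRingEnd ℂ) c • conj3 v := by
  ext k; simp [conj3_apply]

theorem conj3_conj3 (v : C3) : conj3 (conj3 v) = v := by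
  ext k; simp [conj3_apply]

section

variable {E : Type} [NormedAddCommGroup E] [NormedSpace ℝ E]

/-- The reflection `f ↦ conj f(-ξ)`. -/
def refl (J : E →L[ℝ] E) (f : E3 → E) (ξ : E3) : E := J (f (-ξ))

/-- Multipliers depending on |ξ| alone are unchanged by the reflection. -/
theorem refl_Duh {J : E →L[ℝ] E} (hJ : ∀ v, J (J v) = v) {γ : ℝ} {A : E3 → E} {F : ℝ → E3 → E}
    {t : ℝ} : refl J (Duh γ A F t) = Duh γ (refl J A) (fun τ => refl J (F τ)) t := by
  ext ξ
  -- An invertible linear map commutes with every Bochner integral, integrable or not, so no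
  -- integrability is assumed.
  let e : E ≃L[ℝ] E := ContinuousLinearEquiv.equivOfInverse J J hJ hJ
  have h : J (∫ τ in (0 : ℝ)..t, Real.exp (τ * ‖ξ‖ ^ (2 * γ)) • F τ (-ξ)) =
      ∫ τ in (0 : ℝ)..t, Real.exp (τ * ‖ξ‖ ^ (2 * γ)) • J (F τ (-ξ)) := by
    simp only [intervalIntegral, map_sub]
    have h2 : ∀ S : Set ℝ, J (∫ τ in S, Real.exp (τ * ‖ξ‖ ^ (2 * γ)) • F τ (-ξ)) =
        ∫ τ in S, Real.exp (τ * ‖ξ‖ ^ (2 * γ)) • J (F τ (-ξ)) := fun S => by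
      have := e.integral_comp_comm (μ := volume.restrict S)
        (fun τ => Real.exp (τ * ‖ξ‖ ^ (2 * γ)) • F τ (-ξ))
      simp only [map_smul] at this
      exact this.symm
    rw [h2, h2]
  simp only [refl, Duh, duh, norm_neg, map_smul, map_add, h]

end

theorem dotc_conj (ξ : E3) (v : C3) : dotc ξ (conj3 v) = (starRingEnd ℂ) (dotc ξ v) := by
  simp [dotc, conj3_apply]

theorem dotc_neg_left (ξ : E3) (v : C3) : dotc (-ξ) v = -dotc ξ v := by
  simp [dotc]

/-- Two signs cancel: one from ξ ↦ -ξ in the factor ξ, one from conjugating i. -/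
theorem refl_adv {E : Type} [NormedAddCommGroup E] [NormedSpace ℂ E]
    {J : E →L[ℝ] E} (hJ : ∀ v, J (J v) = v) (hJc : ∀ (c : ℂ) v, J (c • v) = (starRingEnd ℂ) c • J v)
    {U : E3 → C3} {V : E3 → E} : refl J (adv U V) = adv (refl conj3 U) (refl J V) := by
  ext ξ
  let e : E ≃L[ℝ] E := ContinuousLinearEquiv.equivOfInverse J J hJ hJ
  have h := e.integral_comp_comm (μ := (volume : Measure E3))
    (fun η => dotc (-ξ) (U (-ξ - η)) • V η)
  have h' : J (∫ η, dotc (-ξ) (U (-ξ - η)) • V η) =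
    ∫ η, (starRingEnd ℂ) (dotc (-ξ) (U (-ξ - η))) • J (V η) := by
    rw [← integral_congr_ae (ae_of_all _ fun η => hJc _ _)]
    exact h.symm
  have h3 : ∫ η, (starRingEnd ℂ) (dotc (-ξ) (U (-ξ - η))) • J (V η) =
      -∫ η, dotc ξ (conj3 (U (-(ξ - η)))) • J (V (-η)) := by
    rw [← integral_neg_eq_self, ← integral_neg]
    congr 1
    funext η
    rw [dotc_neg_left, dotc_conj, map_neg, neg_smul, show -ξ - -η = -(ξ - η) by abel]
  simp only [refl, adv, hJc, h', h3]
  simp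

theorem conj3_lerayAt (ξ : E3) (v : C3) : conj3 (lerayAt (-ξ) v) = lerayAt ξ (conj3 v) := by
  ext k
  simp [conj3_apply, lerayAt_apply, dotc_neg_left, dotc_conj]

theorem refl_forceU {U : E3 → C3} {Θ : E3 → ℂ} :
    refl conj3 (forceU U Θ) = forceU (refl conj3 U) (refl conj1 Θ) := by
  ext1 ξ
  have h1 : conj3 (adv U U (-ξ)) = adv (refl conj3 U) (refl conj3 U) ξ :=
    congrFun (refl_adv conj3_conj3 conj3_smul) ξ
  have h2 : conj3 (EuclideanSpace.single 2 (Θ (-ξ))) =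
      EuclideanSpace.single 2 (refl conj1 Θ ξ) := by
    ext k
    simp only [conj3_apply, PiLp.single_apply, refl, conj1_apply]
    split_ifs <;> simp
  rw [refl, forceU, map_sub, conj3_lerayAt, conj3_lerayAt, h1, h2, forceU]

theorem refl_forceT {U : E3 → C3} {Θ : E3 → ℂ} :
    refl conj1 (forceT U Θ) = forceT (refl conj3 U) (refl conj1 Θ) := by
  ext1 ξ
  have h1 : conj1 (adv U Θ (-ξ)) = adv (refl conj3 U) (refl conj1 Θ) ξ :=
    congrFun (refl_adv (by simp [conj1_apply]) (by simp [conj1_apply])) ξ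
  rw [refl, forceT, map_neg, h1, forceT]

theorem ae_eq_of_nrm_eq_zero {w : E3 → ℝ} {C : ℝ} (hw : GoodWeight w C) {E : Type*}
    [NormedAddCommGroup E] {f g : E3 → E} (hf : StronglyMeasurable f) (hg : StronglyMeasurable g)
    (h : nrm w (fun ξ => f ξ - g ξ) = 0) : f =ᵐ[volume] g := by
  have hwm := hw.measurable
  have := (hf.sub hg).enorm
  simp only [Pi.sub_apply] at this
  rw [nrm, lintegral_eq_zero_iff (by fun_prop)] at h
  filter_upwards [h, ae_ne_zero] with ξ hξ h0
  have h1 := hw.one_le ξ h0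
  simp only [Pi.zero_apply, mul_eq_zero, ENNReal.ofReal_eq_zero, enorm_eq_zero] at hξ
  rcases hξ with h2 | h2
  · have := mul_nonpos_of_nonneg_of_nonpos hw.const_pos.le h2
    linarith
  · exact sub_eq_zero.1 h2

theorem ae_eq_of_lintegral_nrm_eq_zero {w : E3 → ℝ} {C : ℝ} (hw : GoodWeight w C) {E : Type*}
    [NormedAddCommGroup E] {f g : ℝ → E3 → E} (hf : StronglyMeasurable (Function.uncurry f))
    (hg : StronglyMeasurable (Function.uncurry g)) {S : Set ℝ}
    (h : ∫⁻ τ in S, nrm w (fun ξ => f τ ξ - g τ ξ) = 0) :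
    ∀ᵐ τ ∂volume.restrict S, f τ =ᵐ[volume] g τ := by
  rw [lintegral_eq_zero_iff (measurable_nrm hw.measurable
    (f := fun τ ξ => f τ ξ - g τ ξ) (hf.sub hg))] at h
  filter_upwards [h] with τ hτ
  exact ae_eq_of_nrm_eq_zero hw (stronglyMeasurable_section hf τ)
    (stronglyMeasurable_section hg τ) hτ

theorem Duh_congr_data {E : Type} [NormedAddCommGroup E] [NormedSpace ℝ E] {γ : ℝ} {A A' : E3 → E}
    {F : ℝ → E3 → E} (h : A =ᵐ[volume] A') (t : ℝ) : Duh γ A F t =ᵐ[volume] Duh γ A' F t := by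
  filter_upwards [h] with ξ hξ
  rw [Duh, Duh, hξ]

theorem nrm_refl {w : E3 → ℝ} (hw : ∀ ξ, w (-ξ) = w ξ) {E : Type} [NormedAddCommGroup E]
    [NormedSpace ℝ E] {J : E →L[ℝ] E} (hJ : ∀ v, ‖J v‖ = ‖v‖) (f : E3 → E) :
    nrm w (refl J f) = nrm w f := by
  unfold nrm
  rw [← lintegral_neg_eq_self]
  refine lintegral_congr fun ξ => ?_
  rw [hw, refl, neg_neg, ← ofReal_norm, hJ, ofReal_norm]

theorem stronglyMeasurable_refl {E : Type} [NormedAddCommGroup E] [NormedSpace ℝ E]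
    (J : E →L[ℝ] E) {F : ℝ → E3 → E} (hF : StronglyMeasurable (Function.uncurry F)) :
    StronglyMeasurable (Function.uncurry fun τ => refl J (F τ)) :=
  J.continuous.comp_stronglyMeasurable
    (hF.comp_measurable (g := fun p : ℝ × E3 => (p.1, -p.2)) (by fun_prop))

section

variable {w : E3 → ℝ} {C : ℝ} {α β T : ℝ}

/-- Uniqueness of the forcings in a ball gives the symmetry of solutions with symmetric data. -/
theorem GoodWeight.refl_eq_of_solves (hw : GoodWeight w C) (hwn : ∀ ξ, w (-ξ) = w ξ) {η ρ : ℝ≥0∞}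
    {A : E3 → C3} {B : E3 → ℂ} {F : ℝ → E3 → C3} {G : ℝ → E3 → ℂ} (hT : 0 ≤ T)
    (hη : Gain w α T η) (hη' : Gain w β T η) (hρ : ρ < ⊤)
    (hsmall : 2 * ENNReal.ofReal T + 12 * ENNReal.ofReal (kap * C) * η * ρ ≤ 2⁻¹)
    (hA : StronglyMeasurable A) (hB : StronglyMeasurable B)
    (hF : StronglyMeasurable (Function.uncurry F)) (hG : StronglyMeasurable (Function.uncurry G))
    (hAF : nrm w A + ∫⁻ τ in Ioc 0 T, nrm w (F τ) ≤ ρ)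
    (hBG : nrm w B + ∫⁻ τ in Ioc 0 T, nrm w (G τ) ≤ ρ)
    (hsol : Solves α β A B F G (Ioc 0 T))
    (hsA : refl conj3 A =ᵐ[volume] A) (hsB : refl conj1 B =ᵐ[volume] B) :
    (∀ᵐ τ ∂volume.restrict (Ioc 0 T), refl conj3 (F τ) =ᵐ[volume] F τ) ∧
      ∀ᵐ τ ∂volume.restrict (Ioc 0 T), refl conj1 (G τ) =ᵐ[volume] G τ := by
  have j1 : ∀ v, conj1 (conj1 v) = v := by simp [conj1_apply]
  have n1 : ∀ v, ‖conj1 v‖ = ‖v‖ := by simp [conj1_apply]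
  have hF' := stronglyMeasurable_refl conj3 hF
  have hG' := stronglyMeasurable_refl conj1 hG
  have eF : ∀ τ, nrm w (refl conj3 (F τ)) = nrm w (F τ) := fun τ => nrm_refl hwn norm_conj3 _
  have eG : ∀ τ, nrm w (refl conj1 (G τ)) = nrm w (G τ) := fun τ => nrm_refl hwn n1 _
  have neg : ∀ {p : E3 → Prop}, (∀ᵐ ξ, p ξ) → ∀ᵐ ξ, p (-ξ) := fun h =>
    (Measure.measurePreserving_neg (volume : Measure E3)).quasiMeasurePreserving.ae h
  have dF : ∀ τ, refl conj3 (Duh α A F τ) =ᵐ[volume]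
      Duh α A (fun τ => refl conj3 (F τ)) τ := fun τ => by
    rw [refl_Duh conj3_conj3]; exact Duh_congr_data hsA τ
  have dG : ∀ τ, refl conj1 (Duh β B G τ) =ᵐ[volume]
      Duh β B (fun τ => refl conj1 (G τ)) τ := fun τ => by
    rw [refl_Duh j1]; exact Duh_congr_data hsB τ
  have s1 : ∀ᵐ τ ∂volume.restrict (Ioc 0 T), refl conj3 (F τ) =ᵐ[volume]
      forceU (Duh α A (fun τ => refl conj3 (F τ)) τ) (Duh β B (fun τ => refl conj1 (G τ)) τ) := by
    filter_upwards [hsol.1] with τ hτ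
    have h1 : refl conj3 (F τ) =ᵐ[volume] refl conj3 (forceU (Duh α A F τ) (Duh β B G τ)) := by
      filter_upwards [neg hτ] with ξ hξ
      rw [refl, hξ, refl]
    rw [refl_forceU] at h1
    exact h1.trans (forceU_congr (dF τ) (dG τ))
  have s2 : ∀ᵐ τ ∂volume.restrict (Ioc 0 T), refl conj1 (G τ) =ᵐ[volume]
      forceT (Duh α A (fun τ => refl conj3 (F τ)) τ) (Duh β B (fun τ => refl conj1 (G τ)) τ) := by
    filter_upwards [hsol.2] with τ hτ
    have h1 : refl conj1 (G τ) =ᵐ[volume] refl conj1 (forceT (Duh α A F τ) (Duh β B G τ)) := by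
      filter_upwards [neg hτ] with ξ hξ
      rw [refl, hξ, refl]
    rw [refl_forceT] at h1
    exact h1.trans (ae_of_all _ (forceT_congr (dF τ) (dG τ)))
  set δU := ∫⁻ τ in Ioc 0 T, nrm w (fun ξ => refl conj3 (F τ) ξ - F τ ξ)
  set δT := ∫⁻ τ in Ioc 0 T, nrm w (fun ξ => refl conj1 (G τ) ξ - G τ ξ)
  -- The reflected forcings solve the same problem in the same ball. The contraction estimate gives
  -- δ ≤ δ/2 for the finite distance δ between the two, hence δ = 0.
  have key := hw.lintegral_force_sub_le (α := α) (β := β) (A := A) (B := B) (δ := δU + δT)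
    hT hη hη' hρ hA hB hF' hF hG' hG (by simpa only [eF] using hAF) hAF
    (by simpa only [eG] using hBG) hBG le_self_add le_add_self
  have e1 : ∫⁻ τ in Ioc 0 T, nrm w (fun ξ => forceU (Duh α A (fun τ => refl conj3 (F τ)) τ)
      (Duh β B (fun τ => refl conj1 (G τ)) τ) ξ - forceU (Duh α A F τ) (Duh β B G τ) ξ) = δU := by
    refine lintegral_congr_ae ?_
    filter_upwards [s1, hsol.1] with τ h1 h2
    refine nrm_congr ?_
    filter_upwards [h1, h2] with ξ h3 h4
    rw [h3, h4]
  have e2 : ∫⁻ τ in Ioc 0 T, nrm w (fun ξ => forceT (Duh α A (fun τ => refl conj3 (F τ)) τ)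
      (Duh β B (fun τ => refl conj1 (G τ)) τ) ξ - forceT (Duh α A F τ) (Duh β B G τ) ξ) = δT := by
    refine lintegral_congr_ae ?_
    filter_upwards [s2, hsol.2] with τ h1 h2
    refine nrm_congr ?_
    filter_upwards [h1, h2] with ξ h3 h4
    rw [h3, h4]
  rw [e1, e2] at key
  have fin : δU + δT < ⊤ := by
    have b1 : δU ≤ ρ + ρ := by
      refine le_trans (lintegral_mono fun τ => nrm_sub_le hw.measurable
        (stronglyMeasurable_section hF' τ).aestronglyMeasurable) ?_
      rw [lintegral_add_left (measurable_nrm hw.measurable hF')]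
      simp only [eF]
      exact add_le_add (le_add_self.trans hAF) (le_add_self.trans hAF)
    have b2 : δT ≤ ρ + ρ := by
      refine le_trans (lintegral_mono fun τ => nrm_sub_le hw.measurable
        (stronglyMeasurable_section hG' τ).aestronglyMeasurable) ?_
      rw [lintegral_add_left (measurable_nrm hw.measurable hG')]
      simp only [eG]
      exact add_le_add (le_add_self.trans hBG) (le_add_self.trans hBG)
    exact (add_le_add b1 b2).trans_lt (by simp [hρ])
  have zero : δU + δT = 0 := by
    have h1 : δU + δT ≤ 2⁻¹ * (δU + δT) := key.trans (by gcongr)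
    by_contra h0
    have h2 : 2⁻¹ * (δU + δT) < 1 * (δU + δT) :=
      ENNReal.mul_lt_mul_left h0 fin.ne (ENNReal.inv_lt_one.2 (by norm_num))
    rw [one_mul] at h2
    exact absurd h1 (not_le.2 h2)
  rw [add_eq_zero] at zero
  exact ⟨ae_eq_of_lintegral_nrm_eq_zero hw hF' hF zero.1,
    ae_eq_of_lintegral_nrm_eq_zero hw hG' hG zero.2⟩

/-! ### Solutions on a short time interval -/

theorem exists_small {k r c : ℝ} (hk : 0 < k) (hr : 1 ≤ r) (hc : 0 < c) :
    ∃ T : ℝ, 0 < T ∧ (2 * T + 12 * k * (1 / (48 * k * r ^ 2) + c * T) * r) * r = 1 / 2 := by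
  -- The term 1/(48kr²) contributes 1/4 by itself; the rest is linear in T, and T is chosen to make
  -- it 1/4 as well.
  refine ⟨1 / (4 * (2 * r + 12 * k * c * r ^ 2)), by positivity, ?_⟩
  field_simp
  ring

/-- Puts the weight into the measure, so that the space of forcings is an ordinary `L¹` space and
the abstract fixed point theorem applies. -/
theorem lintegral_withDensity_prod {w : E3 → ℝ} (hw : Measurable w) {E : Type*}
    [NormedAddCommGroup E] {f : ℝ × E3 → E} (hf : StronglyMeasurable f) (S : Set ℝ) :
    ∫⁻ p, ‖f p‖ₑ ∂(((volume.restrict S).prod (volume : Measure E3)).withDensity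
      fun p => ENNReal.ofReal (w p.2)) = ∫⁻ τ in S, nrm w (fun ξ => f (τ, ξ)) := by
  have := hf.enorm
  rw [lintegral_withDensity_eq_lintegral_mul _ (by fun_prop) this, lintegral_prod _ (by fun_prop)]
  rfl

theorem four_add_two_le (x y z : ℝ≥0∞) : 4 * x * y * z + 2 * x * y * z ≤ 12 * x * y * z := by
  calc _ = 6 * (x * y * z) := by ring
    _ ≤ 12 * (x * y * z) := mul_le_mul_left (by norm_num) _
    _ = _ := by ring

/-- A pair of forcings is mapped to the forcings produced by its Duhamel flows. If the pair lies in
the unit ball, the flows are bounded by ρ, which exceeds the norm of the data by at least one; the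
two smallness assumptions say that the ball is preserved and that the map halves distances. -/
theorem GoodWeight.exists_solves_of_small (hw : GoodWeight w C) {η ρ : ℝ≥0∞}
    {A : E3 → C3} {B : E3 → ℂ} (hT : 0 < T) (hη : Gain w α T η) (hη' : Gain w β T η) (hρ : ρ < ⊤)
    (hsmall : (2 * ENNReal.ofReal T + 12 * ENNReal.ofReal (kap * C) * η * ρ) * ρ ≤ 1)
    (small' : 2 * ENNReal.ofReal T + 12 * ENNReal.ofReal (kap * C) * η * ρ ≤ 2⁻¹)
    (hA : StronglyMeasurable A) (hB : StronglyMeasurable B)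
    (hAρ : nrm w A + 1 ≤ ρ) (hBρ : nrm w B + 1 ≤ ρ) :
    ∃ (F : ℝ → E3 → C3) (G : ℝ → E3 → ℂ),
      StronglyMeasurable (Function.uncurry F) ∧ StronglyMeasurable (Function.uncurry G) ∧
      nrm w A + ∫⁻ τ in Ioc 0 T, nrm w (F τ) ≤ ρ ∧
      nrm w B + ∫⁻ τ in Ioc 0 T, nrm w (G τ) ≤ ρ ∧
      Solves α β A B F G (Ioc 0 T) := by
  set ν := ((volume.restrict (Ioc 0 T)).prod (volume : Measure E3)).withDensity
      fun p => ENNReal.ofReal (w p.2)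
  let cF : (ℝ × E3 → C3 × ℂ) → ℝ → E3 → C3 := fun f τ ξ => (f (τ, ξ)).1
  let cG : (ℝ × E3 → C3 × ℂ) → ℝ → E3 → ℂ := fun f τ ξ => (f (τ, ξ)).2
  let Φ : (ℝ × E3 → C3 × ℂ) → ℝ × E3 → C3 × ℂ := fun f p =>
    (forceU (Duh α A (cF f) p.1) (Duh β B (cG f) p.1) p.2,
      forceT (Duh α A (cF f) p.1) (Duh β B (cG f) p.1) p.2)
  have mF : ∀ {f}, StronglyMeasurable f → StronglyMeasurable (Function.uncurry (cF f)) :=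
    fun h => h.fst
  have mG : ∀ {f}, StronglyMeasurable f → StronglyMeasurable (Function.uncurry (cG f)) :=
    fun h => h.snd
  have en : ∀ f : ℝ × E3 → C3 × ℂ, StronglyMeasurable f → ∫⁻ p, ‖f p‖ₑ ∂ν =
      ∫⁻ τ in Ioc 0 T, nrm w (fun ξ => f (τ, ξ)) := fun f hf =>
    lintegral_withDensity_prod hw.measurable hf _
  have fst_le : ∀ x : C3 × ℂ, ‖x.1‖ₑ ≤ ‖x‖ₑ := fun x => by
    rw [← ofReal_norm, ← ofReal_norm]; exact ENNReal.ofReal_le_ofReal (norm_fst_le x)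
  have snd_le : ∀ x : C3 × ℂ, ‖x.2‖ₑ ≤ ‖x‖ₑ := fun x => by
    rw [← ofReal_norm, ← ofReal_norm]; exact ENNReal.ofReal_le_ofReal (norm_snd_le x)
  have le_sum : ∀ x : C3 × ℂ, ‖x‖ₑ ≤ ‖x.1‖ₑ + ‖x.2‖ₑ := fun x => by
    rw [← ofReal_norm, ← ofReal_norm, ← ofReal_norm, ← ENNReal.ofReal_add (norm_nonneg _)
      (norm_nonneg _)]
    refine ENNReal.ofReal_le_ofReal ?_
    rw [Prod.norm_def]
    exact max_le_add_of_nonneg (norm_nonneg _) (norm_nonneg _)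
  have hsum : ∀ f : ℝ × E3 → C3 × ℂ, StronglyMeasurable f → ∫⁻ p, ‖f p‖ₑ ∂ν ≤
      (∫⁻ τ in Ioc 0 T, nrm w (cF f τ)) + ∫⁻ τ in Ioc 0 T, nrm w (cG f τ) := fun f hf => by
    rw [en f hf, ← lintegral_add_left (measurable_nrm hw.measurable (mF hf))]
    refine lintegral_mono fun τ => ?_
    have h1 : Measurable fun ξ => ENNReal.ofReal (w ξ) * ‖cF f τ ξ‖ₑ :=
      (ENNReal.measurable_ofReal.comp hw.measurable).mul
        (stronglyMeasurable_section (mF hf) τ).enorm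
    simp only [nrm]
    rw [← lintegral_add_left h1]
    refine lintegral_mono fun ξ => ?_
    rw [← mul_add]
    exact mul_le_mul_right (le_sum _) _
  have hfst : ∀ f : ℝ × E3 → C3 × ℂ, StronglyMeasurable f →
      ∫⁻ τ in Ioc 0 T, nrm w (cF f τ) ≤ ∫⁻ p, ‖f p‖ₑ ∂ν := fun f hf => by
    rw [en f hf]
    exact lintegral_mono fun τ => nrm_mono (ae_of_all _ fun ξ => fst_le _)
  have hsnd : ∀ f : ℝ × E3 → C3 × ℂ, StronglyMeasurable f →
      ∫⁻ τ in Ioc 0 T, nrm w (cG f τ) ≤ ∫⁻ p, ‖f p‖ₑ ∂ν := fun f hf => by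
    rw [en f hf]
    exact lintegral_mono fun τ => nrm_mono (ae_of_all _ fun ξ => snd_le _)
  have hAf : ∀ f, StronglyMeasurable f → ∫⁻ p, ‖f p‖ₑ ∂ν ≤ 1 →
      nrm w A + ∫⁻ τ in Ioc 0 T, nrm w (cF f τ) ≤ ρ := fun f hf h1 =>
    (add_le_add le_rfl ((hfst f hf).trans h1)).trans hAρ
  have hBf : ∀ f, StronglyMeasurable f → ∫⁻ p, ‖f p‖ₑ ∂ν ≤ 1 →
      nrm w B + ∫⁻ τ in Ioc 0 T, nrm w (cG f τ) ≤ ρ := fun f hf h1 =>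
    (add_le_add le_rfl ((hsnd f hf).trans h1)).trans hBρ
  have hΦm : ∀ f, StronglyMeasurable f → StronglyMeasurable (Φ f) := fun f hf =>
    (stronglyMeasurable_forceU (stronglyMeasurable_Duh hA (mF hf))
      (stronglyMeasurable_Duh hB (mG hf))).prodMk
    (stronglyMeasurable_forceT (stronglyMeasurable_Duh hA (mF hf))
      (stronglyMeasurable_Duh hB (mG hf)))
  have hb : ∀ f, StronglyMeasurable f → ∫⁻ p, ‖f p‖ₑ ∂ν ≤ 1 → ∫⁻ p, ‖Φ f p‖ₑ ∂ν ≤ 1 := by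
    intro f hf h1
    have fA : ∫⁻ τ in Ioc 0 T, nrm w (cF f τ) < ⊤ :=
      (le_add_self.trans (hAf f hf h1)).trans_lt hρ
    have fB : ∫⁻ τ in Ioc 0 T, nrm w (cG f τ) < ⊤ :=
      (le_add_self.trans (hBf f hf h1)).trans_lt hρ
    have cU := (hw.controlled_Duh (γ := α) hT.le hA (mF hf) fA).mono (hAf f hf h1)
    have cT := (hw.controlled_Duh (γ := β) hT.le hB (mG hf) fB).mono (hBf f hf h1)
    have mU := stronglyMeasurable_Duh (γ := α) hA (mF hf)
    have mT := stronglyMeasurable_Duh (γ := β) hB (mG hf)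
    refine (hsum _ (hΦm f hf)).trans ?_
    refine (add_le_add (hw.lintegral_forceU_le hη mU mT cU cT)
      (hw.lintegral_forceT_le hη hη' mU mT cU cT)).trans ?_
    calc _ ≤ (2 * ENNReal.ofReal T + 12 * ENNReal.ofReal (kap * C) * η * ρ) * ρ := by
          rw [← add_mul, add_assoc]
          exact mul_le_mul_left (add_le_add le_rfl (four_add_two_le _ _ _)) _
      _ ≤ 1 := hsmall
  have hl : ∀ f g, StronglyMeasurable f → ∫⁻ p, ‖f p‖ₑ ∂ν ≤ 1 → StronglyMeasurable g →
      ∫⁻ p, ‖g p‖ₑ ∂ν ≤ 1 → ∫⁻ p, ‖Φ f p - Φ g p‖ₑ ∂ν ≤ 2⁻¹ * ∫⁻ p, ‖f p - g p‖ₑ ∂ν := by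
    intro f g hf hf1 hg hg1
    have hfg : StronglyMeasurable fun p => f p - g p := hf.sub hg
    have hΦfg : StronglyMeasurable fun p => Φ f p - Φ g p := (hΦm f hf).sub (hΦm g hg)
    have e1 : ∀ τ, cF (fun p => Φ f p - Φ g p) τ = fun ξ =>
        forceU (Duh α A (cF f) τ) (Duh β B (cG f) τ) ξ -
          forceU (Duh α A (cF g) τ) (Duh β B (cG g) τ) ξ := fun τ => rfl
    have e2 : ∀ τ, cG (fun p => Φ f p - Φ g p) τ = fun ξ =>
        forceT (Duh α A (cF f) τ) (Duh β B (cG f) τ) ξ -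
          forceT (Duh α A (cF g) τ) (Duh β B (cG g) τ) ξ := fun τ => rfl
    have e3 : ∀ τ, cF (fun p => f p - g p) τ = fun ξ => cF f τ ξ - cF g τ ξ := fun τ => rfl
    have e4 : ∀ τ, cG (fun p => f p - g p) τ = fun ξ => cG f τ ξ - cG g τ ξ := fun τ => rfl
    have d1 := hfst _ hfg
    have d2 := hsnd _ hfg
    have h1 := hsum _ hΦfg
    simp only [e1, e2] at h1
    simp only [e3] at d1
    simp only [e4] at d2
    exact h1.trans ((hw.lintegral_force_sub_le hT.le hη hη' hρ hA hB (mF hf) (mF hg) (mG hf)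
      (mG hg) (hAf f hf hf1) (hAf g hg hg1) (hBf f hf hf1) (hBf g hg hg1) d1 d2).trans
      (mul_le_mul_left small' _))
  obtain ⟨f, hf, hf1, hfix⟩ := exists_fixedPoint_L1 ν Φ (fun f hf _ => hΦm f hf) hb hl
  have hd : StronglyMeasurable fun p => Φ f p - f p := (hΦm f hf).sub hf
  have z1 := le_antisymm ((hfst _ hd).trans hfix.le) zero_le
  have z2 := le_antisymm ((hsnd _ hd).trans hfix.le) zero_le
  have mΦ1 : StronglyMeasurable (Function.uncurry (cF (Φ f))) := mF (hΦm f hf)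
  have mΦ2 : StronglyMeasurable (Function.uncurry (cG (Φ f))) := mG (hΦm f hf)
  have hsol : Solves α β A B (cF f) (cG f) (Ioc 0 T) := by
    constructor
    · filter_upwards [ae_eq_of_lintegral_nrm_eq_zero hw mΦ1 (mF hf) z1] with τ hτ
      exact hτ.symm
    · filter_upwards [ae_eq_of_lintegral_nrm_eq_zero hw mΦ2 (mG hf) z2] with τ hτ
      exact hτ.symm
  exact ⟨cF f, cG f, mF hf, mG hf, hAf f hf hf1, hBf f hf hf1, hsol⟩

/-- Local existence, on the Fourier side. -/
theorem GoodWeight.exists_solves (hw : GoodWeight w C) (hwn : ∀ ξ, w (-ξ) = w ξ)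
    (hα : 1 / 2 < α) (hβ : 1 / 2 < β) {A : E3 → C3} {B : E3 → ℂ}
    (hA : StronglyMeasurable A) (hB : StronglyMeasurable B) (hA1 : nrm w A < ⊤)
    (hB1 : nrm w B < ⊤) (hsA : refl conj3 A =ᵐ[volume] A) (hsB : refl conj1 B =ᵐ[volume] B) :
    ∃ T > 0, ∃ (F : ℝ → E3 → C3) (G : ℝ → E3 → ℂ),
      StronglyMeasurable (Function.uncurry F) ∧ StronglyMeasurable (Function.uncurry G) ∧
      ∫⁻ τ in Ioc 0 T, nrm w (F τ) < ⊤ ∧ ∫⁻ τ in Ioc 0 T, nrm w (G τ) < ⊤ ∧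
      Solves α β A B F G (Ioc 0 T) ∧
      (∀ᵐ τ ∂volume.restrict (Ioc 0 T), refl conj3 (F τ) =ᵐ[volume] F τ) ∧
      ∀ᵐ τ ∂volume.restrict (Ioc 0 T), refl conj1 (G τ) =ᵐ[volume] G τ := by
  set ρ : ℝ≥0∞ := nrm w A + nrm w B + 1
  have hρ : ρ < ⊤ := by simp [ρ, hA1, hB1]
  have hρ1 : 1 ≤ ρ := le_add_self
  have hr : 1 ≤ ρ.toReal := by
    have := ENNReal.toReal_mono hρ.ne hρ1
    simpa using this
  have hk : 0 < kap * C := mul_pos kap_pos hw.const_pos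
  -- The square of ρ appears because the self-mapping condition is quadratic in ρ. As ρ ≥ 1, that
  -- condition, with 1/2 on the right, also implies the contraction condition.
  have hε : 0 < 1 / (48 * (kap * C) * ρ.toReal ^ 2) := by positivity
  obtain ⟨c, hc, hcg⟩ := hw.exists_gain hα hε
  obtain ⟨c', hc', hcg'⟩ := hw.exists_gain hβ hε
  obtain ⟨T, hT, hTs⟩ := exists_small hk hr (add_pos hc hc')
  set η : ℝ≥0∞ := ENNReal.ofReal (1 / (48 * (kap * C) * ρ.toReal ^ 2) + (c + c') * T)
  have hη : Gain w α T η := Gain.mono (hcg T hT.le) (ENNReal.ofReal_le_ofReal (by gcongr; linarith))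
  have hη' : Gain w β T η := Gain.mono (hcg' T hT.le) (ENNReal.ofReal_le_ofReal (by gcongr; linarith))
  have small : (2 * ENNReal.ofReal T + 12 * ENNReal.ofReal (kap * C) * η * ρ) * ρ = 2⁻¹ := by
    have h1 : ρ = ENNReal.ofReal ρ.toReal := (ENNReal.ofReal_toReal hρ.ne).symm
    have h2 : (2 : ℝ≥0∞) = ENNReal.ofReal 2 := by simp
    have h3 : (12 : ℝ≥0∞) = ENNReal.ofReal 12 := by simp
    rw [h1, h3, h2, ← ENNReal.ofReal_inv_of_pos (by norm_num), ← ENNReal.ofReal_mul (by norm_num),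
      ← ENNReal.ofReal_mul (by norm_num), ← ENNReal.ofReal_mul (by positivity),
      ← ENNReal.ofReal_mul (by positivity), ← ENNReal.ofReal_add (by positivity) (by positivity),
      ← ENNReal.ofReal_mul (by positivity)]
    congr 1
    rw [hTs]; norm_num
  have small' : 2 * ENNReal.ofReal T + 12 * ENNReal.ofReal (kap * C) * η * ρ ≤ 2⁻¹ := by
    rw [← small]
    exact le_mul_of_one_le_right zero_le hρ1
  have hsmall : (2 * ENNReal.ofReal T + 12 * ENNReal.ofReal (kap * C) * η * ρ) * ρ ≤ 1 := by
    rw [small]; exact ENNReal.inv_le_one.2 (by norm_num)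
  obtain ⟨F, G, mF, mG, hAF, hBG, hsol⟩ := hw.exists_solves_of_small hT hη hη' hρ hsmall small'
    hA hB (add_le_add le_self_add le_rfl) (add_le_add le_add_self le_rfl)
  have hsym := hw.refl_eq_of_solves hwn hT.le hη hη' hρ small' hA hB mF mG hAF hBG hsol hsA hsB
  exact ⟨T, hT, F, G, mF, mG, (le_add_self.trans hAF).trans_lt hρ,
    (le_add_self.trans hBG).trans_lt hρ, hsol, hsym.1, hsym.2⟩

end

/-! ### A priori estimates -/

section Real

variable {x y : ℝ → ℝ} {p q K t₀ t₁ : ℝ}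

/-- The right-hand side Y of the integral inequality is differentiable with Y' = K y h ≤ K h Y, so Y
exp(-K∫h) is nonincreasing. -/
theorem linear_gronwall (hy : Continuous y) {h : ℝ → ℝ} (hh : Continuous h) (hh0 : ∀ t, 0 ≤ h t)
    (hK : 0 ≤ K) (h01 : t₀ ≤ t₁)
    (hle : ∀ t ∈ Icc t₀ t₁, y t ≤ y t₀ + K * ∫ τ in t₀..t, y τ * h τ) :
    y t₁ ≤ y t₀ * Real.exp (K * ∫ τ in t₀..t₁, h τ) := by
  set Y : ℝ → ℝ := fun t => y t₀ + K * ∫ τ in t₀..t, y τ * h τ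
  have hY : ∀ t, HasDerivAt Y (K * (y t * h t)) t := fun t =>
    ((intervalIntegral.integral_hasDerivAt_right ((hy.mul hh).intervalIntegrable _ _)
      ((hy.mul hh).stronglyMeasurableAtFilter _ _) (hy.mul hh).continuousAt).const_mul K).const_add _
  have hH : ∀ t, HasDerivAt (fun t => Real.exp (-(K * ∫ τ in t₀..t, h τ)))
      (Real.exp (-(K * ∫ τ in t₀..t, h τ)) * (-(K * h t))) t := fun t =>
    (((intervalIntegral.integral_hasDerivAt_right (hh.intervalIntegrable _ _)
      (hh.stronglyMeasurableAtFilter _ _) hh.continuousAt).const_mul K).neg).exp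
  have hV : ∀ t, HasDerivAt (fun t => Y t * Real.exp (-(K * ∫ τ in t₀..t, h τ)))
      (K * (y t * h t) * Real.exp (-(K * ∫ τ in t₀..t, h τ)) +
        Y t * (Real.exp (-(K * ∫ τ in t₀..t, h τ)) * (-(K * h t)))) t := fun t => (hY t).mul (hH t)
  have hanti : AntitoneOn (fun t => Y t * Real.exp (-(K * ∫ τ in t₀..t, h τ))) (Icc t₀ t₁) := by
    refine antitoneOn_of_deriv_nonpos (convex_Icc _ _)
      (fun t _ => (hV t).continuousAt.continuousWithinAt)
      (fun t _ => (hV t).differentiableAt.differentiableWithinAt) fun t ht => ?_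
    rw [interior_Icc] at ht
    rw [(hV t).deriv]
    have h1 := hle t (Ioo_subset_Icc_self ht)
    have h2 : 0 ≤ K * h t * Real.exp (-(K * ∫ τ in t₀..t, h τ)) := by
      have := hh0 t
      positivity
    have h3 : 0 ≤ (Y t - y t) * (K * h t * Real.exp (-(K * ∫ τ in t₀..t, h τ))) :=
      mul_nonneg (sub_nonneg.2 h1) h2
    linarith
  have h4 := hanti (left_mem_Icc.2 h01) (right_mem_Icc.2 h01) h01
  have h5 : Y t₀ = y t₀ := by simp [Y]
  simp only [h5, intervalIntegral.integral_same, mul_zero, neg_zero, Real.exp_zero, mul_one] at h4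
  have h6 : Y t₁ ≤ y t₀ * Real.exp (K * ∫ τ in t₀..t₁, h τ) := by
    rw [Real.exp_neg, ← div_eq_mul_inv, div_le_iff₀ (Real.exp_pos _)] at h4
    exact h4
  exact (hle t₁ (right_mem_Icc.2 h01)).trans h6

theorem frac_le_frac {a b : ℝ} (ha : 0 ≤ a) (hab : a ≤ b) : a / (1 + a) ≤ b / (1 + b) := by
  rw [div_le_div_iff₀ (by linarith) (by linarith)]
  nlinarith

/-- Let Y be the right-hand side of the integral inequality and Z = Y^p + Y^q. Then Z' ≤ c Z(1+Z)
with c = (p+q)K, a logistic-type inequality linearized by Z/(1+Z): the derivative Z'/(1+Z)² of the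
latter is at most c Z/(1+Z). Finally y ≤ Y, with equality at t₀. -/
theorem blowup_rate (hy : Continuous y) (hx : Continuous x) (hx0 : ∀ t, 0 ≤ x t)
    (hxy : ∀ t, x t ≤ y t) (hp : 1 < p) (hq : 1 < q) (hK : 0 ≤ K) (h01 : t₀ ≤ t₁)
    (hle : ∀ t ∈ Icc t₀ t₁, y t ≤ y t₀ + K * ∫ τ in t₀..t, y τ * (1 + y τ ^ p + x τ ^ q)) :
    (y t₁ ^ p + y t₁ ^ q) / (1 + (y t₁ ^ p + y t₁ ^ q)) ≤
      Real.exp ((p + q) * K * (t₁ - t₀)) *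
        ((y t₀ ^ p + y t₀ ^ q) / (1 + (y t₀ ^ p + y t₀ ^ q))) := by
  have hy0 : ∀ t, 0 ≤ y t := fun t => (hx0 t).trans (hxy t)
  have hh : Continuous fun τ => y τ * (1 + y τ ^ p + x τ ^ q) := by
    have h1 : Continuous fun τ => y τ ^ p := hy.rpow_const fun _ => Or.inr (by linarith)
    have h2 : Continuous fun τ => x τ ^ q := hx.rpow_const fun _ => Or.inr (by linarith)
    fun_prop
  set Y : ℝ → ℝ := fun t => y t₀ + K * ∫ τ in t₀..t, y τ * (1 + y τ ^ p + x τ ^ q)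
  set c := (p + q) * K
  have hY : ∀ t, HasDerivAt Y (K * (y t * (1 + y t ^ p + x t ^ q))) t := fun t =>
    ((intervalIntegral.integral_hasDerivAt_right (hh.intervalIntegrable _ _)
      (hh.stronglyMeasurableAtFilter _ _) hh.continuousAt).const_mul K).const_add _
  set Z : ℝ → ℝ := fun t => Y t ^ p + Y t ^ q
  have hZ : ∀ t, HasDerivAt Z (K * (y t * (1 + y t ^ p + x t ^ q)) * p * Y t ^ (p - 1) +
      K * (y t * (1 + y t ^ p + x t ^ q)) * q * Y t ^ (q - 1)) t := fun t =>
    ((hY t).rpow_const (Or.inr hp.le)).add ((hY t).rpow_const (Or.inr hq.le))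
  have hYy : ∀ t ∈ Icc t₀ t₁, y t ≤ Y t := hle
  have hY0 : ∀ t ∈ Icc t₀ t₁, 0 ≤ Y t := fun t ht => (hy0 t).trans (hYy t ht)
  have hZ0 : ∀ t ∈ Icc t₀ t₁, 0 ≤ Z t := fun t ht => by
    have := hY0 t ht
    positivity
  set V : ℝ → ℝ := fun t => Z t / (1 + Z t) * Real.exp (-(c * t))
  have hE : ∀ t, HasDerivAt (fun t : ℝ => Real.exp (-(c * t))) (Real.exp (-(c * t)) * (-(c * 1))) t :=
    fun t => (((hasDerivAt_id t).const_mul c).neg).exp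
  have hV : ∀ t ∈ Icc t₀ t₁, ∃ Z', Z' ≤ c * (Z t * (1 + Z t)) ∧ HasDerivAt V
      ((Z' * (1 + Z t) - Z t * Z') / (1 + Z t) ^ 2 * Real.exp (-(c * t)) +
        Z t / (1 + Z t) * (Real.exp (-(c * t)) * (-(c * 1)))) t := by
    intro t ht
    have h1 := hZ0 t ht
    have h2 := hY0 t ht
    refine ⟨_, ?_, (((hZ t).div ((hZ t).const_add 1) (by linarith)).mul (hE t))⟩
    have e : ∀ r : ℝ, 1 < r → Y t * Y t ^ (r - 1) = Y t ^ r := fun r hr => by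
      rw [mul_comm, ← Real.rpow_add_one' h2 (by linarith), sub_add_cancel]
    -- Since x ≤ y ≤ Y, both powers are dominated by those of Y, and the inequality closes in Y
    -- alone.
    have h3 : y t * (1 + y t ^ p + x t ^ q) ≤ Y t * (1 + Z t) := by
      have h4 := hYy t ht
      have h5 : y t ^ p ≤ Y t ^ p := Real.rpow_le_rpow (hy0 t) h4 (by linarith)
      have h6 : x t ^ q ≤ Y t ^ q := Real.rpow_le_rpow (hx0 t) ((hxy t).trans h4) (by linarith)
      have h7 : 0 ≤ 1 + y t ^ p + x t ^ q := by
        have := Real.rpow_nonneg (hy0 t) p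
        have := Real.rpow_nonneg (hx0 t) q
        linarith
      have h8 : 1 + y t ^ p + x t ^ q ≤ 1 + Z t := by simp only [Z]; linarith
      exact mul_le_mul h4 h8 h7 h2
    have h9 : 0 ≤ p * Y t ^ (p - 1) + q * Y t ^ (q - 1) := by positivity
    calc K * (y t * (1 + y t ^ p + x t ^ q)) * p * Y t ^ (p - 1) +
          K * (y t * (1 + y t ^ p + x t ^ q)) * q * Y t ^ (q - 1)
        = K * ((y t * (1 + y t ^ p + x t ^ q)) * (p * Y t ^ (p - 1) + q * Y t ^ (q - 1))) := by ring
      _ ≤ K * ((Y t * (1 + Z t)) * (p * Y t ^ (p - 1) + q * Y t ^ (q - 1))) := by gcongr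
      _ = K * ((1 + Z t) * (p * Y t ^ p + q * Y t ^ q)) := by
          rw [← e p hp, ← e q hq]; ring
      _ ≤ K * ((1 + Z t) * ((p + q) * Z t)) := by
          have hYp : 0 ≤ Y t ^ p := by positivity
          have hYq : 0 ≤ Y t ^ q := by positivity
          gcongr
          simp only [Z]
          nlinarith
      _ = _ := by simp only [c]; ring
  have hanti : AntitoneOn V (Icc t₀ t₁) := by
    refine antitoneOn_of_deriv_nonpos (convex_Icc _ _)
      (fun t ht => by
        obtain ⟨_, _, h⟩ := hV t ht
        exact h.continuousAt.continuousWithinAt)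
      (fun t ht => by
        obtain ⟨_, _, h⟩ := hV t (interior_subset ht)
        exact h.differentiableAt.differentiableWithinAt) fun t ht => ?_
    obtain ⟨Z', hZ', h⟩ := hV t (interior_subset ht)
    have h1 := hZ0 t (interior_subset ht)
    rw [h.deriv]
    have h2 : (Z' * (1 + Z t) - Z t * Z') / (1 + Z t) ^ 2 ≤ c * (Z t / (1 + Z t)) := by
      have h3 : 0 < 1 + Z t := by linarith
      rw [div_le_iff₀ (by positivity)]
      calc _ = Z' := by ring
        _ ≤ _ := hZ'
        _ = _ := by field_simp
    have h4 := Real.exp_pos (-(c * t))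
    nlinarith
  have h4 := hanti (left_mem_Icc.2 h01) (right_mem_Icc.2 h01) h01
  have h5 : Y t₀ = y t₀ := by simp [Y]
  have h6 : Z t₀ = y t₀ ^ p + y t₀ ^ q := by simp only [Z, h5]
  simp only [V, h6] at h4
  have h7 : Z t₁ / (1 + Z t₁) ≤ Real.exp (c * (t₁ - t₀)) *
      ((y t₀ ^ p + y t₀ ^ q) / (1 + (y t₀ ^ p + y t₀ ^ q))) := by
    have h8 := mul_le_mul_of_nonneg_right h4 (Real.exp_nonneg (c * t₁))
    have e1 : Real.exp (-(c * t₁)) * Real.exp (c * t₁) = 1 := by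
      rw [← Real.exp_add, neg_add_cancel, Real.exp_zero]
    have e2 : Real.exp (-(c * t₀)) * Real.exp (c * t₁) = Real.exp (c * (t₁ - t₀)) := by
      rw [← Real.exp_add]; congr 1; ring
    generalize Z t₁ / (1 + Z t₁) = r₁ at *
    generalize (y t₀ ^ p + y t₀ ^ q) / (1 + (y t₀ ^ p + y t₀ ^ q)) = r₀ at *
    calc r₁ = r₁ * Real.exp (-(c * t₁)) * Real.exp (c * t₁) := by rw [mul_assoc, e1, mul_one]
      _ ≤ _ := h8
      _ = _ := by rw [mul_assoc, e2, mul_comm]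
  refine le_trans (frac_le_frac ?_ ?_) h7
  · have := hy0 t₁
    positivity
  · have h9 := hYy t₁ (right_mem_Icc.2 h01)
    have h10 := hy0 t₁
    exact add_le_add (Real.rpow_le_rpow h10 h9 (by linarith))
      (Real.rpow_le_rpow h10 h9 (by linarith))

end Real

/-! ### The energy inequality -/

/-- `F` and `G` are the forcings of a solution on `[0, T)` with data `A`, `B`, everything being
expressed on the Fourier side. -/
structure IsFourierSolution (w : E3 → ℝ) (α β : ℝ) (A : E3 → C3) (B : E3 → ℂ) (F : ℝ → E3 → C3)
    (G : ℝ → E3 → ℂ) (T : ℝ) : Prop where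
  meas_A : StronglyMeasurable A
  meas_B : StronglyMeasurable B
  meas_F : StronglyMeasurable (Function.uncurry F)
  meas_G : StronglyMeasurable (Function.uncurry G)
  nrm_A : nrm w A < ⊤
  nrm_B : nrm w B < ⊤
  nrm_F : ∀ t < T, ∫⁻ τ in Ioc 0 t, nrm w (F τ) < ⊤
  nrm_G : ∀ t < T, ∫⁻ τ in Ioc 0 t, nrm w (G τ) < ⊤
  solves : Solves α β A B F G (Ioo 0 T)

section

variable {w : E3 → ℝ} {C α β : ℝ}

/-- The forcing is absorbed by the dissipation, up to a superlinear term. -/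
theorem GoodWeight.exists_nrm_force_le (hw : GoodWeight w C) (hα : 1 / 2 < α) (hβ : 1 / 2 < β) :
    ∃ K : ℝ, 0 < K ∧ ∀ (U : E3 → C3) (Θ : E3 → ℂ), StronglyMeasurable U → StronglyMeasurable Θ →
      nrm w U < ⊤ → nrm w Θ < ⊤ →
      nrm w (forceU U Θ) + nrm w (forceT U Θ) ≤
        2⁻¹ * (nrm (up w (2 * α)) U + nrm (up w (2 * β)) Θ) +
          ENNReal.ofReal K * ((nrm w U + nrm w Θ) *
            (1 + ((nrm w U + nrm w Θ) ^ (2 * α / (2 * α - 1)) +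
              nrm w U ^ (2 * β / (2 * β - 1))))) := by
  have hk : 0 < kap * C := mul_pos kap_pos hw.const_pos
  -- Five units of kCε fall on the dissipation of the velocity, four from the doubled u·∇u and one
  -- from u·∇θ. This ε makes their sum exactly 1/2.
  obtain ⟨c, hc, h⟩ := exists_interp hα (ε := 1 / (10 * (kap * C))) (by positivity)
  obtain ⟨c', hc', h'⟩ := exists_interp hβ (ε := 1 / (10 * (kap * C))) (by positivity)
  refine ⟨2 + kap * C * (5 * c + c'), add_pos two_pos (mul_pos hk (by positivity)), fun U Θ hU hΘ hU1 hΘ1 => ?_⟩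
  -- Whenever the velocity carries the derivative, α governs the interpolation and the other factor
  -- is u or θ. When θ carries it, β governs and the other factor is u, so that only the norm of u
  -- receives the exponent belonging to β.
  have i1 := h w hw.measurable hw.nonneg U hU.aestronglyMeasurable (nrm w U) hU1.ne
  have i2 := h w hw.measurable hw.nonneg U hU.aestronglyMeasurable (nrm w Θ) hΘ1.ne
  have i3 := h' w hw.measurable hw.nonneg Θ hΘ.aestronglyMeasurable (nrm w U) hU1.ne
  have a1 := hw.nrm_forceU_le hU hΘ
  have a2 := hw.nrm_adv_le hU hU
  have a3 := hw.nrm_adv_le hU hΘ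
  have a4 : nrm w (forceT U Θ) = nrm w (adv U Θ) := nrm_neg _
  rw [a4]
  have hp : 0 ≤ 2 * α / (2 * α - 1) := div_nonneg (by linarith) (by linarith)
  have hε : ENNReal.ofReal (kap * C) * ENNReal.ofReal (1 / (10 * (kap * C))) =
      ENNReal.ofReal (1 / 10) := by
    rw [← ENNReal.ofReal_mul hk.le, mul_one_div, mul_comm 10, ← div_div, div_self hk.ne']
  generalize nrm w U = x at *
  generalize nrm w Θ = z at *
  generalize nrm (up w 1) U = x₁ at *
  generalize nrm (up w 1) Θ = z₁ at *
  generalize nrm (up w (2 * α)) U = x₂ at *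
  generalize nrm (up w (2 * β)) Θ = z₂ at *
  generalize 2 * α / (2 * α - 1) = p at *
  generalize 2 * β / (2 * β - 1) = q at *
  set k := ENNReal.ofReal (kap * C)
  set ε := ENNReal.ofReal (1 / (10 * (kap * C)))
  have hx : x ^ p ≤ (x + z) ^ p := ENNReal.rpow_le_rpow le_self_add hp
  have hz : z ^ p ≤ (x + z) ^ p := ENNReal.rpow_le_rpow le_add_self hp
  have e5 : 5 * (k * ε) = 2⁻¹ := by
    rw [hε, show (5 : ℝ≥0∞) = ENNReal.ofReal 5 by simp, ← ENNReal.ofReal_mul (by norm_num),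
      show (2⁻¹ : ℝ≥0∞) = ENNReal.ofReal (2⁻¹) by simp]
    norm_num
  have e1 : k * ε ≤ 2⁻¹ := by
    rw [← e5]; exact le_mul_of_one_le_left zero_le (by norm_num)
  have eK : ENNReal.ofReal (2 + kap * C * (5 * c + c')) =
      2 + k * (5 * ENNReal.ofReal c + ENNReal.ofReal c') := by
    rw [ENNReal.ofReal_add (by norm_num) (mul_nonneg hk.le (by positivity)),
      ENNReal.ofReal_mul hk.le,
      ENNReal.ofReal_add (by positivity) hc'.le, ENNReal.ofReal_mul (p := 5) (by norm_num)]
    simp only [ENNReal.ofReal_ofNat, k]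
  rw [eK]
  generalize ENNReal.ofReal c = d at *
  generalize ENNReal.ofReal c' = d' at *
  set y := x + z
  set P := y ^ p
  set Q := x ^ q
  have hxy : x ≤ y := le_self_add
  have hzy : z ≤ y := le_add_self
  calc _ ≤ 2 * z + 2 * (k * (x₁ * x + x * x₁)) + k * (x₁ * z + x * z₁) := by
        gcongr
        exact a1.trans (by gcongr)
    _ = 2 * z + k * (4 * (x * x₁) + z * x₁ + x * z₁) := by ring
    _ ≤ 2 * z + k * (4 * (ε * x₂ + d * x ^ p * x) + (ε * x₂ + d * z ^ p * x) +
          (ε * z₂ + d' * Q * z)) := by gcongr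
    _ ≤ 2 * y + k * (4 * (ε * x₂ + d * P * y) + (ε * x₂ + d * P * y) +
          (ε * z₂ + d' * Q * y)) := by gcongr
    _ = 5 * (k * ε) * x₂ + k * ε * z₂ + (2 * (y * 1) + k * (5 * d) * (y * P) +
          k * d' * (y * Q)) := by ring
    _ ≤ 2⁻¹ * x₂ + 2⁻¹ * z₂ + (2 * (y * (1 + (P + Q))) + k * (5 * d) * (y * (1 + (P + Q))) +
          k * d' * (y * (1 + (P + Q)))) := by
        rw [e5]
        gcongr
        · exact le_self_add
        · exact le_self_add.trans le_add_self
        · exact le_add_self.trans le_add_self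
    _ = _ := by ring

end

section

variable {w : E3 → ℝ} {C α β T : ℝ} {A : E3 → C3} {B : E3 → ℂ} {F : ℝ → E3 → C3} {G : ℝ → E3 → ℂ}

theorem IsFourierSolution.stronglyMeasurable_U (h : IsFourierSolution w α β A B F G T) :
    StronglyMeasurable (Function.uncurry (Duh α A F)) := stronglyMeasurable_Duh h.meas_A h.meas_F

theorem IsFourierSolution.stronglyMeasurable_Θ (h : IsFourierSolution w α β A B F G T) :
    StronglyMeasurable (Function.uncurry (Duh β B G)) := stronglyMeasurable_Duh h.meas_B h.meas_G

theorem IsFourierSolution.nrm_U (hw : GoodWeight w C) (h : IsFourierSolution w α β A B F G T) {t : ℝ}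
    (ht : t ∈ Ico 0 T) : nrm w (Duh α A F t) < ⊤ :=
  (hw.nrm_Duh_le h.meas_A h.meas_F ht.1 (h.nrm_F t ht.2)).trans_lt
    (ENNReal.add_lt_top.2 ⟨h.nrm_A, h.nrm_F t ht.2⟩)

theorem IsFourierSolution.nrm_Θ (hw : GoodWeight w C) (h : IsFourierSolution w α β A B F G T) {t : ℝ}
    (ht : t ∈ Ico 0 T) : nrm w (Duh β B G t) < ⊤ :=
  (hw.nrm_Duh_le h.meas_B h.meas_G ht.1 (h.nrm_G t ht.2)).trans_lt
    (ENNReal.add_lt_top.2 ⟨h.nrm_B, h.nrm_G t ht.2⟩)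

/-- The norm of the solution. -/
def energy (w : E3 → ℝ) (α β : ℝ) (A : E3 → C3) (B : E3 → ℂ) (F : ℝ → E3 → C3) (G : ℝ → E3 → ℂ)
    (t : ℝ) : ℝ≥0∞ := nrm w (Duh α A F t) + nrm w (Duh β B G t)

/-- The quantity whose time integral controls the solution. -/
def rate (w : E3 → ℝ) (α β : ℝ) (A : E3 → C3) (B : E3 → ℂ) (F : ℝ → E3 → C3) (G : ℝ → E3 → ℂ)
    (t : ℝ) : ℝ≥0∞ := energy w α β A B F G t ^ (2 * α / (2 * α - 1)) +
      nrm w (Duh α A F t) ^ (2 * β / (2 * β - 1))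

/-- The forcing is at most half of the dissipation D plus a superlinear term, whereas the smoothing
estimate provides all of D. Half of D is used for absorption; the other half bounds the forcing
itself, which is the second conclusion, needed for continuation. -/
theorem GoodWeight.exists_energy_le (hw : GoodWeight w C) (hα : 1 / 2 < α) (hβ : 1 / 2 < β) :
    ∃ K : ℝ, 0 < K ∧ ∀ {A : E3 → C3} {B : E3 → ℂ} {F : ℝ → E3 → C3} {G : ℝ → E3 → ℂ} {T : ℝ},
      IsFourierSolution w α β A B F G T → ∀ t₀ t, 0 ≤ t₀ → t₀ ≤ t → t < T →
      energy w α β A B F G t ≤ energy w α β A B F G t₀ + ENNReal.ofReal K *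
        ∫⁻ τ in Ioc t₀ t, energy w α β A B F G τ * (1 + rate w α β A B F G τ) ∧
      ∫⁻ τ in Ioc t₀ t, (nrm w (F τ) + nrm w (G τ)) ≤ energy w α β A B F G t₀ + 2 *
        (ENNReal.ofReal K *
          ∫⁻ τ in Ioc t₀ t, energy w α β A B F G τ * (1 + rate w α β A B F G τ)) := by
  obtain ⟨K, hK, hle⟩ := hw.exists_nrm_force_le hα hβ
  refine ⟨K, hK, fun {A B F G T} h t₀ t h0 h01 htT => ?_⟩
  have hU := h.stronglyMeasurable_U
  have hΘ := h.stronglyMeasurable_Θ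
  have mU2 : Measurable fun τ => nrm (up w (2 * α)) (Duh α A F τ) :=
    measurable_nrm (up_measurable hw.measurable _) hU
  have mΘ2 : Measurable fun τ => nrm (up w (2 * β)) (Duh β B G τ) :=
    measurable_nrm (up_measurable hw.measurable _) hΘ
  have mF : Measurable fun τ => nrm w (F τ) := measurable_nrm hw.measurable h.meas_F
  have mG : Measurable fun τ => nrm w (G τ) := measurable_nrm hw.measurable h.meas_G
  have e1 := hw.nrm_Duh_add_le (γ := α) h.meas_A h.meas_F h0 h01 (h.nrm_F t htT)
  have e2 := hw.nrm_Duh_add_le (γ := β) h.meas_B h.meas_G h0 h01 (h.nrm_G t htT)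
  have b : ∫⁻ τ in Ioc t₀ t, (nrm w (F τ) + nrm w (G τ)) ≤
      2⁻¹ * (∫⁻ τ in Ioc t₀ t, nrm (up w (2 * α)) (Duh α A F τ) +
        nrm (up w (2 * β)) (Duh β B G τ)) + ENNReal.ofReal K *
        ∫⁻ τ in Ioc t₀ t, energy w α β A B F G τ * (1 + rate w α β A B F G τ) := by
    rw [← lintegral_const_mul' _ _ (by simp), ← lintegral_const_mul' _ _ ENNReal.ofReal_ne_top,
      ← lintegral_add_left (by fun_prop)]
    have hsub : Ioc t₀ t ⊆ Ioo 0 T := fun τ hτ => ⟨h0.trans_lt hτ.1, hτ.2.trans_lt htT⟩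
    refine lintegral_mono_ae ?_
    filter_upwards [ae_restrict_of_ae_restrict_of_subset hsub h.solves.1,
      ae_restrict_of_ae_restrict_of_subset hsub h.solves.2, ae_restrict_mem measurableSet_Ioc]
      with τ h1 h2 h3
    rw [nrm_congr h1, nrm_congr h2]
    have hτ : τ ∈ Ico 0 T := Ioo_subset_Ico_self (hsub h3)
    exact hle _ _ (stronglyMeasurable_section hU τ) (stronglyMeasurable_section hΘ τ)
      (h.nrm_U hw hτ) (h.nrm_Θ hw hτ)
  rw [lintegral_add_left mU2] at b
  have hfF : ∫⁻ τ in Ioc t₀ t, nrm w (F τ) < ⊤ :=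
    (lintegral_mono_set (Ioc_subset_Ioc_left h0)).trans_lt (h.nrm_F t htT)
  have hfG : ∫⁻ τ in Ioc t₀ t, nrm w (G τ) < ⊤ :=
    (lintegral_mono_set (Ioc_subset_Ioc_left h0)).trans_lt (h.nrm_G t htT)
  have hU0 := h.nrm_U hw (t := t₀) ⟨h0, h01.trans_lt htT⟩
  have hΘ0 := h.nrm_Θ hw (t := t₀) ⟨h0, h01.trans_lt htT⟩
  rw [lintegral_add_left mF] at b ⊢
  have hD1 : ∫⁻ τ in Ioc t₀ t, nrm (up w (2 * α)) (Duh α A F τ) < ⊤ :=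
    (le_add_self.trans e1).trans_lt (ENNReal.add_lt_top.2 ⟨hU0, hfF⟩)
  have hD2 : ∫⁻ τ in Ioc t₀ t, nrm (up w (2 * β)) (Duh β B G τ) < ⊤ :=
    (le_add_self.trans e2).trans_lt (ENNReal.add_lt_top.2 ⟨hΘ0, hfG⟩)
  generalize hI : ENNReal.ofReal K *
    ∫⁻ τ in Ioc t₀ t, energy w α β A B F G τ * (1 + rate w α β A B F G τ) = I at *
  unfold energy at *
  clear hI
  generalize ∫⁻ τ in Ioc t₀ t, nrm (up w (2 * α)) (Duh α A F τ) = D₁ at *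
  generalize ∫⁻ τ in Ioc t₀ t, nrm (up w (2 * β)) (Duh β B G τ) = D₂ at *
  generalize ∫⁻ τ in Ioc t₀ t, nrm w (F τ) = f at *
  generalize ∫⁻ τ in Ioc t₀ t, nrm w (G τ) = g at *
  generalize nrm w (Duh α A F t) = u₁ at *
  generalize nrm w (Duh β B G t) = θ₁ at *
  generalize nrm w (Duh α A F t₀) = u₀ at *
  generalize nrm w (Duh β B G t₀) = θ₀ at *
  set D := D₁ + D₂
  have hD : 2⁻¹ * D < ⊤ := ENNReal.mul_lt_top (by simp) (ENNReal.add_lt_top.2 ⟨hD1, hD2⟩)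
  have hDD : D = 2⁻¹ * D + 2⁻¹ * D := by
    rw [← add_mul, ENNReal.inv_two_add_inv_two, one_mul]
  -- D/2 is added on both sides so that it can be cancelled in `ℝ≥0∞`; it is finite by the smoothing
  -- estimate.
  have key : (u₁ + θ₁ + 2⁻¹ * D) + 2⁻¹ * D ≤ (u₀ + θ₀ + I) + 2⁻¹ * D := by
    calc (u₁ + θ₁ + 2⁻¹ * D) + 2⁻¹ * D = u₁ + θ₁ + (2⁻¹ * D + 2⁻¹ * D) := by ring
      _ = (u₁ + D₁) + (θ₁ + D₂) := by rw [← hDD]; ring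
      _ ≤ (u₀ + f) + (θ₀ + g) := add_le_add e1 e2
      _ = u₀ + θ₀ + (f + g) := by ring
      _ ≤ u₀ + θ₀ + (2⁻¹ * D + I) := by gcongr
      _ = _ := by ring
  have key' := (ENNReal.add_le_add_iff_right hD.ne).1 key
  refine ⟨le_self_add.trans key', b.trans ?_⟩
  calc 2⁻¹ * D + I ≤ (u₀ + θ₀ + I) + I := by
        gcongr
        exact le_add_self.trans key'
    _ = _ := by ring

end

/-! ### Continuation criterion and blow-up rate -/

theorem continuousOn_toReal_nrm {w : E3 → ℝ} {C : ℝ} (hw : GoodWeight w C) {E : Type}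
    [NormedAddCommGroup E] {S : Set ℝ} {f : ℝ → E3 → E}
    (hf : ∀ t ∈ S, AEStronglyMeasurable (f t)) (hf0 : ∀ t ∈ S, nrm w (f t) < ⊤)
    (hc : ∀ t ∈ S, Tendsto (fun r => nrm w (fun ξ => f r ξ - f t ξ)) (𝓝[S] t) (𝓝 0)) :
    ContinuousOn (fun t => (nrm w (f t)).toReal) S := by
  intro t ht
  have hcont := hc t ht
  have hreal := (ENNReal.tendsto_toReal ENNReal.zero_ne_top).comp hcont
  rw [ENNReal.toReal_zero] at hreal
  rw [ContinuousWithinAt, tendsto_iff_dist_tendsto_zero]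
  refine squeeze_zero' (Eventually.of_forall fun _ => dist_nonneg) ?_ hreal
  filter_upwards [hcont.eventually (gt_mem_nhds ENNReal.zero_lt_top), self_mem_nhdsWithin]
    with r hr hrT
  have a1 : nrm w (f r) ≤ nrm w (fun ξ => f r ξ - f t ξ) + nrm w (f t) := by
    have := nrm_add_le (w := w) hw.measurable (f := fun ξ => f r ξ - f t ξ) (g := f t)
      ((hf r hrT).sub (hf t ht))
    simpa using this
  have a2 : nrm w (f t) ≤ nrm w (f r) + nrm w (fun ξ => f r ξ - f t ξ) := by
    have := nrm_sub_le (w := w) hw.measurable (f := f r) (g := fun ξ => f r ξ - f t ξ) (hf r hrT)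
    simpa using this
  have f1 := (hf0 r hrT).ne
  have f2 := (hf0 t ht).ne
  rw [Function.comp_apply, Real.dist_eq, abs_le]
  have b1 := ENNReal.toReal_mono (ENNReal.add_ne_top.2 ⟨hr.ne, f2⟩) a1
  have b2 := ENNReal.toReal_mono (ENNReal.add_ne_top.2 ⟨f1, hr.ne⟩) a2
  rw [ENNReal.toReal_add hr.ne f2] at b1
  rw [ENNReal.toReal_add f1 hr.ne] at b2
  constructor <;> linarith

theorem GoodWeight.continuousOn_nrm_Duh {w : E3 → ℝ} {C : ℝ} (hw : GoodWeight w C) {E : Type}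
    [NormedAddCommGroup E] [NormedSpace ℝ E] {γ : ℝ} {A : E3 → E} {F : ℝ → E3 → E}
    (hA : StronglyMeasurable A) (hF : StronglyMeasurable (Function.uncurry F)) {T : ℝ}
    (hA0 : nrm w A < ⊤) (h : ∫⁻ τ in Ioc 0 T, nrm w (F τ) < ⊤) :
    ContinuousOn (fun t => (nrm w (Duh γ A F t)).toReal) (Icc 0 T) := by
  have hD := stronglyMeasurable_Duh (γ := γ) hA hF
  refine continuousOn_toReal_nrm hw (fun t _ => (stronglyMeasurable_section hD t).aestronglyMeasurable)
    (fun t ht => ?_) fun t ht => hw.tendsto_nrm_Duh hA hF hA0 h ht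
  have h1 : ∫⁻ τ in Ioc 0 t, nrm w (F τ) < ⊤ :=
    (lintegral_mono_set (Ioc_subset_Ioc_right ht.2)).trans_lt h
  exact (hw.nrm_Duh_le hA hF ht.1 h1).trans_lt (ENNReal.add_lt_top.2 ⟨hA0, h1⟩)

section

variable {w : E3 → ℝ} {C α β T : ℝ} {A : E3 → C3} {B : E3 → ℂ} {F : ℝ → E3 → C3} {G : ℝ → E3 → ℂ}

theorem IsFourierSolution.exists_curves (hw : GoodWeight w C)
    (h : IsFourierSolution w α β A B F G T) {t₀ t₁ : ℝ} (h0 : 0 ≤ t₀) (h01 : t₀ ≤ t₁)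
    (h1 : t₁ < T) :
    ∃ x y : ℝ → ℝ, Continuous x ∧ Continuous y ∧ (∀ t, 0 ≤ x t) ∧ (∀ t, x t ≤ y t) ∧
      ∀ t ∈ Icc t₀ t₁, nrm w (Duh α A F t) = ENNReal.ofReal (x t) ∧
        energy w α β A B F G t = ENNReal.ofReal (y t) := by
  have hx := hw.continuousOn_nrm_Duh (γ := α) h.meas_A h.meas_F h.nrm_A (h.nrm_F t₁ h1)
  have hz := hw.continuousOn_nrm_Duh (γ := β) h.meas_B h.meas_G h.nrm_B (h.nrm_G t₁ h1)
  -- Clamping time to [t₀, t₁] extends the norms to continuous functions on the line, as the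
  -- differential inequalities require.
  set π : ℝ → ℝ := fun t => max t₀ (min t₁ t)
  have hπ : Continuous π := by fun_prop
  have hπ1 : ∀ t, π t ∈ Icc 0 t₁ := fun t =>
    ⟨h0.trans (le_max_left _ _), max_le h01 (min_le_left _ _)⟩
  refine ⟨fun t => (nrm w (Duh α A F (π t))).toReal,
    fun t => (nrm w (Duh α A F (π t))).toReal + (nrm w (Duh β B G (π t))).toReal,
    hx.comp_continuous hπ hπ1, (hx.comp_continuous hπ hπ1).add (hz.comp_continuous hπ hπ1),
    fun _ => ENNReal.toReal_nonneg, fun _ => le_add_of_nonneg_right ENNReal.toReal_nonneg, ?_⟩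
  intro t ht
  have e : π t = t := by simp [π, ht.1, ht.2]
  have ht' : t ∈ Ico 0 T := ⟨h0.trans ht.1, ht.2.trans_lt h1⟩
  have f1 := (h.nrm_U hw ht').ne
  have f2 := (h.nrm_Θ hw ht').ne
  simp only [e]
  rw [ENNReal.ofReal_add ENNReal.toReal_nonneg ENNReal.toReal_nonneg, ENNReal.ofReal_toReal f1,
    ENNReal.ofReal_toReal f2]
  exact ⟨rfl, rfl⟩

theorem lintegral_ofReal_Ioc {f : ℝ → ℝ} (hf : Continuous f) (hf0 : ∀ t, 0 ≤ f t) {t₀ t : ℝ}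
    (h : t₀ ≤ t) :
    ∫⁻ τ in Ioc t₀ t, ENNReal.ofReal (f τ) = ENNReal.ofReal (∫ τ in t₀..t, f τ) := by
  rw [intervalIntegral.integral_of_le h, ofReal_integral_eq_lintegral_ofReal
    ((hf.intervalIntegrable _ _).1) (ae_of_all _ hf0)]

theorem one_lt_exponent {γ : ℝ} (hγ : 1 / 2 < γ) : 1 < 2 * γ / (2 * γ - 1) := by
  rw [one_lt_div (by linarith)]; linarith

/-- If the quantity in the continuation criterion is integrable, then so are the forcings. -/
theorem GoodWeight.lintegral_force_lt_top (hw : GoodWeight w C) (hα : 1 / 2 < α) (hβ : 1 / 2 < β)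
    (h : IsFourierSolution w α β A B F G T) {t₀ : ℝ} (ht₀ : t₀ ∈ Ico 0 T)
    (hr : ∫⁻ τ in Ico t₀ T, rate w α β A B F G τ < ⊤) :
    ∫⁻ τ in Ioc 0 T, nrm w (F τ) < ⊤ ∧ ∫⁻ τ in Ioc 0 T, nrm w (G τ) < ⊤ := by
  obtain ⟨K, hK, hle⟩ := hw.exists_energy_le hα hβ
  have hp := one_lt_exponent hα
  have hq := one_lt_exponent hβ
  set p := 2 * α / (2 * α - 1)
  set q := 2 * β / (2 * β - 1)
  -- A bound for the integral of 1 + rate over every [t₀, t] with t < T; Grönwall's factor is then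
  -- exp(KH), uniformly in t.
  set H : ℝ := (T - t₀) + (∫⁻ τ in Ico t₀ T, rate w α β A B F G τ).toReal
  set e₀ := energy w α β A B F G t₀
  have he₀ : e₀ < ⊤ := ENNReal.add_lt_top.2 ⟨h.nrm_U hw ht₀, h.nrm_Θ hw ht₀⟩
  set M : ℝ≥0∞ := e₀ * ENNReal.ofReal (Real.exp (K * H))
  have hM : M < ⊤ := ENNReal.mul_lt_top he₀ ENNReal.ofReal_lt_top
  have hH : ∀ t ∈ Ico t₀ T, ∫⁻ τ in Ioc t₀ t, (1 + rate w α β A B F G τ) ≤ ENNReal.ofReal H := by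
    intro t ht
    rw [lintegral_add_left measurable_const, setLIntegral_const, Real.volume_Ioc, one_mul,
      ENNReal.ofReal_add (sub_nonneg.2 ht₀.2.le) ENNReal.toReal_nonneg, ENNReal.ofReal_toReal hr.ne]
    gcongr
    · exact ht.2.le
    · exact fun τ hτ => ⟨hτ.1.le, hτ.2.trans_lt ht.2⟩
  have hbound : ∀ t ∈ Ico t₀ T, energy w α β A B F G t ≤ M := by
    intro t ht
    obtain ⟨x, y, hx, hy, hx0, hxy, hxe⟩ := h.exists_curves hw ht₀.1 ht.1 ht.2
    have hy0 : ∀ t, 0 ≤ y t := fun t => (hx0 t).trans (hxy t)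
    have hyp : Continuous fun τ => y τ ^ p := hy.rpow_const fun _ => Or.inr (by linarith)
    have hxq : Continuous fun τ => x τ ^ q := hx.rpow_const fun _ => Or.inr (by linarith)
    have hg : Continuous fun τ => 1 + (y τ ^ p + x τ ^ q) := by fun_prop
    have hg0 : ∀ τ, 0 ≤ 1 + (y τ ^ p + x τ ^ q) := fun τ => by
      have := Real.rpow_nonneg (hy0 τ) p
      have := Real.rpow_nonneg (hx0 τ) q
      linarith
    have hrate : ∀ τ ∈ Icc t₀ t, 1 + rate w α β A B F G τ =
        ENNReal.ofReal (1 + (y τ ^ p + x τ ^ q)) := fun τ hτ => by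
      rw [rate, (hxe τ hτ).1, (hxe τ hτ).2, ENNReal.ofReal_rpow_of_nonneg (hy0 τ) (by linarith),
        ENNReal.ofReal_rpow_of_nonneg (hx0 τ) (by linarith),
        ← ENNReal.ofReal_add (Real.rpow_nonneg (hy0 τ) _) (Real.rpow_nonneg (hx0 τ) _),
        ← ENNReal.ofReal_one, ← ENNReal.ofReal_add zero_le_one]
      exact add_nonneg (Real.rpow_nonneg (hy0 τ) _) (Real.rpow_nonneg (hx0 τ) _)
    have hgr := linear_gronwall (K := K) hy hg hg0 hK.le ht.1 fun r hr' => by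
      have a := (hle h t₀ r ht₀.1 hr'.1 (hr'.2.trans_lt ht.2)).1
      have e : ∫⁻ τ in Ioc t₀ r, energy w α β A B F G τ * (1 + rate w α β A B F G τ) =
          ENNReal.ofReal (∫ τ in t₀..r, y τ * (1 + (y τ ^ p + x τ ^ q))) := by
        have e' := lintegral_ofReal_Ioc (hy.mul hg) (fun τ => mul_nonneg (hy0 τ) (hg0 τ)) hr'.1
        simp only [Pi.mul_apply] at e'
        rw [← e']
        refine setLIntegral_congr_fun measurableSet_Ioc fun τ hτ => ?_
        have hτ' : τ ∈ Icc t₀ t := ⟨hτ.1.le, hτ.2.trans hr'.2⟩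
        rw [hrate τ hτ', (hxe τ hτ').2, ENNReal.ofReal_mul (hy0 τ)]
      have hI : 0 ≤ ∫ τ in t₀..r, y τ * (1 + (y τ ^ p + x τ ^ q)) :=
        intervalIntegral.integral_nonneg hr'.1 fun τ _ => mul_nonneg (hy0 τ) (hg0 τ)
      rw [e, (hxe r hr').2, (hxe t₀ ⟨le_rfl, ht.1⟩).2, ← ENNReal.ofReal_mul hK.le,
        ← ENNReal.ofReal_add (hy0 _) (by positivity),
        ENNReal.ofReal_le_ofReal_iff (add_nonneg (hy0 _) (by positivity))] at a
      exact a
    have hHr : ∫ τ in t₀..t, (1 + (y τ ^ p + x τ ^ q)) ≤ H := by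
      have a := hH t ht
      rw [setLIntegral_congr_fun measurableSet_Ioc
        (fun τ hτ => hrate τ (Ioc_subset_Icc_self hτ)), lintegral_ofReal_Ioc hg hg0 ht.1] at a
      have : 0 ≤ H := add_nonneg (sub_nonneg.2 ht₀.2.le) ENNReal.toReal_nonneg
      exact (ENNReal.ofReal_le_ofReal_iff this).1 a
    rw [(hxe t ⟨ht.1, le_rfl⟩).2]
    have hM' : M = ENNReal.ofReal (y t₀ * Real.exp (K * H)) := by
      simp only [M, e₀]
      rw [(hxe t₀ ⟨le_rfl, ht.1⟩).2, ENNReal.ofReal_mul (hy0 _)]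
    rw [hM']
    refine ENNReal.ofReal_le_ofReal (hgr.trans ?_)
    have := hy0 t₀
    gcongr
  have hforce : ∀ t ∈ Ico t₀ T, ∫⁻ τ in Ioc t₀ t, (nrm w (F τ) + nrm w (G τ)) ≤
      e₀ + 2 * (ENNReal.ofReal K * (M * ENNReal.ofReal H)) := by
    intro t ht
    refine ((hle h t₀ t ht₀.1 ht.1 ht.2).2).trans ?_
    gcongr
    refine le_trans ?_ (mul_le_mul_right (hH t ht) M)
    rw [← lintegral_const_mul' _ _ hM.ne]
    refine setLIntegral_mono' measurableSet_Ioc fun τ hτ => ?_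
    gcongr
    exact hbound τ ⟨hτ.1.le, hτ.2.trans_lt ht.2⟩
  have mF : Measurable fun τ => nrm w (F τ) := measurable_nrm hw.measurable h.meas_F
  have mG : Measurable fun τ => nrm w (G τ) := measurable_nrm hw.measurable h.meas_G
  have htot : ∫⁻ τ in Ioc t₀ T, (nrm w (F τ) + nrm w (G τ)) < ⊤ := by
    -- The bound on [t₀, t] does not depend on t, so it passes to the limit t ↑ T.
    have hc : AECover (volume.restrict (Ioo t₀ T)) (𝓝[<] T) fun t => Ioc t₀ t := by
      refine ⟨?_, fun _ => measurableSet_Ioc⟩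
      filter_upwards [ae_restrict_mem measurableSet_Ioo] with τ hτ
      filter_upwards [Ioo_mem_nhdsLT hτ.2] with t ht using ⟨hτ.1, ht.1.le⟩
    have ht : Tendsto (fun t => ∫⁻ τ in Ioc t₀ t, (nrm w (F τ) + nrm w (G τ))
        ∂(volume.restrict (Ioo t₀ T))) (𝓝[<] T)
        (𝓝 (∫⁻ τ in Ioo t₀ T, (nrm w (F τ) + nrm w (G τ)))) :=
      hc.lintegral_tendsto_of_countably_generated (by fun_prop)
    have hfin : e₀ + 2 * (ENNReal.ofReal K * (M * ENNReal.ofReal H)) < ⊤ :=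
      ENNReal.add_lt_top.2 ⟨he₀, ENNReal.mul_lt_top (by simp)
        (ENNReal.mul_lt_top ENNReal.ofReal_lt_top (ENNReal.mul_lt_top hM ENNReal.ofReal_lt_top))⟩
    rw [setLIntegral_congr Ioo_ae_eq_Ioc.symm]
    refine lt_of_le_of_lt (le_of_tendsto ht ?_) hfin
    filter_upwards [Ioo_mem_nhdsLT ht₀.2] with t ht
    refine le_trans ?_ (hforce t ⟨ht.1.le, ht.2⟩)
    rw [Measure.restrict_restrict measurableSet_Ioc]
    exact lintegral_mono_set inter_subset_left
  have hsplit : Ioc 0 T = Ioc 0 t₀ ∪ Ioc t₀ T := (Ioc_union_Ioc_eq_Ioc ht₀.1 ht₀.2.le).symm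
  have hF1 : ∫⁻ τ in Ioc t₀ T, nrm w (F τ) < ⊤ :=
    (lintegral_mono fun τ => le_self_add).trans_lt htot
  have hG1 : ∫⁻ τ in Ioc t₀ T, nrm w (G τ) < ⊤ :=
    (lintegral_mono fun τ => le_add_self).trans_lt htot
  rw [hsplit]
  exact ⟨(lintegral_union_le _ _ _).trans_lt (ENNReal.add_lt_top.2 ⟨h.nrm_F _ ht₀.2, hF1⟩),
    (lintegral_union_le _ _ _).trans_lt (ENNReal.add_lt_top.2 ⟨h.nrm_G _ ht₀.2, hG1⟩)⟩

/-- The lower bound for the blow-up rate. -/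
theorem GoodWeight.exists_blowup_rate (hw : GoodWeight w C) (hα : 1 / 2 < α) (hβ : 1 / 2 < β) :
    ∃ c : ℝ, 0 < c ∧ ∀ {A : E3 → C3} {B : E3 → ℂ} {F : ℝ → E3 → C3} {G : ℝ → E3 → ℂ} {T : ℝ},
      IsFourierSolution w α β A B F G T →
      (∀ M : ℝ≥0∞, M < ⊤ → ∃ᶠ t in 𝓝[<] T, M < energy w α β A B F G t) →
      ∀ t ∈ Ico 0 T, ENNReal.ofReal ((Real.exp (c * (T - t)) - 1)⁻¹) ≤
        energy w α β A B F G t ^ (2 * α / (2 * α - 1)) +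
          energy w α β A B F G t ^ (2 * β / (2 * β - 1)) := by
  obtain ⟨K, hK, hle⟩ := hw.exists_energy_le hα hβ
  have hp := one_lt_exponent hα
  have hq := one_lt_exponent hβ
  simp only [rate] at hle
  generalize 2 * α / (2 * α - 1) = p at *
  generalize 2 * β / (2 * β - 1) = q at *
  refine ⟨(p + q) * K, by positivity, fun {A B F G T} h hfreq t₀ ht₀ => ?_⟩
  have he₀ : energy w α β A B F G t₀ < ⊤ := ENNReal.add_lt_top.2 ⟨h.nrm_U hw ht₀, h.nrm_Θ hw ht₀⟩
  set e := (energy w α β A B F G t₀).toReal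
  have he : 0 ≤ e := ENNReal.toReal_nonneg
  have hpos : 0 < Real.exp ((p + q) * K * (T - t₀)) - 1 := by
    have : 0 < (p + q) * K * (T - t₀) := mul_pos (by positivity) (sub_pos.2 ht₀.2)
    linarith [Real.add_one_lt_exp this.ne']
  have hz : 0 ≤ e ^ p + e ^ q := by positivity
  -- Since the energy exceeds N at some time after t₀, `blowup_rate` compares that time with t₀, and
  -- N/(1+N) bounds the later value from below.
  have hmain : ∀ N : ℝ, 1 ≤ N → N / (1 + N) ≤ Real.exp ((p + q) * K * (T - t₀)) *
      ((e ^ p + e ^ q) / (1 + (e ^ p + e ^ q))) := by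
    intro N hN
    obtain ⟨t₁, hN1, ht₁⟩ := ((hfreq (ENNReal.ofReal N) ENNReal.ofReal_lt_top).and_eventually
      (Ioo_mem_nhdsLT ht₀.2)).exists
    obtain ⟨x, y, hx, hy, hx0, hxy, hxe⟩ := h.exists_curves hw ht₀.1 ht₁.1.le ht₁.2
    have hy0 : ∀ t, 0 ≤ y t := fun t => (hx0 t).trans (hxy t)
    have hyp : Continuous fun τ => y τ ^ p := hy.rpow_const fun _ => Or.inr (by linarith)
    have hxq : Continuous fun τ => x τ ^ q := hx.rpow_const fun _ => Or.inr (by linarith)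
    have hg : Continuous fun τ => 1 + y τ ^ p + x τ ^ q := by fun_prop
    have hg0 : ∀ τ, 0 ≤ 1 + y τ ^ p + x τ ^ q := fun τ => by
      have := Real.rpow_nonneg (hy0 τ) p
      have := Real.rpow_nonneg (hx0 τ) q
      linarith
    have hb := blowup_rate (K := K) hy hx hx0 hxy hp hq hK.le ht₁.1.le fun r hr' => by
      have a := (hle h t₀ r ht₀.1 hr'.1 (hr'.2.trans_lt ht₁.2)).1
      have e : ∫⁻ τ in Ioc t₀ r, energy w α β A B F G τ *
          (1 + (energy w α β A B F G τ ^ p + nrm w (Duh α A F τ) ^ q)) =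
          ENNReal.ofReal (∫ τ in t₀..r, y τ * (1 + y τ ^ p + x τ ^ q)) := by
        have e' := lintegral_ofReal_Ioc (hy.mul hg) (fun τ => mul_nonneg (hy0 τ) (hg0 τ)) hr'.1
        simp only [Pi.mul_apply] at e'
        rw [← e']
        refine setLIntegral_congr_fun measurableSet_Ioc fun τ hτ => ?_
        have hτ' : τ ∈ Icc t₀ t₁ := ⟨hτ.1.le, hτ.2.trans hr'.2⟩
        rw [(hxe τ hτ').1, (hxe τ hτ').2, ENNReal.ofReal_mul (hy0 τ), add_assoc,
          ENNReal.ofReal_rpow_of_nonneg (hy0 τ) (by linarith),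
          ENNReal.ofReal_rpow_of_nonneg (hx0 τ) (by linarith),
          ← ENNReal.ofReal_add (Real.rpow_nonneg (hy0 τ) _) (Real.rpow_nonneg (hx0 τ) _),
          ← ENNReal.ofReal_one, ← ENNReal.ofReal_add zero_le_one]
        exact add_nonneg (Real.rpow_nonneg (hy0 τ) _) (Real.rpow_nonneg (hx0 τ) _)
      have hI : 0 ≤ ∫ τ in t₀..r, y τ * (1 + y τ ^ p + x τ ^ q) :=
        intervalIntegral.integral_nonneg hr'.1 fun τ _ => mul_nonneg (hy0 τ) (hg0 τ)
      rw [e, (hxe r hr').2, (hxe t₀ ⟨le_rfl, ht₁.1.le⟩).2, ← ENNReal.ofReal_mul hK.le,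
        ← ENNReal.ofReal_add (hy0 _) (by positivity),
        ENNReal.ofReal_le_ofReal_iff (add_nonneg (hy0 _) (by positivity))] at a
      exact a
    have ey : y t₀ = e := by
      simp only [e]
      rw [(hxe t₀ ⟨le_rfl, ht₁.1.le⟩).2, ENNReal.toReal_ofReal (hy0 _)]
    rw [ey] at hb
    have hNy : N ≤ y t₁ := by
      rw [(hxe t₁ ⟨ht₁.1.le, le_rfl⟩).2] at hN1
      exact ((ENNReal.ofReal_lt_ofReal_iff_of_nonneg (by linarith)).1 hN1).le
    have hNp : N ≤ y t₁ ^ p + y t₁ ^ q := by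
      have h1 : N ≤ N ^ p := Real.self_le_rpow_of_one_le hN hp.le
      have h2 : N ^ p ≤ y t₁ ^ p := Real.rpow_le_rpow (by linarith) hNy (by linarith)
      have h3 : 0 ≤ y t₁ ^ q := Real.rpow_nonneg (hy0 _) _
      linarith
    refine (frac_le_frac (by linarith) hNp).trans (hb.trans ?_)
    have : 0 ≤ (p + q) * K := by positivity
    gcongr
    exact ht₁.2.le
  have hlim : Tendsto (fun N : ℝ => N / (1 + N)) atTop (𝓝 1) := by
    have h1 : Tendsto (fun N : ℝ => 1 - (1 + N)⁻¹) atTop (𝓝 (1 - 0)) :=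
      (tendsto_inv_atTop_zero.comp (tendsto_atTop_add_const_left _ 1 tendsto_id)).const_sub 1
    rw [sub_zero] at h1
    refine h1.congr' ?_
    filter_upwards [eventually_gt_atTop 0] with N hN
    field_simp
    ring
  -- As N → ∞ this becomes 1 ≤ exp(c(T - t₀)) z/(1+z) for z = e^p + e^q, which is solved for z.
  have h1 := le_of_tendsto hlim (by filter_upwards [eventually_ge_atTop 1] with N hN using hmain N hN)
  have h2 : (Real.exp ((p + q) * K * (T - t₀)) - 1)⁻¹ ≤ e ^ p + e ^ q := by
    rw [inv_le_iff_one_le_mul₀ hpos]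
    rw [mul_div_assoc', le_div_iff₀ (by linarith)] at h1
    linarith
  have h3 : energy w α β A B F G t₀ ^ p + energy w α β A B F G t₀ ^ q =
      ENNReal.ofReal (e ^ p + e ^ q) := by
    rw [← ENNReal.ofReal_toReal he₀.ne, ENNReal.ofReal_rpow_of_nonneg he (by linarith),
      ENNReal.ofReal_rpow_of_nonneg he (by linarith),
      ← ENNReal.ofReal_add (by positivity) (by positivity)]
  rw [h3]
  exact ENNReal.ofReal_le_ofReal h2

end

/-! ### The Fourier transform of the forcing -/

/-- The vector field `u` has the Fourier transform `U`. -/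
def VHatIs (u : Fin 3 → Dist) (U : E3 → C3) : Prop := ∀ k, HatIs (u k) fun ξ => U ξ k

theorem integrable_apply {X : Type*} [MeasurableSpace X] {μ : Measure X} {V : X → C3}
    (hV : Integrable V μ) (k : Fin 3) : Integrable (fun ξ => V ξ k) μ :=
  (EuclideanSpace.proj (𝕜 := ℂ) k : C3 →L[ℂ] ℂ).integrable_comp hV

theorem integral_apply {X : Type*} [MeasurableSpace X] {μ : Measure X} {V : X → C3}
    (hV : Integrable V μ) (k : Fin 3) : (∫ ξ, V ξ ∂μ) k = ∫ ξ, V ξ k ∂μ :=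
  ((EuclideanSpace.proj (𝕜 := ℂ) k : C3 →L[ℂ] ℂ).integral_comp_comm hV).symm

theorem integrable_heat {γ t : ℝ} (ht : 0 ≤ t) {E : Type} [NormedAddCommGroup E] [NormedSpace ℝ E]
    {g : E3 → E} (hg : Integrable g) :
    Integrable fun ξ => Real.exp (-(t * ‖ξ‖ ^ (2 * γ))) • g ξ := by
  have h1 : Measurable fun ξ : E3 => Real.exp (-(t * ‖ξ‖ ^ (2 * γ))) := by fun_prop
  refine hg.mono (h1.aestronglyMeasurable.smul hg.aestronglyMeasurable) (ae_of_all _ fun ξ => ?_)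
  rw [norm_smul, Real.norm_eq_abs, Real.abs_exp]
  refine mul_le_of_le_one_left (norm_nonneg _) (Real.exp_le_one_iff.2 ?_)
  have : 0 ≤ t * ‖ξ‖ ^ (2 * γ) := by positivity
  linarith

theorem HatIs.heat {f : Dist} {g : E3 → ℂ} (h : HatIs f g) (hg : Integrable g) {γ t : ℝ}
    (ht : 0 ≤ t) : HatIs (heat γ t f) fun ξ => Real.exp (-(t * ‖ξ‖ ^ (2 * γ))) • g ξ := by
  have e : (fun ξ => Real.exp (-(t * ‖ξ‖ ^ (2 * γ))) • g ξ) =ᵐ[volume]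
      fun ξ => (Real.exp (-t * ‖ξ‖ ^ (2 * γ)) : ℂ) * hat f ξ := by
    filter_upwards [h.hat_ae] with ξ hξ
    rw [hξ, neg_mul, Complex.real_smul, Complex.ofReal_exp]
  have hi := integrable_heat (γ := γ) ht hg
  exact (hatIs_ofHat (hi.congr e)).congr e.symm

theorem integrable_lerayAt {V : E3 → C3} (hV : Integrable V) :
    Integrable fun ξ => lerayAt ξ (V ξ) := by
  refine (hV.norm.const_mul 2).mono' ?_ (ae_of_all _ fun ξ => norm_lerayAt_le _ _)
  exact (measurable_lerayAt.comp_aemeasurable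
    (aemeasurable_id.prodMk hV.aemeasurable)).aestronglyMeasurable

theorem VHatIs.leray {v : Fin 3 → Dist} {V : E3 → C3} (h : VHatIs v V) (hV : Integrable V) :
    VHatIs (leray v) fun ξ => lerayAt ξ (V ξ) := by
  intro k
  have e : (fun ξ => lerayAt ξ (V ξ) k) =ᵐ[volume] fun ξ => hat (v k) ξ -
      (ξ k : ℂ) * (∑ j, (ξ j : ℂ) * hat (v j) ξ) / ((‖ξ‖ ^ 2 : ℝ) : ℂ) := by
    have hall : ∀ᵐ ξ, ∀ j, hat (v j) ξ = V ξ j := ae_all_iff.2 fun j => (h j).hat_ae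
    filter_upwards [hall] with ξ hξ
    rw [lerayAt_apply, dotc]
    simp only [hξ]
  exact (hatIs_ofHat ((integrable_apply (integrable_lerayAt hV) k).congr e)).congr e.symm

theorem HatIs.timesE3 {f : Dist} {g : E3 → ℂ} (h : HatIs f g) :
    VHatIs (timesE3 f) fun ξ => EuclideanSpace.single 2 (g ξ) := by
  intro k
  by_cases hk : k = 2
  · simp only [Boussinesq.timesE3, hk, if_true, PiLp.single_apply]
    exact h
  · simp only [Boussinesq.timesE3, hk, if_false, PiLp.single_apply]
    exact hatIs_zero

theorem GoodWeight.integrable_coord_mul {w : E3 → ℝ} {C : ℝ} (hw : GoodWeight w C) {g : E3 → ℂ}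
    (hg : AEStronglyMeasurable g) (h : nrm (up w 1) g < ⊤) (j : Fin 3) :
    Integrable fun ξ : E3 => Complex.I * (ξ j : ℂ) * g ξ := by
  have hm : Measurable fun ξ : E3 => Complex.I * (ξ j : ℂ) := by fun_prop
  refine hw.integrable (hm.aestronglyMeasurable.mul hg) (lt_of_le_of_lt ?_ h)
  refine lintegral_mono fun ξ => ?_
  rw [up, mul_comm (‖ξ‖ ^ (1 : ℝ)), ENNReal.ofReal_mul (hw.nonneg ξ), mul_assoc]
  gcongr
  rw [enorm_mul, Real.rpow_one, ofReal_norm]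
  gcongr
  rw [enorm_mul, ← ofReal_norm, ← ofReal_norm, ← ofReal_norm, ← ENNReal.ofReal_mul (norm_nonneg _)]
  refine ENNReal.ofReal_le_ofReal ?_
  rw [Complex.norm_I, one_mul, Complex.norm_real]
  exact PiLp.norm_apply_le ξ j

/-- The equations contain u·∇f, with the derivative on f, whereas the estimates use the divergence
form. They agree because ξ·Û(ξ-η) = η·Û(ξ-η) for divergence-free u. Integrability of the summands is
only known for almost every ξ. -/
theorem sum_hconv_eq_adv {U : E3 → C3} {g : E3 → ℂ} (hU : Integrable U)
    (hg : ∀ j : Fin 3, Integrable fun ξ : E3 => Complex.I * (ξ j : ℂ) * g ξ)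
    (hdiv : ∀ᵐ ξ, dotc ξ (U ξ) = 0) :
    ∀ᵐ ξ, ∑ j, hconv (fun ξ => U ξ j) (fun η => Complex.I * (η j : ℂ) * g η) ξ = adv U g ξ := by
  have hi : ∀ᵐ ξ, ∀ j : Fin 3, Integrable fun η => U (ξ - η) j * (Complex.I * (η j : ℂ) * g η) := by
    refine ae_all_iff.2 fun j => ?_
    have h := ((hg j).convolution_integrand (.mul ℂ ℂ) (integrable_apply hU j)).prod_right_ae
    filter_upwards [h] with ξ hξ
    refine hξ.congr (ae_of_all _ fun η => ?_)
    simp only [ContinuousLinearMap.mul_apply', mul_comm]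
  filter_upwards [hi] with ξ hξ
  rw [adv_eq_of_div_free hdiv]
  simp only [hconv]
  rw [← Finset.smul_sum, ← integral_finsetSum _ fun j _ => hξ j, Complex.real_smul, smul_eq_mul,
    ← integral_const_mul, ← integral_const_mul]
  have hkap : ((((2 * Real.pi) ^ 3)⁻¹ : ℝ) : ℂ) = (kap : ℂ) := rfl
  rw [hkap]
  refine integral_congr_ae (ae_of_all _ fun η => ?_)
  simp only [dotc, smul_eq_mul, Finset.sum_mul, Finset.mul_sum]
  refine Finset.sum_congr rfl fun j _ => ?_
  ring

theorem adv_apply {U V : E3 → C3} (hU : Integrable U) (hV : Integrable V) (k : Fin 3) :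
    ∀ᵐ ξ, adv U V ξ k = adv U (fun η => V η k) ξ := by
  filter_upwards [ae_integrable_adv hU hV] with ξ hξ
  rw [adv, adv, PiLp.smul_apply, integral_apply hξ]
  rfl

section

variable {w : E3 → ℝ} {C : ℝ} {u : Fin 3 → Dist} {f : Dist} {U : E3 → C3} {g : E3 → ℂ}

theorem GoodWeight.hatIs_transport (hw : GoodWeight w C) (hu : VHatIs u U) (hf : HatIs f g)
    (hU : Integrable U) (hg : AEStronglyMeasurable g) (hg1 : nrm (up w 1) g < ⊤)
    (hdiv : ∀ᵐ ξ, dotc ξ (U ξ) = 0) : HatIs (transport u f) (adv U g) :=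
  (Boussinesq.hatIs_transport hu hf (integrable_apply hU) (hw.integrable_coord_mul hg hg1)).congr
    (sum_hconv_eq_adv hU (hw.integrable_coord_mul hg hg1) hdiv)

theorem nrm_apply_le (V : E3 → C3) (k : Fin 3) : nrm w (fun ξ => V ξ k) ≤ nrm w V := by
  refine nrm_mono (ae_of_all _ fun ξ => ?_)
  rw [← ofReal_norm, ← ofReal_norm]
  exact ENNReal.ofReal_le_ofReal (PiLp.norm_apply_le _ _)

theorem GoodWeight.nrm_adv_lt_top {E : Type} [NormedAddCommGroup E] [NormedSpace ℂ E]
    (hw : GoodWeight w C) {V : E3 → E} (hU : StronglyMeasurable U) (hV : StronglyMeasurable V)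
    (hU0 : nrm w U < ⊤) (hV0 : nrm w V < ⊤) (hU1 : nrm (up w 1) U < ⊤)
    (hV1 : nrm (up w 1) V < ⊤) : nrm w (adv U V) < ⊤ :=
  (hw.nrm_adv_le hU hV).trans_lt (ENNReal.mul_lt_top ENNReal.ofReal_lt_top
    (ENNReal.add_lt_top.2 ⟨ENNReal.mul_lt_top hU1 hV0, ENNReal.mul_lt_top hU0 hV1⟩))

theorem stronglyMeasurable_adv' {E : Type} [NormedAddCommGroup E] [NormedSpace ℂ E] {V : E3 → E}
    (hU : StronglyMeasurable U) (hV : StronglyMeasurable V) : StronglyMeasurable (adv U V) :=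
  stronglyMeasurable_section (stronglyMeasurable_adv (X := Unit) (U := fun _ => U)
    (V := fun _ => V) (hU.comp_measurable measurable_snd) (hV.comp_measurable measurable_snd)) ()

/-- One extra derivative of the velocity must be finite at time τ for the products to be transforms
of integrable functions. This holds at almost every time, which suffices under a time integral. -/
theorem GoodWeight.hatIs_velocityForcing (hw : GoodWeight w C) {α t τ : ℝ} (hτ : τ ≤ t)
    {u : ℝ → Fin 3 → Dist} {θ : ℝ → Dist} {Θ : E3 → ℂ} (hu : VHatIs (u τ) U) (hθ : HatIs (θ τ) Θ)
    (hU : StronglyMeasurable U) (hΘ : StronglyMeasurable Θ) (hU0 : nrm w U < ⊤)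
    (hΘ0 : nrm w Θ < ⊤) (hU1 : nrm (up w 1) U < ⊤) (hdiv : ∀ᵐ ξ, dotc ξ (U ξ) = 0) (k : Fin 3) :
    HatIs (velocityForcing α u θ t k τ)
      fun ξ => Real.exp (-((t - τ) * ‖ξ‖ ^ (2 * α))) • forceU U Θ ξ k := by
  have iU := hw.integrable hU.aestronglyMeasurable hU0
  have iΘ := hw.integrable hΘ.aestronglyMeasurable hΘ0
  have iA := hw.integrable (stronglyMeasurable_adv' hU hU).aestronglyMeasurable
    (hw.nrm_adv_lt_top hU hU hU0 hU0 hU1 hU1)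
  have hUk : ∀ i, StronglyMeasurable fun ξ => U ξ i := fun i =>
    (EuclideanSpace.proj (𝕜 := ℂ) i : C3 →L[ℂ] ℂ).continuous.comp_stronglyMeasurable hU
  have h1 : VHatIs (fun i => transport (u τ) (u τ i)) (adv U U) := fun i =>
    (hw.hatIs_transport hu (hu i) iU (hUk i).aestronglyMeasurable
      ((nrm_apply_le U i).trans_lt hU1) hdiv).congr ((adv_apply iU iU i).mono fun _ h => h.symm)
  have iE : Integrable fun ξ => (EuclideanSpace.single 2 (Θ ξ) : C3) := by
    refine iΘ.norm.mono' (continuous_single_two.comp_stronglyMeasurable hΘ).aestronglyMeasurable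
      (ae_of_all _ fun ξ => ?_)
    simp
  have h2 := (h1.leray iA k).heat (γ := α) (integrable_apply (integrable_lerayAt iA) k)
    (sub_nonneg.2 hτ)
  have h3 := ((hθ.timesE3).leray iE k).heat (γ := α) (integrable_apply (integrable_lerayAt iE) k)
    (sub_nonneg.2 hτ)
  refine (h3.sub h2).congr (ae_of_all _ fun ξ => ?_)
  simp only [forceU, PiLp.sub_apply, smul_sub]

theorem GoodWeight.hatIs_temperatureForcing (hw : GoodWeight w C) {β t τ : ℝ} (hτ : τ ≤ t)
    {u : ℝ → Fin 3 → Dist} {θ : ℝ → Dist} {Θ : E3 → ℂ} (hu : VHatIs (u τ) U) (hθ : HatIs (θ τ) Θ)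
    (hU : StronglyMeasurable U) (hΘ : StronglyMeasurable Θ) (hU0 : nrm w U < ⊤)
    (hΘ0 : nrm w Θ < ⊤) (hU1 : nrm (up w 1) U < ⊤) (hΘ1 : nrm (up w 1) Θ < ⊤)
    (hdiv : ∀ᵐ ξ, dotc ξ (U ξ) = 0) :
    HatIs (temperatureForcing β u θ t τ)
      fun ξ => Real.exp (-((t - τ) * ‖ξ‖ ^ (2 * β))) • forceT U Θ ξ := by
  have iU := hw.integrable hU.aestronglyMeasurable hU0
  have iA := hw.integrable (stronglyMeasurable_adv' hU hΘ).aestronglyMeasurable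
    (hw.nrm_adv_lt_top hU hΘ hU0 hΘ0 hU1 hΘ1)
  have h1 := (hw.hatIs_transport hu hθ iU hΘ.aestronglyMeasurable hΘ1 hdiv).heat (γ := β) iA
    (sub_nonneg.2 hτ)
  refine h1.neg.congr (ae_of_all _ fun ξ => ?_)
  simp only [forceT, smul_neg]

end

/-! ### The mild formulation -/

theorem duh_eq_zero {E : Type} [NormedAddCommGroup E] [NormedSpace ℝ E] {m : ℝ} {A : E} {F : ℝ → E}
    {t : ℝ} (h : IntervalIntegrable F volume 0 t) : duh m A F t =
      Real.exp (-(t * m)) • A + ∫ τ in (0 : ℝ)..t, Real.exp (-((t - τ) * m)) • F τ := by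
  have := duh_eq (m := m) (A := A) (F := F) (t₀ := 0) (t := t) (by simp) h
  rwa [sub_zero, duh_zero] at this

theorem GoodWeight.integrable_prod {w : E3 → ℝ} {C : ℝ} (hw : GoodWeight w C) {E : Type*}
    [NormedAddCommGroup E] {F : ℝ → E3 → E} (hF : StronglyMeasurable (Function.uncurry F))
    {S : Set ℝ} (h : ∫⁻ τ in S, nrm w (F τ) < ⊤) :
    Integrable (Function.uncurry F) ((volume.restrict S).prod volume) := by
  refine ⟨hF.aestronglyMeasurable, ?_⟩
  rw [HasFiniteIntegral, lintegral_prod _ hF.enorm.aemeasurable]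
  refine lt_of_le_of_lt (lintegral_mono fun τ => hw.lintegral_le (F τ)) ?_
  rw [lintegral_const_mul' _ _ ENNReal.ofReal_ne_top]
  exact ENNReal.mul_lt_top ENNReal.ofReal_lt_top h

/-- Duhamel's formula on the Fourier side is the mild formulation. -/
theorem GoodWeight.apply_Duh {w : E3 → ℝ} {C : ℝ} (hw : GoodWeight w C) {γ t : ℝ} (ht : 0 ≤ t) {A : E3 → ℂ}
    {F : ℝ → E3 → ℂ} (hA : StronglyMeasurable A) (hF : StronglyMeasurable (Function.uncurry F))
    (hA0 : nrm w A < ⊤) (hF0 : ∫⁻ τ in Ioc 0 t, nrm w (F τ) < ⊤) {d d₀ : Dist} {f : ℝ → Dist}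
    (hd : HatIs d (Duh γ A F t)) (hd₀ : HatIs d₀ fun ξ => Real.exp (-(t * ‖ξ‖ ^ (2 * γ))) • A ξ)
    (hf : ∀ᵐ τ ∂volume.restrict (Ioc 0 t),
      HatIs (f τ) fun ξ => Real.exp (-((t - τ) * ‖ξ‖ ^ (2 * γ))) • F τ ξ) (φ : 𝓢(E3, ℂ)) :
    IntervalIntegrable (fun τ => f τ φ) volume 0 t ∧
      d φ = d₀ φ + ∫ τ in (0 : ℝ)..t, f τ φ := by
  set ψ : E3 → ℂ := fun ξ => (𝓕⁻ φ : 𝓢(E3, ℂ)) ((2 * Real.pi)⁻¹ • ξ)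
  obtain ⟨M, hM⟩ : ∃ M, ∀ ξ, ‖ψ ξ‖ ≤ M := by
    obtain ⟨M, hM⟩ := (𝓕⁻ φ : 𝓢(E3, ℂ)).decay 0 0
    exact ⟨M, fun ξ => by simpa only [pow_zero, one_mul, norm_iteratedFDeriv_zero] using hM.2 ((2 * Real.pi)⁻¹ • ξ)⟩
  have hψc : Continuous ψ := (𝓕⁻ φ : 𝓢(E3, ℂ)).continuous.comp (continuous_const_smul _)
  have hψ : ∀ {g : E3 → ℂ}, Integrable g →
      Integrable fun ξ => (((2 * Real.pi) ^ 3)⁻¹ : ℝ) • (ψ ξ * g ξ) := fun hg =>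
    (hg.bdd_mul (c := M) hψc.aestronglyMeasurable (ae_of_all _ hM)).smul (((2 * Real.pi) ^ 3)⁻¹ : ℝ)
  have hM0 : 0 ≤ M := (norm_nonneg _).trans (hM 0)
  have hFi := hw.integrable_prod hF hF0
  -- The heat factor is at most one for τ ≤ t and ψ is bounded, so F, integrable in (τ, ξ),
  -- dominates; this justifies Fubini's theorem at the end.
  have hP0 : Integrable (Function.uncurry fun τ ξ => ψ ξ *
      (Real.exp (-((t - τ) * ‖ξ‖ ^ (2 * γ))) • F τ ξ)) ((volume.restrict (Ioc 0 t)).prod volume) := by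
    refine (hFi.norm.const_mul M).mono' ?_ ?_
    · have h1 : StronglyMeasurable fun p : ℝ × E3 => Real.exp (-((t - p.1) * ‖p.2‖ ^ (2 * γ))) :=
        Measurable.stronglyMeasurable (by fun_prop)
      have h2 : StronglyMeasurable fun p : ℝ × E3 => ψ p.2 :=
        (hψc.comp continuous_snd).stronglyMeasurable
      exact (h2.mul (h1.smul hF)).aestronglyMeasurable
    · filter_upwards [Measure.quasiMeasurePreserving_fst.ae (ae_restrict_mem measurableSet_Ioc)]
        with p hp
      rw [Function.uncurry_def, norm_mul, norm_smul, Real.norm_eq_abs, Real.abs_exp]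
      refine mul_le_mul (hM _) (mul_le_of_le_one_left (norm_nonneg _) (Real.exp_le_one_iff.2 ?_))
        (by positivity) hM0
      have : 0 ≤ (t - p.1) * ‖p.2‖ ^ (2 * γ) :=
        mul_nonneg (sub_nonneg.2 hp.2) (by positivity)
      linarith
  have hP : Integrable (Function.uncurry fun τ ξ => (((2 * Real.pi) ^ 3)⁻¹ : ℝ) • (ψ ξ *
      (Real.exp (-((t - τ) * ‖ξ‖ ^ (2 * γ))) • F τ ξ))) ((volume.restrict (Ioc 0 t)).prod volume) :=
    hP0.smul ((((2 * Real.pi) ^ 3)⁻¹ : ℝ))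
  have hfφ : (fun τ => f τ φ) =ᵐ[volume.restrict (Ioc 0 t)] fun τ =>
      ∫ ξ, (((2 * Real.pi) ^ 3)⁻¹ : ℝ) • (ψ ξ *
        (Real.exp (-((t - τ) * ‖ξ‖ ^ (2 * γ))) • F τ ξ)) := by
    filter_upwards [hf] with τ hτ using hτ.apply' φ
  refine ⟨(intervalIntegrable_iff_integrableOn_Ioc_of_le ht).2
    (hP.integral_prod_left.congr hfφ.symm), ?_⟩
  have hpt : ∀ᵐ ξ, (((2 * Real.pi) ^ 3)⁻¹ : ℝ) • (ψ ξ * Duh γ A F t ξ) =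
      (((2 * Real.pi) ^ 3)⁻¹ : ℝ) • (ψ ξ * (Real.exp (-(t * ‖ξ‖ ^ (2 * γ))) • A ξ)) +
      ∫ τ in Ioc 0 t, (((2 * Real.pi) ^ 3)⁻¹ : ℝ) • (ψ ξ *
        (Real.exp (-((t - τ) * ‖ξ‖ ^ (2 * γ))) • F τ ξ)) := by
    filter_upwards [hw.ae_integrableOn hF hF0] with ξ hξ
    rw [Duh, duh_eq_zero ((intervalIntegrable_iff_integrableOn_Ioc_of_le ht).2 hξ),
      intervalIntegral.integral_of_le ht, integral_smul, integral_const_mul, mul_add, smul_add]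
  have hI : Integrable fun ξ => ∫ τ in Ioc 0 t, (((2 * Real.pi) ^ 3)⁻¹ : ℝ) • (ψ ξ *
      (Real.exp (-((t - τ) * ‖ξ‖ ^ (2 * γ))) • F τ ξ)) := hP.swap.integral_prod_left
  rw [hd.apply' φ, hd₀.apply' φ, integral_congr_ae hpt,
    integral_add (hψ (integrable_heat (γ := γ) ht (hw.integrable hA.aestronglyMeasurable hA0))) hI,
    intervalIntegral.integral_of_le ht, integral_congr_ae hfφ, integral_integral_swap hP]

/-! ### From mild solutions to the Fourier side -/

theorem stronglyMeasurable_integral_closedBall {E : Type} [NormedAddCommGroup E] [NormedSpace ℝ E]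
    {g : E3 → E} (hg : StronglyMeasurable g) (r : ℝ) :
    StronglyMeasurable fun ξ : E3 => ∫ η in Metric.closedBall ξ r, g η := by
  have hS : MeasurableSet {p : E3 × E3 | p.2 ∈ Metric.closedBall p.1 r} :=
    (isClosed_le (by fun_prop) continuous_const : IsClosed {p : E3 × E3 | dist p.2 p.1 ≤ r}).measurableSet
  have h1 : StronglyMeasurable ({p : E3 × E3 | p.2 ∈ Metric.closedBall p.1 r}.indicator
      fun p : E3 × E3 => g p.2) := (hg.comp_measurable measurable_snd).indicator hS
  have h2 := h1.integral_prod_right' (ν := (volume : Measure E3))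
  refine (congrArg StronglyMeasurable (funext fun ξ => ?_)).mp h2
  rw [← integral_indicator Metric.isClosed_closedBall.measurableSet]
  rfl

/-- A continuous curve of functions has a jointly measurable version. -/
theorem GoodWeight.exists_measurable_version {w : E3 → ℝ} {C : ℝ} (hw : GoodWeight w C) {E : Type}
    [NormedAddCommGroup E] [NormedSpace ℝ E] [CompleteSpace E] {T : ℝ} {g : ℝ → E3 → E}
    (hg : ∀ t ∈ Ico 0 T, AEStronglyMeasurable (g t)) (hg0 : ∀ t ∈ Ico 0 T, nrm w (g t) < ⊤)
    (hc : ∀ t ∈ Ico 0 T, Tendsto (fun r => nrm w (fun ξ => g r ξ - g t ξ)) (𝓝[Ico 0 T] t) (𝓝 0)) :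
    ∃ g' : ℝ → E3 → E, StronglyMeasurable (Function.uncurry g') ∧
      ∀ t ∈ Ico 0 T, g t =ᵐ[volume] g' t := by
  set δ : ℕ → ℝ := fun n => 1 / ((n : ℝ) + 1)
  -- Averages over small balls are continuous in t, because the norm dominates `L¹`, and measurable
  -- in ξ; hence they are jointly measurable. Their limit is the desired version.
  set h : ℕ → Ico (0 : ℝ) T → E3 → E := fun n t ξ => ⨍ η in Metric.closedBall ξ (δ n), g t η
  have hint : ∀ t ∈ Ico 0 T, Integrable (g t) := fun t ht => hw.integrable (hg t ht) (hg0 t ht)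
  have hm : ∀ n, StronglyMeasurable (Function.uncurry (h n)) := by
    intro n
    refine stronglyMeasurable_uncurry_of_continuous_of_stronglyMeasurable (fun ξ => ?_) fun t => ?_
    · simp only [h, setAverage_eq]
      refine Continuous.const_smul ?_ _
      rw [continuous_iff_continuousAt]
      intro t
      rw [ContinuousAt, tendsto_iff_norm_sub_tendsto_zero]
      have h1 : Tendsto (fun r : Ico (0 : ℝ) T => nrm w (fun ξ => g r ξ - g t ξ)) (𝓝 t) (𝓝 0) :=
        (hc t t.2).comp (tendsto_nhdsWithin_iff.2 ⟨continuous_subtype_val.continuousAt,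
          Eventually.of_forall fun r => r.2⟩)
      have h3 := ENNReal.Tendsto.const_mul (a := ENNReal.ofReal C) h1 (Or.inr ENNReal.ofReal_ne_top)
      rw [mul_zero] at h3
      have h2 := (ENNReal.tendsto_toReal ENNReal.zero_ne_top).comp h3
      rw [ENNReal.toReal_zero] at h2
      refine squeeze_zero' (Eventually.of_forall fun _ => norm_nonneg _) ?_ h2
      filter_upwards [h1.eventually (gt_mem_nhds ENNReal.zero_lt_top)] with r hr
      rw [← integral_sub (hint r r.2).integrableOn (hint t t.2).integrableOn]
      refine (norm_integral_le_lintegral_norm _).trans (ENNReal.toReal_mono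
        (ENNReal.mul_lt_top ENNReal.ofReal_lt_top hr).ne ?_)
      simp only [ofReal_norm]
      exact (setLIntegral_le_lintegral _ _).trans (hw.lintegral_le _)
    · have e : ∀ ξ, h n t ξ = (volume.real (Metric.closedBall (0 : E3) (δ n)))⁻¹ •
          ∫ η in Metric.closedBall ξ (δ n), (hg t t.2).mk (g t) η := fun ξ => by
        simp only [h, setAverage_eq]
        rw [Measure.real, Measure.real, Measure.addHaar_closedBall_center]
        congr 1
        exact integral_congr_ae (ae_restrict_of_ae (hg t t.2).ae_eq_mk)
      rw [show h n t = _ from funext e]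
      exact (stronglyMeasurable_integral_closedBall (hg t t.2).stronglyMeasurable_mk _).const_smul _
  have hlim : StronglyMeasurable fun p : Ico (0 : ℝ) T × E3 =>
      limUnder atTop fun n => Function.uncurry (h n) p := StronglyMeasurable.limUnder hm
  have hemb : MeasurableEmbedding (Prod.map Subtype.val id : Ico (0 : ℝ) T × E3 → ℝ × E3) :=
    (MeasurableEmbedding.subtype_coe measurableSet_Ico).prodMap .id
  obtain ⟨f, hf, hfe⟩ := hemb.exists_stronglyMeasurable_extend hlim fun _ => ⟨0⟩
  refine ⟨fun t ξ => f (t, ξ), hf, fun t ht => ?_⟩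
  have hδ : Tendsto δ atTop (𝓝[>] 0) := tendsto_nhdsWithin_iff.2
    ⟨tendsto_one_div_add_atTop_nhds_zero_nat, Eventually.of_forall fun n => by
      simp only [δ, mem_Ioi]; positivity⟩
  -- Lebesgue's differentiation theorem: at each fixed t the averages converge to g at almost every
  -- ξ.
  filter_upwards [IsUnifLocDoublingMeasure.ae_tendsto_average volume (hint t ht).locallyIntegrable 1]
    with ξ hξ
  have h1 := hξ (fun _ => ξ) δ hδ (Eventually.of_forall fun n => by
    simp only [δ, one_mul]; exact Metric.mem_closedBall_self (by positivity))
  have h2 := congrFun hfe (⟨t, ht⟩, ξ)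
  simp only [Function.comp_apply, Prod.map_apply, id] at h2
  rw [h2]
  exact h1.limUnder_eq.symm

section

variable {a s σ : ℝ}

theorem HatIs.aestronglyMeasurable {f : Dist} {g : E3 → ℂ} (h : HatIs f g) :
    AEStronglyMeasurable g := by
  have h1 := h.1.aestronglyMeasurable
  have h2 := h1.comp_quasiMeasurePreserving
    (Measure.quasiMeasurePreserving_smul (volume : Measure E3) (inv_ne_zero two_pi_ne))
  refine h2.congr (ae_of_all _ fun ξ => ?_)
  simp only [Function.comp_apply, smul_inv_smul₀ two_pi_ne]

theorem VHatIs.aestronglyMeasurable {v : Fin 3 → Dist} {V : E3 → C3} (h : VHatIs v V) :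
    AEStronglyMeasurable V := by
  have h1 : AEMeasurable fun ξ => (fun k => V ξ k : Fin 3 → ℂ) :=
    aemeasurable_pi_lambda _ fun k => (h k).aestronglyMeasurable.aemeasurable
  exact ((PiLp.continuous_toLp 2 fun _ : Fin 3 => ℂ).measurable.comp_aemeasurable
    h1).aestronglyMeasurable

theorem VHatIs.congr {v : Fin 3 → Dist} {V V' : E3 → C3} (h : VHatIs v V) (hV : V =ᵐ[volume] V') :
    VHatIs v V' := fun k => (h k).congr (hV.mono fun ξ hξ => by simp only [hξ])

theorem normX_eq {f : Dist} {g : E3 → ℂ} (h : HatIs f g) :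
    normX a s σ f = nrm (weight a s σ) g := by
  rw [normX, if_pos h.hasFunHat]
  exact nrm_congr h.hat_ae

theorem VHatIs.hat_ae {v : Fin 3 → Dist} {V : E3 → C3} (h : VHatIs v V) :
    (fun ξ => (WithLp.toLp 2 fun k => hat (v k) ξ : C3)) =ᵐ[volume] V := by
  have hall : ∀ᵐ ξ, ∀ j, hat (v j) ξ = V ξ j := ae_all_iff.2 fun j => (h j).hat_ae
  filter_upwards [hall] with ξ hξ
  simp only [hξ]

theorem normX3_eq {v : Fin 3 → Dist} {V : E3 → C3} (h : VHatIs v V) :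
    normX3 a s σ v = nrm (weight a s σ) V := by
  rw [normX3, if_pos fun k => (h k).hasFunHat]
  exact nrm_congr h.hat_ae

theorem hatIs_of_normX {f : Dist} (h : normX a s σ f < ⊤) : HatIs f (hat f) := by
  by_cases hf : HasFunHat f
  · exact hf.hatIs
  · simp [normX, hf] at h

theorem vhatIs_of_normX3 {v : Fin 3 → Dist} (h : normX3 a s σ v < ⊤) :
    VHatIs v fun ξ => WithLp.toLp 2 fun k => hat (v k) ξ := by
  by_cases hf : ∀ k, HasFunHat (v k)
  · exact fun k => (hf k).hatIs
  · simp [normX3, hf] at h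

theorem VHatIs.sub {v v' : Fin 3 → Dist} {V V' : E3 → C3} (h : VHatIs v V) (h' : VHatIs v' V') :
    VHatIs (v - v') fun ξ => V ξ - V' ξ := fun k => (h k).sub (h' k)

theorem nrm_weight_add {E : Type} [NormedAddCommGroup E] (r : ℝ) (f : E3 → E) :
    nrm (weight a (s + r) σ) f = nrm (up (weight a s σ) r) f := by
  refine lintegral_congr_ae ?_
  filter_upwards [ae_ne_zero] with ξ hξ
  rw [up, weight, weight, Real.rpow_add (norm_pos_iff.2 hξ), mul_comm (‖ξ‖ ^ s), mul_assoc]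

end

section

variable {w : E3 → ℝ} {C : ℝ}

theorem GoodWeight.Duh_apply (hw : GoodWeight w C) {γ t : ℝ} (ht : 0 ≤ t) {A : E3 → C3}
    {F : ℝ → E3 → C3} (hF : StronglyMeasurable (Function.uncurry F))
    (h : ∫⁻ τ in Ioc 0 t, nrm w (F τ) < ⊤) (k : Fin 3) :
    ∀ᵐ ξ, Duh γ A F t ξ k = Duh γ (fun ξ => A ξ k) (fun τ ξ => F τ ξ k) t ξ := by
  filter_upwards [hw.ae_integrableOn hF h] with ξ hξ
  have h1 := intervalIntegrable_exp_smul (m := ‖ξ‖ ^ (2 * γ))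
    ((intervalIntegrable_iff_integrableOn_Ioc_of_le ht).2 hξ)
  rw [Duh, Duh, duh, duh, PiLp.smul_apply, PiLp.add_apply, intervalIntegral.integral_of_le ht,
    intervalIntegral.integral_of_le ht, integral_apply h1.1]
  rfl

theorem stronglyMeasurable_apply {X : Type*} [MeasurableSpace X] {V : X → C3}
    (hV : StronglyMeasurable V) (k : Fin 3) : StronglyMeasurable fun x => V x k :=
  (EuclideanSpace.proj (𝕜 := ℂ) k : C3 →L[ℂ] ℂ).continuous.comp_stronglyMeasurable hV

/-- One derivative is intermediate between none and 2γ > 1; this is interpolation with factor 1. -/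
theorem GoodWeight.nrm_up_one_lt_top (hw : GoodWeight w C) {γ : ℝ} (hγ : 1 / 2 < γ) {E : Type}
    [NormedAddCommGroup E] {f : E3 → E} (hf : AEStronglyMeasurable f) (h0 : nrm w f < ⊤)
    (h1 : nrm (up w (2 * γ)) f < ⊤) : nrm (up w 1) f < ⊤ := by
  obtain ⟨c, hc, h⟩ := exists_interp hγ one_pos
  have := h w hw.measurable hw.nonneg f hf 1 (by simp)
  simp only [ENNReal.one_rpow, one_mul, mul_one] at this
  exact this.trans_lt (ENNReal.add_lt_top.2 ⟨ENNReal.mul_lt_top ENNReal.ofReal_lt_top h1,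
    ENNReal.mul_lt_top ENNReal.ofReal_lt_top h0⟩)

theorem exists_controlled {γ t : ℝ} {E : Type}
    [NormedAddCommGroup E] {f : ℝ → E3 → E} (hc : ContinuousOn (fun t => (nrm w (f t)).toReal) (Icc 0 t))
    (h0 : ∀ τ ∈ Icc 0 t, nrm w (f τ) < ⊤)
    (h1 : ∫⁻ τ in Ioc 0 t, nrm (up w (2 * γ)) (f τ) < ⊤) :
    ∃ ρ < ⊤, Controlled w γ t f ρ := by
  obtain ⟨M, hM⟩ := isCompact_Icc.bddAbove_image hc
  refine ⟨ENNReal.ofReal M + ∫⁻ τ in Ioc 0 t, nrm (up w (2 * γ)) (f τ),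
    ENNReal.add_lt_top.2 ⟨ENNReal.ofReal_lt_top, h1⟩, fun τ hτ => ?_, le_add_self⟩
  refine le_trans ?_ le_self_add
  rw [← ENNReal.ofReal_toReal (h0 τ (Ioc_subset_Icc_self hτ)).ne]
  exact ENNReal.ofReal_le_ofReal (hM ⟨τ, Ioc_subset_Icc_self hτ, rfl⟩)

theorem dotc_ae_eq_zero {u : Fin 3 → Dist} {U : E3 → C3} (hu : VHatIs u U) :
    div3 u = 0 ↔ ∀ᵐ ξ, dotc ξ (U ξ) = 0 := div3_eq_zero_iff hu

/-- Duhamel's formula for the velocity on the Fourier side is the mild formulation. -/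
theorem GoodWeight.apply_Duh_vector (hw : GoodWeight w C) {γ t : ℝ} (ht : 0 ≤ t) {A : E3 → C3}
    {F : ℝ → E3 → C3} (hA : StronglyMeasurable A) (hF : StronglyMeasurable (Function.uncurry F))
    (hA0 : nrm w A < ⊤) (hF0 : ∫⁻ τ in Ioc 0 t, nrm w (F τ) < ⊤) {d d₀ : Dist} {f : ℝ → Dist}
    {k : Fin 3} (hd : HatIs d fun ξ => Duh γ A F t ξ k)
    (hd₀ : HatIs d₀ fun ξ => A ξ k)
    (hf : ∀ᵐ τ ∂volume.restrict (Ioc 0 t),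
      HatIs (f τ) fun ξ => Real.exp (-((t - τ) * ‖ξ‖ ^ (2 * γ))) • F τ ξ k) (φ : 𝓢(E3, ℂ)) :
    IntervalIntegrable (fun τ => f τ φ) volume 0 t ∧
      d φ = heat γ t d₀ φ + ∫ τ in (0 : ℝ)..t, f τ φ :=
  hw.apply_Duh (F := fun τ ξ => F τ ξ k) ht (stronglyMeasurable_apply hA k)
    (stronglyMeasurable_apply hF k)
    ((nrm_apply_le A k).trans_lt hA0)
    ((lintegral_mono fun τ => nrm_apply_le (F τ) k).trans_lt hF0)
    (hd.congr (hw.Duh_apply ht hF hF0 k))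
    (hd₀.heat (integrable_apply (hw.integrable hA.aestronglyMeasurable hA0) k) ht) hf φ

theorem GoodWeight.integrable_Duh (hw : GoodWeight w C) {γ t : ℝ} (ht : 0 ≤ t) {E : Type}
    [NormedAddCommGroup E] [NormedSpace ℝ E] {A : E3 → E} {F : ℝ → E3 → E}
    (hA : StronglyMeasurable A) (hF : StronglyMeasurable (Function.uncurry F))
    (hA0 : nrm w A < ⊤) (hF0 : ∫⁻ τ in Ioc 0 t, nrm w (F τ) < ⊤) : Integrable (Duh γ A F t) :=
  hw.integrable (stronglyMeasurable_section (stronglyMeasurable_Duh hA hF) t).aestronglyMeasurable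
    ((hw.nrm_Duh_le hA hF ht hF0).trans_lt (ENNReal.add_lt_top.2 ⟨hA0, hF0⟩))

end

/-- A mild solution is a solution on the Fourier side. -/
theorem IsMildSolution.exists_isFourierSolution {a s σ α β T C : ℝ} {u₀ : Fin 3 → Dist} {θ₀ : Dist}
    {u : ℝ → Fin 3 → Dist} {θ : ℝ → Dist} (hw : GoodWeight (weight a s σ) C) (hα : 1 / 2 < α)
    (hβ : 1 / 2 < β) (hu₀ : normX3 a s σ u₀ < ⊤) (hθ₀ : normX a s σ θ₀ < ⊤)
    (h : IsMildSolution a s σ α β u₀ θ₀ T u θ) :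
    ∃ (A : E3 → C3) (B : E3 → ℂ) (F : ℝ → E3 → C3) (G : ℝ → E3 → ℂ),
      IsFourierSolution (weight a s σ) α β A B F G T ∧ VHatIs u₀ A ∧ HatIs θ₀ B ∧
      ∀ t ∈ Ico 0 T, VHatIs (u t) (Duh α A F t) ∧ HatIs (θ t) (Duh β B G t) := by
  set w := weight a s σ
  have hu0 := vhatIs_of_normX3 hu₀
  have hθ0 := hatIs_of_normX hθ₀
  obtain ⟨A, hA, hAe⟩ := hu0.aestronglyMeasurable
  obtain ⟨B, hB, hBe⟩ := hθ0.aestronglyMeasurable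
  replace hu0 := hu0.congr hAe
  replace hθ0 := hθ0.congr hBe
  have hA0 : nrm w A < ⊤ := by rwa [normX3_eq hu0] at hu₀
  have hB0 : nrm w B < ⊤ := by rwa [normX_eq hθ0] at hθ₀
  have hu1 := fun t ht => vhatIs_of_normX3 (h.mem_u t ht)
  have hθ1 := fun t ht => hatIs_of_normX (h.mem_θ t ht)
  -- `hat` picks a representative at each time separately, with no joint measurability in (t, ξ);
  -- continuity in time allows a measurable choice.
  obtain ⟨U, hU, hUe⟩ := hw.exists_measurable_version (T := T)
    (g := fun t ξ => (WithLp.toLp 2 fun k => hat (u t k) ξ : C3))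
    (fun t ht => (hu1 t ht).aestronglyMeasurable)
    (fun t ht => by rw [← normX3_eq (hu1 t ht)]; exact h.mem_u t ht) fun t ht =>
      (h.continuous_u t ht).congr' (by
        filter_upwards [self_mem_nhdsWithin] with r hr
        exact normX3_eq ((hu1 r hr).sub (hu1 t ht)))
  obtain ⟨Θ, hΘ, hΘe⟩ := hw.exists_measurable_version (T := T) (g := fun t => hat (θ t))
    (fun t ht => (hθ1 t ht).aestronglyMeasurable)
    (fun t ht => by rw [← normX_eq (hθ1 t ht)]; exact h.mem_θ t ht) fun t ht =>
      (h.continuous_θ t ht).congr' (by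
        filter_upwards [self_mem_nhdsWithin] with r hr
        exact normX_eq ((hθ1 r hr).sub (hθ1 t ht)))
  replace hu1 : ∀ t ∈ Ico 0 T, VHatIs (u t) (U t) := fun t ht => (hu1 t ht).congr (hUe t ht)
  replace hθ1 : ∀ t ∈ Ico 0 T, HatIs (θ t) (Θ t) := fun t ht => (hθ1 t ht).congr (hΘe t ht)
  have hsU := fun t => stronglyMeasurable_section hU t
  have hsΘ := fun t => stronglyMeasurable_section hΘ t
  have hU0 : ∀ t ∈ Ico 0 T, nrm w (U t) < ⊤ := fun t ht => by
    rw [← normX3_eq (hu1 t ht)]; exact h.mem_u t ht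
  have hΘ0 : ∀ t ∈ Ico 0 T, nrm w (Θ t) < ⊤ := fun t ht => by
    rw [← normX_eq (hθ1 t ht)]; exact h.mem_θ t ht
  have hcU : ContinuousOn (fun t => (nrm w (U t)).toReal) (Ico 0 T) :=
    continuousOn_toReal_nrm hw (fun t _ => (hsU t).aestronglyMeasurable) hU0 fun t ht =>
      (h.continuous_u t ht).congr' (by
        filter_upwards [self_mem_nhdsWithin] with r hr
        exact normX3_eq ((hu1 r hr).sub (hu1 t ht)))
  have hcΘ : ContinuousOn (fun t => (nrm w (Θ t)).toReal) (Ico 0 T) :=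
    continuousOn_toReal_nrm hw (fun t _ => (hsΘ t).aestronglyMeasurable) hΘ0 fun t ht =>
      (h.continuous_θ t ht).congr' (by
        filter_upwards [self_mem_nhdsWithin] with r hr
        exact normX_eq ((hθ1 r hr).sub (hθ1 t ht)))
  have hsub : ∀ t ∈ Ico 0 T, Icc 0 t ⊆ Ico 0 T := fun t ht τ hτ => ⟨hτ.1, hτ.2.trans_lt ht.2⟩
  have hsub' : ∀ t ∈ Ico 0 T, Ioc 0 t ⊆ Ico 0 T := fun t ht =>
    Ioc_subset_Icc_self.trans (hsub t ht)
  have hU2 : ∀ t ∈ Ico 0 T, ∫⁻ τ in Ioc 0 t, nrm (up w (2 * α)) (U τ) < ⊤ := fun t ht => by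
    refine lt_of_le_of_lt (le_trans (le_of_eq ?_) (lintegral_mono_set Ioc_subset_Icc_self))
      (h.integrable_u t ht)
    refine setLIntegral_congr_fun measurableSet_Ioc fun τ hτ => ?_
    rw [normX3_eq (hu1 τ (hsub' t ht hτ)), nrm_weight_add]
  have hΘ2 : ∀ t ∈ Ico 0 T, ∫⁻ τ in Ioc 0 t, nrm (up w (2 * β)) (Θ τ) < ⊤ := fun t ht => by
    refine lt_of_le_of_lt (le_trans (le_of_eq ?_) (lintegral_mono_set Ioc_subset_Icc_self))
      (h.integrable_θ t ht)
    refine setLIntegral_congr_fun measurableSet_Ioc fun τ hτ => ?_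
    rw [normX_eq (hθ1 τ (hsub' t ht hτ)), nrm_weight_add]
  -- The forcing is computed from the solution itself. The mild formulation will show that the
  -- solution is the Duhamel flow of this forcing, so that the equation for the forcings holds by
  -- construction.
  set F : ℝ → E3 → C3 := fun τ => forceU (U τ) (Θ τ)
  set G : ℝ → E3 → ℂ := fun τ => forceT (U τ) (Θ τ)
  have hF : StronglyMeasurable (Function.uncurry F) := stronglyMeasurable_forceU hU hΘ
  have hG : StronglyMeasurable (Function.uncurry G) := stronglyMeasurable_forceT hU hΘ
  have hFG : ∀ t ∈ Ico 0 T, ∫⁻ τ in Ioc 0 t, nrm w (F τ) < ⊤ ∧ ∫⁻ τ in Ioc 0 t, nrm w (G τ) < ⊤ := by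
    intro t ht
    obtain ⟨ρ, hρ, hρ'⟩ := exists_controlled (γ := α) (hcU.mono (hsub t ht))
      (fun τ hτ => hU0 τ (hsub t ht hτ)) (hU2 t ht)
    obtain ⟨ρ₂, hρ₂, hρ₂'⟩ := exists_controlled (γ := β) (hcΘ.mono (hsub t ht))
      (fun τ hτ => hΘ0 τ (hsub t ht hτ)) (hΘ2 t ht)
    obtain ⟨c, -, hη⟩ := hw.exists_gain hα one_pos
    obtain ⟨c', -, hη'⟩ := hw.exists_gain hβ one_pos
    have g1 : Gain w α t (ENNReal.ofReal (1 + c * t) + ENNReal.ofReal (1 + c' * t)) :=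
      Gain.mono (hη t ht.1) le_self_add
    have g2 : Gain w β t (ENNReal.ofReal (1 + c * t) + ENNReal.ofReal (1 + c' * t)) :=
      Gain.mono (hη' t ht.1) le_add_self
    clear hη hη'
    have hη : ENNReal.ofReal (1 + c * t) + ENNReal.ofReal (1 + c' * t) < ⊤ := by simp
    have hr : ρ + ρ₂ < ⊤ := ENNReal.add_lt_top.2 ⟨hρ, hρ₂⟩
    have k1 : Controlled w α t U (ρ + ρ₂) := hρ'.mono le_self_add
    have k2 : Controlled w β t Θ (ρ + ρ₂) := hρ₂'.mono le_add_self
    generalize ENNReal.ofReal (1 + c * t) + ENNReal.ofReal (1 + c' * t) = η at *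
    constructor
    · refine (hw.lintegral_forceU_le g1 hU hΘ k1 k2).trans_lt (ENNReal.mul_lt_top
        (ENNReal.add_lt_top.2 ⟨ENNReal.mul_lt_top (by simp) (by simp), ENNReal.mul_lt_top
          (ENNReal.mul_lt_top (ENNReal.mul_lt_top (by simp) (by simp)) hη) hr⟩) hr)
    · exact (hw.lintegral_forceT_le g1 g2 hU hΘ k1 k2).trans_lt (ENNReal.mul_lt_top
        (ENNReal.mul_lt_top (ENNReal.mul_lt_top (ENNReal.mul_lt_top (by simp) (by simp)) hη) hr) hr)
  have hdiv : ∀ t ∈ Ico 0 T, ∀ᵐ ξ, dotc ξ (U t ξ) = 0 := fun t ht =>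
    (dotc_ae_eq_zero (hu1 t ht)).1 (h.div_free t ht)
  have hae : ∀ t ∈ Ico 0 T, ∀ᵐ τ ∂volume.restrict (Ioc 0 t), τ ∈ Ioc 0 t ∧
      nrm (up w 1) (U τ) < ⊤ ∧ nrm (up w 1) (Θ τ) < ⊤ := by
    intro t ht
    filter_upwards [ae_restrict_mem measurableSet_Ioc,
      ae_lt_top (measurable_nrm (up_measurable hw.measurable _) hU) (hU2 t ht).ne,
      ae_lt_top (measurable_nrm (up_measurable hw.measurable _) hΘ) (hΘ2 t ht).ne] with τ hτ h1 h2
    exact ⟨hτ, hw.nrm_up_one_lt_top hα (hsU τ).aestronglyMeasurable (hU0 τ (hsub' t ht hτ)) h1,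
      hw.nrm_up_one_lt_top hβ (hsΘ τ).aestronglyMeasurable (hΘ0 τ (hsub' t ht hτ)) h2⟩
  have hutD : ∀ t ∈ Ico 0 T, VHatIs (u t) (Duh α A F t) := by
    intro t ht k
    have hi := integrable_apply (hw.integrable_Duh (γ := α) ht.1 hA hF hA0 (hFG t ht).1) k
    have hd := hatIs_ofHat hi
    -- Both distributions have the same pairing with every test function: one by the mild
    -- formulation, the other by Fubini's theorem.
    have e : u t k = ofHat fun ξ => Duh α A F t ξ k := by
      ext φ
      have h1 := hw.apply_Duh_vector ht.1 hA hF hA0 (hFG t ht).1 hd (hu0 k)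
        (f := fun τ => velocityForcing α u θ t k τ) (by
          filter_upwards [hae t ht] with τ hτ
          have hτ' := hsub' t ht hτ.1
          exact hw.hatIs_velocityForcing hτ.1.2 (hu1 τ hτ') (hθ1 τ hτ') (hsU τ) (hsΘ τ)
            (hU0 τ hτ') (hΘ0 τ hτ') hτ.2.1 (hdiv τ hτ') k) φ
      rw [(h.eq_u t ht k φ).2, h1.2]
    rw [e]
    exact hd
  have hθtD : ∀ t ∈ Ico 0 T, HatIs (θ t) (Duh β B G t) := by
    intro t ht
    have hi := hw.integrable_Duh (γ := β) ht.1 hB hG hB0 (hFG t ht).2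
    have hd := hatIs_ofHat hi
    have e : θ t = ofHat (Duh β B G t) := by
      ext φ
      have h1 := hw.apply_Duh ht.1 hB hG hB0 (hFG t ht).2 hd
        (hθ0.heat (hw.integrable hB.aestronglyMeasurable hB0) ht.1)
        (f := fun τ => temperatureForcing β u θ t τ) (by
          filter_upwards [hae t ht] with τ hτ
          have hτ' := hsub' t ht hτ.1
          exact hw.hatIs_temperatureForcing hτ.1.2 (hu1 τ hτ') (hθ1 τ hτ') (hsU τ) (hsΘ τ)
            (hU0 τ hτ') (hΘ0 τ hτ') hτ.2.1 hτ.2.2 (hdiv τ hτ')) φ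
      rw [(h.eq_θ t ht φ).2, h1.2]
    rw [e]
    exact hd
  have hUae : ∀ t ∈ Ico 0 T, U t =ᵐ[volume] Duh α A F t := fun t ht => by
    have := (hu1 t ht).hat_ae
    exact this.symm.trans (hutD t ht).hat_ae
  have hΘae : ∀ t ∈ Ico 0 T, Θ t =ᵐ[volume] Duh β B G t := fun t ht =>
    (hθ1 t ht).ae_eq (hθtD t ht)
  refine ⟨A, B, F, G, ⟨hA, hB, hF, hG, hA0, hB0, fun t ht => ?_, fun t ht => ?_, ?_, ?_⟩, hu0, hθ0,
    fun t ht => ⟨hutD t ht, hθtD t ht⟩⟩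
  · rcases le_or_gt 0 t with h0 | h0
    · exact (hFG t ⟨h0, ht⟩).1
    · simp [Ioc_eq_empty (not_lt.2 h0.le)]
  · rcases le_or_gt 0 t with h0 | h0
    · exact (hFG t ⟨h0, ht⟩).2
    · simp [Ioc_eq_empty (not_lt.2 h0.le)]
  · filter_upwards [ae_restrict_mem measurableSet_Ioo] with τ hτ
    have hτ' := Ioo_subset_Ico_self hτ
    exact forceU_congr (hUae τ hτ') (hΘae τ hτ')
  · filter_upwards [ae_restrict_mem measurableSet_Ioo] with τ hτ
    have hτ' := Ioo_subset_Ico_self hτ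
    exact ae_of_all _ (forceT_congr (hUae τ hτ') (hΘae τ hτ'))

/-! ### From the Fourier side to mild solutions -/

/-- Fubini's theorem for null sets: identities known for almost every ξ at almost every time become
identities in time at a fixed frequency, where `duh` can use them. -/
theorem ae_ae_eq_swap {E : Type} [NormedAddCommGroup E] {S : Set ℝ} {f g : ℝ → E3 → E}
    (hf : StronglyMeasurable (Function.uncurry f)) (hg : StronglyMeasurable (Function.uncurry g))
    (h : ∀ᵐ τ ∂volume.restrict S, f τ =ᵐ[volume] g τ) :
    ∀ᵐ ξ, ∀ᵐ τ ∂volume.restrict S, f τ ξ = g τ ξ :=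
  (Measure.ae_ae_comm (p := fun τ ξ => f τ ξ = g τ ξ) (hf.measurableSet_eq_fun hg)).1 h

theorem refl_Duh_ae {E : Type} [NormedAddCommGroup E] [NormedSpace ℝ E] {J : E →L[ℝ] E}
    (hJ : ∀ v, J (J v) = v) {γ t : ℝ} (ht : 0 ≤ t) {A : E3 → E} {F : ℝ → E3 → E}
    (hF : StronglyMeasurable (Function.uncurry F)) (hA : refl J A =ᵐ[volume] A)
    (h : ∀ᵐ τ ∂volume.restrict (Ioc 0 t), refl J (F τ) =ᵐ[volume] F τ) :
    refl J (Duh γ A F t) =ᵐ[volume] Duh γ A F t := by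
  rw [refl_Duh hJ]
  filter_upwards [hA, ae_ae_eq_swap (stronglyMeasurable_refl J hF) hF h] with ξ h1 h2
  rw [Duh, Duh, h1]
  exact duh_congr ht h2

/-- Each frequency evolves by real multiples and time integrals, which stay in the complex plane
orthogonal to ξ; the forcing lies there because of the Leray symbol. -/
theorem dotc_Duh_ae {w : E3 → ℝ} {C : ℝ} (hw : GoodWeight w C) {γ t : ℝ} (ht : 0 ≤ t) {A : E3 → C3}
    {F : ℝ → E3 → C3} (hF : StronglyMeasurable (Function.uncurry F))
    (hF0 : ∫⁻ τ in Ioc 0 t, nrm w (F τ) < ⊤) (hA : ∀ᵐ ξ, dotc ξ (A ξ) = 0)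
    (h : ∀ᵐ τ ∂volume.restrict (Ioc 0 t), ∀ᵐ ξ, dotc ξ (F τ ξ) = 0) :
    ∀ᵐ ξ, dotc ξ (Duh γ A F t ξ) = 0 := by
  have hm : StronglyMeasurable (Function.uncurry fun (τ : ℝ) ξ => dotc ξ (F τ ξ)) :=
    continuous_dotc.comp_stronglyMeasurable
      ((measurable_snd.stronglyMeasurable).prodMk hF)
  filter_upwards [hA, ae_ae_eq_swap (g := fun _ _ => (0 : ℂ)) hm stronglyMeasurable_const h,
    hw.ae_integrableOn hF hF0] with ξ h1 h2 h3
  have h4 := intervalIntegrable_exp_smul (m := ‖ξ‖ ^ (2 * γ))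
    ((intervalIntegrable_iff_integrableOn_Ioc_of_le ht).2 h3)
  have hs : ∀ (c : ℝ) (v : C3), dotc ξ (c • v) = c * dotc ξ v := fun c v => by
    rw [← Complex.coe_smul, dotc_smul]
  have h5 : dotc ξ (∫ τ in Ioc 0 t, Real.exp (τ * ‖ξ‖ ^ (2 * γ)) • F τ ξ) = 0 := by
    rw [dotc_eq_inner, ← integral_inner h4.1]
    refine integral_eq_zero_of_ae ?_
    filter_upwards [h2] with τ hτ
    rw [← dotc_eq_inner, hs, hτ, mul_zero, Pi.zero_apply]
  rw [Duh, duh, intervalIntegral.integral_of_le ht, hs, dotc_add, h1, h5]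
  simp

theorem isReal_of_refl {f : Dist} {g : E3 → ℂ} (h : HatIs f g) (hg : Integrable g)
    (hs : refl conj1 g =ᵐ[volume] g) : IsReal f := by
  rw [isReal_iff h hg]
  filter_upwards [hs] with ξ hξ
  rw [← hξ, refl, conj1_apply, Complex.conj_conj]

theorem refl_of_isReal {f : Dist} {g : E3 → ℂ} (h : HatIs f g) (hg : Integrable g)
    (hr : IsReal f) : refl conj1 g =ᵐ[volume] g := by
  filter_upwards [(isReal_iff h hg).1 hr] with ξ hξ
  rw [refl, hξ, conj1_apply, Complex.conj_conj]

theorem VHatIs.isReal {u : Fin 3 → Dist} {U : E3 → C3} (h : VHatIs u U) (hU : Integrable U)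
    (hs : refl conj3 U =ᵐ[volume] U) (k : Fin 3) : IsReal (u k) := by
  refine isReal_of_refl (h k) (integrable_apply hU k) ?_
  filter_upwards [hs] with ξ hξ
  rw [refl, conj1_apply, ← conj3_apply]
  exact congrArg (fun v : C3 => v k) hξ

theorem VHatIs.refl_of_isReal {u : Fin 3 → Dist} {U : E3 → C3} (h : VHatIs u U) (hU : Integrable U)
    (hr : ∀ k, IsReal (u k)) : refl conj3 U =ᵐ[volume] U := by
  have hall : ∀ᵐ ξ, ∀ k, refl conj1 (fun ξ => U ξ k) ξ = U ξ k :=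
    ae_all_iff.2 fun k => Boussinesq.refl_of_isReal (h k) (integrable_apply hU k) (hr k)
  filter_upwards [hall] with ξ hξ
  ext k
  exact hξ k

theorem dotc_forceU (U : E3 → C3) (Θ : E3 → ℂ) (ξ : E3) : dotc ξ (forceU U Θ ξ) = 0 := by
  rw [forceU, dotc_sub, dotc_lerayAt, dotc_lerayAt, sub_zero]

/-- A solution on the Fourier side is a mild solution. -/
theorem IsFourierSolution.isMildSolution {a s σ α β T C : ℝ} {u₀ : Fin 3 → Dist} {θ₀ : Dist}
    {u : ℝ → Fin 3 → Dist} {θ : ℝ → Dist} (hw : GoodWeight (weight a s σ) C) (hα : 1 / 2 < α)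
    (hβ : 1 / 2 < β) {A : E3 → C3} {B : E3 → ℂ} {F : ℝ → E3 → C3} {G : ℝ → E3 → ℂ}
    (h : IsFourierSolution (weight a s σ) α β A B F G T) (hu₀ : VHatIs u₀ A) (hθ₀ : HatIs θ₀ B)
    (hsA : refl conj3 A =ᵐ[volume] A) (hsB : refl conj1 B =ᵐ[volume] B)
    (hdA : ∀ᵐ ξ, dotc ξ (A ξ) = 0)
    (hsF : ∀ᵐ τ ∂volume.restrict (Ioo 0 T), refl conj3 (F τ) =ᵐ[volume] F τ)
    (hsG : ∀ᵐ τ ∂volume.restrict (Ioo 0 T), refl conj1 (G τ) =ᵐ[volume] G τ)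
    (hu : ∀ t ∈ Ico 0 T, VHatIs (u t) (Duh α A F t))
    (hθ : ∀ t ∈ Ico 0 T, HatIs (θ t) (Duh β B G t)) :
    IsMildSolution a s σ α β u₀ θ₀ T u θ := by
  set w := weight a s σ
  have j1 : ∀ v, conj1 (conj1 v) = v := by simp [conj1_apply]
  have hU := h.stronglyMeasurable_U
  have hΘ := h.stronglyMeasurable_Θ
  have hsub : ∀ t ∈ Ico 0 T, Ioc 0 t ⊆ Ioo 0 T := fun t ht τ hτ => ⟨hτ.1, hτ.2.trans_lt ht.2⟩
  have hiU : ∀ t ∈ Ico 0 T, Integrable (Duh α A F t) := fun t ht =>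
    hw.integrable_Duh ht.1 h.meas_A h.meas_F h.nrm_A (h.nrm_F t ht.2)
  have hiΘ : ∀ t ∈ Ico 0 T, Integrable (Duh β B G t) := fun t ht =>
    hw.integrable_Duh ht.1 h.meas_B h.meas_G h.nrm_B (h.nrm_G t ht.2)
  have hdF : ∀ᵐ τ ∂volume.restrict (Ioo 0 T), ∀ᵐ ξ, dotc ξ (F τ ξ) = 0 := by
    filter_upwards [h.solves.1] with τ hτ
    filter_upwards [hτ] with ξ hξ
    rw [hξ, dotc_forceU]
  have hdU : ∀ t ∈ Ico 0 T, ∀ᵐ ξ, dotc ξ (Duh α A F t ξ) = 0 := fun t ht =>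
    dotc_Duh_ae hw ht.1 h.meas_F (h.nrm_F t ht.2) hdA
      (ae_restrict_of_ae_restrict_of_subset (hsub t ht) hdF)
  have hU2 : ∀ t ∈ Ico 0 T, ∫⁻ τ in Ioc 0 t, nrm (up w (2 * α)) (Duh α A F τ) < ⊤ := fun t ht =>
    (hw.controlled_Duh (γ := α) ht.1 h.meas_A h.meas_F (h.nrm_F t ht.2)).2.trans_lt
      (ENNReal.add_lt_top.2 ⟨h.nrm_A, h.nrm_F t ht.2⟩)
  have hΘ2 : ∀ t ∈ Ico 0 T, ∫⁻ τ in Ioc 0 t, nrm (up w (2 * β)) (Duh β B G τ) < ⊤ := fun t ht =>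
    (hw.controlled_Duh (γ := β) ht.1 h.meas_B h.meas_G (h.nrm_G t ht.2)).2.trans_lt
      (ENNReal.add_lt_top.2 ⟨h.nrm_B, h.nrm_G t ht.2⟩)
  -- Continuity of the Duhamel flow is available on closed intervals where the forcing is
  -- integrable; [0, (t+T)/2] is one that contains all points of [0, T) near t.
  have hnhds : ∀ t ∈ Ico 0 T, t ∈ Icc 0 ((t + T) / 2) ∧
      𝓝[Ico 0 T] t ≤ 𝓝[Icc 0 ((t + T) / 2)] t := fun t ht => by
    have h1 : t < (t + T) / 2 := by linarith [ht.2]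
    refine ⟨⟨ht.1, h1.le⟩, nhdsWithin_le_iff.2 ?_⟩
    filter_upwards [self_mem_nhdsWithin, mem_nhdsWithin_of_mem_nhds (Iio_mem_nhds h1)] with r hr hr'
    exact ⟨hr.1, le_of_lt hr'⟩
  have hae : ∀ t ∈ Ico 0 T, ∀ᵐ τ ∂volume.restrict (Ioc 0 t), τ ∈ Ioc 0 t ∧
      nrm (up w 1) (Duh α A F τ) < ⊤ ∧ nrm (up w 1) (Duh β B G τ) < ⊤ := by
    intro t ht
    filter_upwards [ae_restrict_mem measurableSet_Ioc,
      ae_lt_top (measurable_nrm (up_measurable hw.measurable _) hU) (hU2 t ht).ne,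
      ae_lt_top (measurable_nrm (up_measurable hw.measurable _) hΘ) (hΘ2 t ht).ne] with τ hτ h1 h2
    have hτ' := Ioo_subset_Ico_self (hsub t ht hτ)
    exact ⟨hτ, hw.nrm_up_one_lt_top hα (stronglyMeasurable_section hU τ).aestronglyMeasurable
      (h.nrm_U hw hτ') h1, hw.nrm_up_one_lt_top hβ
      (stronglyMeasurable_section hΘ τ).aestronglyMeasurable (h.nrm_Θ hw hτ') h2⟩
  constructor
  case real_u =>
    intro t ht k
    exact (hu t ht).isReal (hiU t ht) (refl_Duh_ae conj3_conj3 ht.1 h.meas_F hsA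
      (ae_restrict_of_ae_restrict_of_subset (hsub t ht) hsF)) k
  case real_θ =>
    intro t ht
    exact isReal_of_refl (hθ t ht) (hiΘ t ht) (refl_Duh_ae j1 ht.1 h.meas_G hsB
      (ae_restrict_of_ae_restrict_of_subset (hsub t ht) hsG))
  case div_free =>
    intro t ht
    exact (dotc_ae_eq_zero (hu t ht)).2 (hdU t ht)
  case mem_u =>
    intro t ht
    rw [normX3_eq (hu t ht)]
    exact h.nrm_U hw ht
  case mem_θ =>
    intro t ht
    rw [normX_eq (hθ t ht)]
    exact h.nrm_Θ hw ht
  case continuous_u =>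
    intro t ht
    have h1 : (t + T) / 2 < T := by linarith [ht.2]
    refine ((hw.tendsto_nrm_Duh (γ := α) h.meas_A h.meas_F h.nrm_A (h.nrm_F _ h1)
      (hnhds t ht).1).mono_left (hnhds t ht).2).congr' ?_
    filter_upwards [self_mem_nhdsWithin] with r hr
    exact (normX3_eq ((hu r hr).sub (hu t ht))).symm
  case continuous_θ =>
    intro t ht
    have h1 : (t + T) / 2 < T := by linarith [ht.2]
    refine ((hw.tendsto_nrm_Duh (γ := β) h.meas_B h.meas_G h.nrm_B (h.nrm_G _ h1)
      (hnhds t ht).1).mono_left (hnhds t ht).2).congr' ?_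
    filter_upwards [self_mem_nhdsWithin] with r hr
    exact (normX_eq ((hθ r hr).sub (hθ t ht))).symm
  case integrable_u =>
    intro t ht
    rw [← setLIntegral_congr Ioc_ae_eq_Icc]
    refine lt_of_le_of_lt (le_of_eq ?_) (hU2 t ht)
    refine setLIntegral_congr_fun measurableSet_Ioc fun τ hτ => ?_
    rw [normX3_eq (hu τ (Ioo_subset_Ico_self (hsub t ht hτ))), nrm_weight_add]
  case integrable_θ =>
    intro t ht
    rw [← setLIntegral_congr Ioc_ae_eq_Icc]
    refine lt_of_le_of_lt (le_of_eq ?_) (hΘ2 t ht)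
    refine setLIntegral_congr_fun measurableSet_Ioc fun τ hτ => ?_
    rw [normX_eq (hθ τ (Ioo_subset_Ico_self (hsub t ht hτ))), nrm_weight_add]
  case eq_u =>
    intro t ht k φ
    refine hw.apply_Duh_vector ht.1 h.meas_A h.meas_F h.nrm_A (h.nrm_F t ht.2) (hu t ht k) (hu₀ k) ?_ φ
    filter_upwards [hae t ht, ae_restrict_of_ae_restrict_of_subset (hsub t ht) h.solves.1]
      with τ hτ hF
    have hτ' := Ioo_subset_Ico_self (hsub t ht hτ.1)
    refine (hw.hatIs_velocityForcing hτ.1.2 (hu τ hτ') (hθ τ hτ') (stronglyMeasurable_section hU τ)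
      (stronglyMeasurable_section hΘ τ) (h.nrm_U hw hτ') (h.nrm_Θ hw hτ') hτ.2.1 (hdU τ hτ')
      k).congr ?_
    filter_upwards [hF] with ξ hξ
    rw [hξ]
  case eq_θ =>
    intro t ht φ
    refine hw.apply_Duh ht.1 h.meas_B h.meas_G h.nrm_B (h.nrm_G t ht.2) (hθ t ht)
      (hθ₀.heat (hw.integrable h.meas_B.aestronglyMeasurable h.nrm_B) ht.1) ?_ φ
    filter_upwards [hae t ht, ae_restrict_of_ae_restrict_of_subset (hsub t ht) h.solves.2]
      with τ hτ hG
    have hτ' := Ioo_subset_Ico_self (hsub t ht hτ.1)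
    refine (hw.hatIs_temperatureForcing hτ.1.2 (hu τ hτ') (hθ τ hτ')
      (stronglyMeasurable_section hU τ) (stronglyMeasurable_section hΘ τ) (h.nrm_U hw hτ')
      (h.nrm_Θ hw hτ') hτ.2.1 hτ.2.2 (hdU τ hτ')).congr ?_
    filter_upwards [hG] with ξ hξ
    rw [hξ]

/-! ### Continuation -/

/-- The function that is `F` before the time `T` and a translate of `F₁` after it. -/
def glue {Z : Type*} (T : ℝ) (F F₁ : ℝ → Z) (τ : ℝ) : Z := if τ < T then F τ else F₁ (τ - T)

theorem ae_glue {p : ℝ → Prop} {T δ : ℝ} (h1 : ∀ᵐ τ ∂volume.restrict (Ioo 0 T), p τ)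
    (h2 : ∀ᵐ τ ∂volume.restrict (Ioc 0 δ), p (τ + T)) :
    ∀ᵐ τ ∂volume.restrict (Ioo 0 (T + δ)), p τ := by
  have h3 : ∀ᵐ τ ∂volume.restrict (Ioc T (T + δ)), p τ := by
    have hm := ((measurePreserving_sub_right volume T).restrict_preimage
      (measurableSet_Ioc (a := (0 : ℝ)) (b := δ))).quasiMeasurePreserving.ae h2
    rw [preimage_sub_const_Ioc, zero_add, add_comm δ T] at hm
    simpa using hm
  rw [Measure.restrict_congr_set Ioo_ae_eq_Ioc] at h1
  refine ae_restrict_of_ae_restrict_of_subset (t := Ioc 0 T ∪ Ioc T (T + δ)) (fun τ hτ => ?_)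
    ((ae_restrict_union_iff _ _ _).2 ⟨h1, h3⟩)
  rcases le_or_gt τ T with h | h
  · exact Or.inl ⟨hτ.1, h⟩
  · exact Or.inr ⟨h, hτ.2.le⟩

section

variable {E : Type} [NormedAddCommGroup E] {F F₁ : ℝ → E3 → E} {T δ : ℝ}

theorem stronglyMeasurable_glue (hF : StronglyMeasurable (Function.uncurry F))
    (hF₁ : StronglyMeasurable (Function.uncurry F₁)) :
    StronglyMeasurable (Function.uncurry (glue T F F₁)) := by
  have hs : MeasurableSet {p : ℝ × E3 | p.1 < T} := measurableSet_lt measurable_fst measurable_const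
  have h1 : StronglyMeasurable fun p : ℝ × E3 => F₁ (p.1 - T) p.2 :=
    hF₁.comp_measurable (g := fun p : ℝ × E3 => (p.1 - T, p.2)) (by fun_prop)
  have e : Function.uncurry (glue T F F₁) =
      fun p => if p.1 < T then Function.uncurry F p else F₁ (p.1 - T) p.2 := by
    ext1 p
    by_cases h : p.1 < T <;> simp [glue, Function.uncurry_def, h]
  rw [e]
  exact StronglyMeasurable.ite hs hF h1

theorem lintegral_glue {w : E3 → ℝ} (hw : Measurable w)
    (hF₁ : StronglyMeasurable (Function.uncurry F₁)) :
    ∫⁻ τ in Ioc 0 (T + δ), nrm w (glue T F F₁ τ) ≤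
      (∫⁻ τ in Ioc 0 T, nrm w (F τ)) + ∫⁻ τ in Ioc 0 δ, nrm w (F₁ τ) := by
  have h2 : ∫⁻ τ in Ioc T (T + δ), nrm w (F₁ (τ - T)) = ∫⁻ τ in Ioc 0 δ, nrm w (F₁ τ) := by
    have := (measurePreserving_sub_right (volume : Measure ℝ) T).setLIntegral_comp_preimage
      (measurableSet_Ioc (a := (0 : ℝ)) (b := δ)) (measurable_nrm hw hF₁)
    rwa [preimage_sub_const_Ioc, zero_add, add_comm δ T] at this
  have hsub : Ioc 0 (T + δ) ⊆ Ioc 0 T ∪ Ioc T (T + δ) := fun τ hτ => by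
    rcases le_or_gt τ T with h | h
    · exact Or.inl ⟨hτ.1, h⟩
    · exact Or.inr ⟨h, hτ.2⟩
  refine (lintegral_mono_set hsub).trans ((lintegral_union_le _ _ _).trans (add_le_add
    (le_of_eq ?_) (le_of_eq ?_)))
  · rw [← setLIntegral_congr Ioo_ae_eq_Ioc, ← setLIntegral_congr Ioo_ae_eq_Ioc]
    exact setLIntegral_congr_fun measurableSet_Ioo fun τ hτ => by simp only [glue, if_pos hτ.2]
  · rw [← h2]
    exact setLIntegral_congr_fun measurableSet_Ioc fun τ hτ => by
      simp only [glue, if_neg (not_lt.2 hτ.1.le)]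

variable [NormedSpace ℝ E]

theorem Duh_glue_of_le {γ t : ℝ} {A : E3 → E} (ht0 : 0 ≤ t) (ht : t ≤ T) :
    Duh γ A (glue T F F₁) t = Duh γ A F t := by
  ext1 ξ
  refine duh_congr ht0 ?_
  rw [← Measure.restrict_congr_set Ioo_ae_eq_Ioc]
  filter_upwards [ae_restrict_mem measurableSet_Ioo] with τ hτ
  simp only [glue, if_pos (hτ.2.trans_le ht)]

/-- Restart Duhamel's formula at T and shift time: after T the glued forcing is the translate of
`F₁`, and the state at T is the new initial value. -/
theorem GoodWeight.Duh_glue_add {w : E3 → ℝ} {C : ℝ} (hw : GoodWeight w C) {γ t : ℝ} {A : E3 → E}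
    (hT : 0 ≤ T) (ht : 0 ≤ t) (hF : StronglyMeasurable (Function.uncurry F))
    (hF₁ : StronglyMeasurable (Function.uncurry F₁))
    (hF0 : ∫⁻ τ in Ioc 0 T, nrm w (F τ) < ⊤) (hF₁0 : ∫⁻ τ in Ioc 0 t, nrm w (F₁ τ) < ⊤) :
    Duh γ A (glue T F F₁) (t + T) =ᵐ[volume] Duh γ (Duh γ A F T) F₁ t := by
  have hg : ∫⁻ τ in Ioc 0 (T + t), nrm w (glue T F F₁ τ) < ⊤ :=
    (lintegral_glue hw.measurable hF₁).trans_lt (ENNReal.add_lt_top.2 ⟨hF0, hF₁0⟩)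
  filter_upwards [hw.ae_integrableOn (stronglyMeasurable_glue hF hF₁) hg,
    hw.ae_integrableOn hF₁ hF₁0] with ξ h1 h2
  have e : Duh γ A F T ξ = Duh γ A (glue T F F₁) T ξ := by rw [Duh_glue_of_le hT le_rfl]
  have i1 : IntervalIntegrable (fun τ => glue T F F₁ τ ξ) volume 0 T :=
    (intervalIntegrable_iff_integrableOn_Ioc_of_le hT).2
      (h1.mono_set (Ioc_subset_Ioc_right (by linarith)))
  have i2 : IntervalIntegrable (fun τ => glue T F F₁ τ ξ) volume T (t + T) :=
    (intervalIntegrable_iff_integrableOn_Ioc_of_le (by linarith)).2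
      (h1.mono_set (Ioc_subset_Ioc hT (by linarith)))
  rw [Duh, Duh, duh_eq i1 i2, duh_eq_zero ((intervalIntegrable_iff_integrableOn_Ioc_of_le ht).2 h2),
    e, add_sub_cancel_right, Duh]
  congr 1
  have h3 := intervalIntegral.integral_comp_add_right (a := 0) (b := t)
    (fun τ => Real.exp (-((t + T - τ) * ‖ξ‖ ^ (2 * γ))) • glue T F F₁ τ ξ) T
  rw [zero_add] at h3
  rw [← h3]
  refine intervalIntegral.integral_congr_ae (ae_of_all _ fun τ hτ => ?_)
  rw [uIoc_of_le ht] at hτ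
  have h4 : ¬ τ + T < T := by linarith [hτ.1]
  simp only [glue, if_neg h4, add_sub_add_right_eq_sub, add_sub_cancel_right]

end

/-- Integrability of the forcing up to T places the Duhamel flow at time T in the space. Local
existence starts from that value and the two forcings are glued; the symmetry of the data and of the
forcing makes the restart real-valued too. -/
theorem IsFourierSolution.exists_extension {w : E3 → ℝ} {C α β T : ℝ} {A : E3 → C3} {B : E3 → ℂ}
    {F : ℝ → E3 → C3} {G : ℝ → E3 → ℂ} (hw : GoodWeight w C) (hwn : ∀ ξ, w (-ξ) = w ξ)
    (hα : 1 / 2 < α) (hβ : 1 / 2 < β) (h : IsFourierSolution w α β A B F G T) (hT : 0 ≤ T)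
    (hF : ∫⁻ τ in Ioc 0 T, nrm w (F τ) < ⊤) (hG : ∫⁻ τ in Ioc 0 T, nrm w (G τ) < ⊤)
    (hsA : refl conj3 A =ᵐ[volume] A) (hsB : refl conj1 B =ᵐ[volume] B)
    (hsF : ∀ᵐ τ ∂volume.restrict (Ioo 0 T), refl conj3 (F τ) =ᵐ[volume] F τ)
    (hsG : ∀ᵐ τ ∂volume.restrict (Ioo 0 T), refl conj1 (G τ) =ᵐ[volume] G τ) :
    ∃ T' > T, ∃ (F' : ℝ → E3 → C3) (G' : ℝ → E3 → ℂ), IsFourierSolution w α β A B F' G' T' ∧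
      (∀ᵐ τ ∂volume.restrict (Ioo 0 T'), refl conj3 (F' τ) =ᵐ[volume] F' τ) ∧
      (∀ᵐ τ ∂volume.restrict (Ioo 0 T'), refl conj1 (G' τ) =ᵐ[volume] G' τ) ∧
      ∀ t ∈ Ico 0 T, Duh α A F' t = Duh α A F t ∧ Duh β B G' t = Duh β B G t := by
  have j1 : ∀ v, conj1 (conj1 v) = v := by simp [conj1_apply]
  have hA₁ := stronglyMeasurable_section h.stronglyMeasurable_U T
  have hB₁ := stronglyMeasurable_section h.stronglyMeasurable_Θ T
  obtain ⟨δ, hδ, F₁, G₁, hF₁, hG₁, hF₁0, hG₁0, hsol, hsF₁, hsG₁⟩ := hw.exists_solves hwn hα hβ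
    hA₁ hB₁ ((hw.nrm_Duh_le h.meas_A h.meas_F hT hF).trans_lt (ENNReal.add_lt_top.2 ⟨h.nrm_A, hF⟩))
    ((hw.nrm_Duh_le h.meas_B h.meas_G hT hG).trans_lt (ENNReal.add_lt_top.2 ⟨h.nrm_B, hG⟩))
    (refl_Duh_ae conj3_conj3 hT h.meas_F hsA (by rwa [← Measure.restrict_congr_set Ioo_ae_eq_Ioc]))
    (refl_Duh_ae j1 hT h.meas_G hsB (by rwa [← Measure.restrict_congr_set Ioo_ae_eq_Ioc]))
  have e1 : ∀ {Z : Type} (f f₁ : ℝ → Z), ∀ τ ∈ Ioo 0 T, glue T f f₁ τ = f τ := fun f f₁ τ hτ => by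
    simp only [glue, if_pos hτ.2]
  have e2 : ∀ {Z : Type} (f f₁ : ℝ → Z), ∀ τ ∈ Ioc 0 δ, glue T f f₁ (τ + T) = f₁ τ :=
    fun f f₁ τ hτ => by
      have : ¬ τ + T < T := by linarith [hτ.1]
      simp only [glue, if_neg this, add_sub_cancel_right]
  have hfin : ∀ τ ∈ Ioc 0 δ, ∫⁻ r in Ioc 0 τ, nrm w (F₁ r) < ⊤ ∧ ∫⁻ r in Ioc 0 τ, nrm w (G₁ r) < ⊤ :=
    fun τ hτ => ⟨(lintegral_mono_set (Ioc_subset_Ioc_right hτ.2)).trans_lt hF₁0,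
      (lintegral_mono_set (Ioc_subset_Ioc_right hτ.2)).trans_lt hG₁0⟩
  refine ⟨T + δ, by linarith, glue T F F₁, glue T G G₁,
    ⟨h.meas_A, h.meas_B, stronglyMeasurable_glue h.meas_F hF₁, stronglyMeasurable_glue h.meas_G hG₁,
      h.nrm_A, h.nrm_B, fun t ht => ?_, fun t ht => ?_, ae_glue ?_ ?_, ae_glue ?_ ?_⟩,
    ae_glue ?_ ?_, ae_glue ?_ ?_,
    fun t ht => ⟨Duh_glue_of_le ht.1 ht.2.le, Duh_glue_of_le ht.1 ht.2.le⟩⟩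
  · exact ((lintegral_mono_set (Ioc_subset_Ioc_right ht.le)).trans
      (lintegral_glue hw.measurable hF₁)).trans_lt (ENNReal.add_lt_top.2 ⟨hF, hF₁0⟩)
  · exact ((lintegral_mono_set (Ioc_subset_Ioc_right ht.le)).trans
      (lintegral_glue hw.measurable hG₁)).trans_lt (ENNReal.add_lt_top.2 ⟨hG, hG₁0⟩)
  · filter_upwards [h.solves.1, ae_restrict_mem measurableSet_Ioo] with τ h1 hτ
    rwa [e1 F F₁ τ hτ, Duh_glue_of_le hτ.1.le hτ.2.le, Duh_glue_of_le hτ.1.le hτ.2.le]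
  · filter_upwards [hsol.1, ae_restrict_mem measurableSet_Ioc] with τ h1 hτ
    rw [e2 F F₁ τ hτ]
    exact h1.trans (forceU_congr
      (hw.Duh_glue_add hT hτ.1.le h.meas_F hF₁ hF (hfin τ hτ).1).symm
      (hw.Duh_glue_add hT hτ.1.le h.meas_G hG₁ hG (hfin τ hτ).2).symm)
  · filter_upwards [h.solves.2, ae_restrict_mem measurableSet_Ioo] with τ h1 hτ
    rwa [e1 G G₁ τ hτ, Duh_glue_of_le hτ.1.le hτ.2.le, Duh_glue_of_le hτ.1.le hτ.2.le]
  · filter_upwards [hsol.2, ae_restrict_mem measurableSet_Ioc] with τ h1 hτ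
    rw [e2 G G₁ τ hτ]
    exact h1.trans (ae_of_all _ (forceT_congr
      (hw.Duh_glue_add hT hτ.1.le h.meas_F hF₁ hF (hfin τ hτ).1).symm
      (hw.Duh_glue_add hT hτ.1.le h.meas_G hG₁ hG (hfin τ hτ).2).symm))
  · filter_upwards [hsF, ae_restrict_mem measurableSet_Ioo] with τ h1 hτ
    rwa [e1 F F₁ τ hτ]
  · filter_upwards [hsF₁, ae_restrict_mem measurableSet_Ioc] with τ h1 hτ
    rwa [e2 F F₁ τ hτ]
  · filter_upwards [hsG, ae_restrict_mem measurableSet_Ioo] with τ h1 hτ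
    rwa [e1 G G₁ τ hτ]
  · filter_upwards [hsG₁, ae_restrict_mem measurableSet_Ioc] with τ h1 hτ
    rwa [e2 G G₁ τ hτ]

/-- A mild solution with integrable forcing can be continued. -/
theorem IsMaximalMildSolution.lintegral_rate_eq_top {a s σ α β T C : ℝ} {u₀ : Fin 3 → Dist}
    {θ₀ : Dist} {u : ℝ → Fin 3 → Dist} {θ : ℝ → Dist} (hw : GoodWeight (weight a s σ) C)
    (hα : 1 / 2 < α) (hβ : 1 / 2 < β) (hu₀r : ∀ k, IsReal (u₀ k)) (hθ₀r : IsReal θ₀)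
    (hu₀d : div3 u₀ = 0) (h : IsMaximalMildSolution a s σ α β u₀ θ₀ T u θ)
    {A : E3 → C3} {B : E3 → ℂ} {F : ℝ → E3 → C3} {G : ℝ → E3 → ℂ}
    (hs : IsFourierSolution (weight a s σ) α β A B F G T) (hA : VHatIs u₀ A) (hB : HatIs θ₀ B)
    (hut : ∀ t ∈ Ico 0 T, VHatIs (u t) (Duh α A F t) ∧ HatIs (θ t) (Duh β B G t))
    {t : ℝ} (ht : t ∈ Ico 0 T) :
    ∫⁻ τ in Ico t T, rate (weight a s σ) α β A B F G τ = ⊤ := by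
  by_contra hne
  obtain ⟨hF, hG⟩ := hw.lintegral_force_lt_top hα hβ hs ht (lt_top_iff_ne_top.2 hne)
  set w := weight a s σ
  have hwn : ∀ ξ, w (-ξ) = w ξ := fun ξ => by simp only [w, weight, norm_neg]
  have hsA := hA.refl_of_isReal (hw.integrable hs.meas_A.aestronglyMeasurable hs.nrm_A) hu₀r
  have hsB := refl_of_isReal hB (hw.integrable hs.meas_B.aestronglyMeasurable hs.nrm_B) hθ₀r
  have hiU : ∀ t ∈ Ico 0 T, Integrable (Duh α A F t) := fun t ht =>
    hw.integrable_Duh ht.1 hs.meas_A hs.meas_F hs.nrm_A (hs.nrm_F t ht.2)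
  have hiΘ : ∀ t ∈ Ico 0 T, Integrable (Duh β B G t) := fun t ht =>
    hw.integrable_Duh ht.1 hs.meas_B hs.meas_G hs.nrm_B (hs.nrm_G t ht.2)
  have hrU : ∀ t ∈ Ico 0 T, refl conj3 (Duh α A F t) =ᵐ[volume] Duh α A F t := fun t ht =>
    (hut t ht).1.refl_of_isReal (hiU t ht) (h.solution.real_u t ht)
  have hrΘ : ∀ t ∈ Ico 0 T, refl conj1 (Duh β B G t) =ᵐ[volume] Duh β B G t := fun t ht =>
    refl_of_isReal (hut t ht).2 (hiΘ t ht) (h.solution.real_θ t ht)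
  have neg : ∀ {p : E3 → Prop}, (∀ᵐ ξ, p ξ) → ∀ᵐ ξ, p (-ξ) := fun h =>
    (Measure.measurePreserving_neg (volume : Measure E3)).quasiMeasurePreserving.ae h
  -- The forcing inherits the symmetry from the solution, which is real by assumption, because
  -- `forceU` commutes with the reflection.
  have hsF : ∀ᵐ τ ∂volume.restrict (Ioo 0 T), refl conj3 (F τ) =ᵐ[volume] F τ := by
    filter_upwards [hs.solves.1, ae_restrict_mem measurableSet_Ioo] with τ h1 hτ
    have hτ' := Ioo_subset_Ico_self hτ
    have h2 : refl conj3 (F τ) =ᵐ[volume] refl conj3 (forceU (Duh α A F τ) (Duh β B G τ)) := by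
      filter_upwards [neg h1] with ξ hξ
      rw [refl, hξ, refl]
    rw [refl_forceU] at h2
    exact (h2.trans (forceU_congr (hrU τ hτ') (hrΘ τ hτ'))).trans h1.symm
  have hsG : ∀ᵐ τ ∂volume.restrict (Ioo 0 T), refl conj1 (G τ) =ᵐ[volume] G τ := by
    filter_upwards [hs.solves.2, ae_restrict_mem measurableSet_Ioo] with τ h1 hτ
    have hτ' := Ioo_subset_Ico_self hτ
    have h2 : refl conj1 (G τ) =ᵐ[volume] refl conj1 (forceT (Duh α A F τ) (Duh β B G τ)) := by
      filter_upwards [neg h1] with ξ hξ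
      rw [refl, hξ, refl]
    rw [refl_forceT] at h2
    exact (h2.trans (ae_of_all _ (forceT_congr (hrU τ hτ') (hrΘ τ hτ')))).trans h1.symm
  obtain ⟨T', hT', F', G', hs', hsF', hsG', hagree⟩ := hs.exists_extension hw hwn hα hβ
    h.time_pos.le hF hG hsA hsB hsF hsG
  have hiU' : ∀ t ∈ Ico 0 T', Integrable (Duh α A F' t) := fun t ht =>
    hw.integrable_Duh ht.1 hs'.meas_A hs'.meas_F hs'.nrm_A (hs'.nrm_F t ht.2)
  have hiΘ' : ∀ t ∈ Ico 0 T', Integrable (Duh β B G' t) := fun t ht =>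
    hw.integrable_Duh ht.1 hs'.meas_B hs'.meas_G hs'.nrm_B (hs'.nrm_G t ht.2)
  -- The extension is defined through `ofHat`. On [0, T) it equals the given solution as a
  -- distribution, since a distribution is determined by its transform.
  refine h.no_extension ⟨T', hT', fun t k => ofHat fun ξ => Duh α A F' t ξ k,
    fun t => ofHat (Duh β B G' t), hs'.isMildSolution hw hα hβ hA hB hsA hsB
      ((dotc_ae_eq_zero hA).1 hu₀d) hsF' hsG' (fun t ht k => hatIs_ofHat (integrable_apply (hiU' t ht) k))
      fun t ht => hatIs_ofHat (hiΘ' t ht), fun t ht => ⟨?_, ?_⟩⟩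
  · funext k
    simp only [(hagree t ht).1]
    exact ((hut t ht).1 k).eq_ofHat.symm
  · simp only [(hagree t ht).2]
    exact (hut t ht).2.eq_ofHat.symm

end Boussinesq

end

/-! ### The blow-up statements -/

theorem theorem1p4 (a s σ α β : ℝ) (hα : 1 / 2 < α) (hβ : 1 / 2 < β)
    (hrange : (0 < a ∧ s ∈ Set.Ico (-1 : ℝ) 0 ∧ 1 < σ) ∨ (0 ≤ a ∧ s = 0 ∧ 1 ≤ σ)) :
    ∃ C : ℝ, 0 < C ∧
      ∀ (u₀ : Fin 3 → Boussinesq.Dist) (θ₀ : Boussinesq.Dist),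
        (∀ k, Boussinesq.IsReal (u₀ k)) → Boussinesq.IsReal θ₀ →
        Boussinesq.div3 u₀ = 0 →
        Boussinesq.normX3 a s σ u₀ < ⊤ → Boussinesq.normX a s σ θ₀ < ⊤ →
        ∀ (Tstar : ℝ) (u : ℝ → Fin 3 → Boussinesq.Dist) (θ : ℝ → Boussinesq.Dist),
          Boussinesq.IsMaximalMildSolution a s σ α β u₀ θ₀ Tstar u θ →
          Filter.limsup (fun t => Boussinesq.normPair a s σ (u t) (θ t)) (𝓝[<] Tstar) = ⊤ ∧
          (∀ t ∈ Set.Ico 0 Tstar,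
            ∫⁻ τ in Set.Ico t Tstar,
              (Boussinesq.normPair a s σ (u τ) (θ τ) ^ (2 * α / (2 * α - 1))
                + Boussinesq.normX3 a s σ (u τ) ^ (2 * β / (2 * β - 1))) = ⊤) ∧
          (∀ t ∈ Set.Ico 0 Tstar,
            ENNReal.ofReal ((Real.exp (C * (Tstar - t)) - 1)⁻¹)
              ≤ Boussinesq.normPair a s σ (u t) (θ t) ^ (2 * α / (2 * α - 1))
                + Boussinesq.normPair a s σ (u t) (θ t) ^ (2 * β / (2 * β - 1))) := by
  obtain ⟨C, hw⟩ := Boussinesq.goodWeight hrange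
  obtain ⟨c, hc, hrate⟩ := hw.exists_blowup_rate hα hβ
  refine ⟨c, hc, fun u₀ θ₀ hu₀r hθ₀r hu₀d hu₀ hθ₀ T u θ h => ?_⟩
  obtain ⟨A, B, F, G, hs, hA, hB, hut⟩ := h.solution.exists_isFourierSolution hw hα hβ hu₀ hθ₀
  have hT := h.time_pos
  have e3 : ∀ t ∈ Set.Ico 0 T, Boussinesq.normX3 a s σ (u t) =
      Boussinesq.nrm (Boussinesq.weight a s σ) (Boussinesq.Duh α A F t) := fun t ht =>
    Boussinesq.normX3_eq (hut t ht).1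
  have eP : ∀ t ∈ Set.Ico 0 T, Boussinesq.normPair a s σ (u t) (θ t) =
      Boussinesq.energy (Boussinesq.weight a s σ) α β A B F G t := fun t ht => by
    rw [Boussinesq.normPair, e3 t ht, Boussinesq.normX_eq (hut t ht).2, Boussinesq.energy]
  have hp := Boussinesq.one_lt_exponent hα
  have hq := Boussinesq.one_lt_exponent hβ
  have hii : ∀ t ∈ Set.Ico 0 T,
      ∫⁻ τ in Set.Ico t T,
        (Boussinesq.normPair a s σ (u τ) (θ τ) ^ (2 * α / (2 * α - 1))
          + Boussinesq.normX3 a s σ (u τ) ^ (2 * β / (2 * β - 1))) = ⊤ := fun t ht => by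
    rw [← h.lintegral_rate_eq_top hw hα hβ hu₀r hθ₀r hu₀d hs hA hB hut ht]
    refine setLIntegral_congr_fun measurableSet_Ico fun τ hτ => ?_
    have hτ' : τ ∈ Set.Ico 0 T := ⟨ht.1.trans hτ.1, hτ.2⟩
    rw [eP τ hτ', e3 τ hτ', Boussinesq.rate]
  -- If the norm stayed below M near T, the integrand of ii would be bounded on a final interval of
  -- finite length, against `hii`.
  have hfreq : ∀ M : ℝ≥0∞, M < ⊤ →
      ∃ᶠ t in 𝓝[<] T, M < Boussinesq.normPair a s σ (u t) (θ t) := by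
    intro M hM hev
    simp only [not_lt] at hev
    obtain ⟨l, hl, hlT⟩ := (mem_nhdsLT_iff_exists_Ioo_subset' hT).1 hev
    set t := (max l 0 + T) / 2
    have hmax : max l 0 < T := max_lt hl hT
    have ht1 : max l 0 < t := by simp only [t]; linarith
    have ht : t ∈ Set.Ico 0 T := ⟨(le_max_right l 0).trans ht1.le, by simp only [t]; linarith⟩
    have hb : ∫⁻ τ in Set.Ico t T,
        (Boussinesq.normPair a s σ (u τ) (θ τ) ^ (2 * α / (2 * α - 1))
          + Boussinesq.normX3 a s σ (u τ) ^ (2 * β / (2 * β - 1))) ≤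
        ∫⁻ _ in Set.Ico t T, (M ^ (2 * α / (2 * α - 1)) + M ^ (2 * β / (2 * β - 1))) := by
      refine setLIntegral_mono' measurableSet_Ico fun τ hτ => ?_
      have hτM : Boussinesq.normPair a s σ (u τ) (θ τ) ≤ M :=
        hlT ⟨((le_max_left l 0).trans_lt ht1).trans_le hτ.1, hτ.2⟩
      exact add_le_add (ENNReal.rpow_le_rpow hτM (by linarith))
        (ENNReal.rpow_le_rpow (le_self_add.trans hτM) (by linarith))
    rw [hii t ht, setLIntegral_const, Real.volume_Ico, top_le_iff] at hb
    refine absurd hb (ENNReal.mul_lt_top (ENNReal.add_lt_top.2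
      ⟨ENNReal.rpow_lt_top_of_nonneg (by linarith) hM.ne,
        ENNReal.rpow_lt_top_of_nonneg (by linarith) hM.ne⟩) ENNReal.ofReal_lt_top).ne
  refine ⟨?_, hii, fun t ht => ?_⟩
  -- A limsup below some finite M would keep the norm below M near T.
  · by_contra hne
    obtain ⟨M, hM1, hM2⟩ := exists_between (lt_top_iff_ne_top.2 hne)
    exact hfreq M hM2 ((eventually_lt_of_limsup_lt hM1).mono fun t ht => not_lt.2 ht.le)
  · rw [eP t ht]
    refine hrate hs (fun M hM => ?_) t ht
    refine ((hfreq M hM).and_eventually (Ioo_mem_nhdsLT hT)).mono fun t ht => ?_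
    rw [← eP t ⟨ht.2.1.le, ht.2.2⟩]
    exact ht.1
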